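/- **Setting.** Let $l>0$, $\tau,\eta\in\mathbb R$, $\eta\neq0$, $\gamma>0$, $\omega\in\mathbb C$, $|\omega|=1$; put $\partial_\tau u=u'+{\rm i}\tau u$, $Du=\partial_\tau u(0)-\omega\,\partial_\tau u(l)$, $c=\Re({\rm e}^{{\rm i}\tau l}\overline\omega)$. In $H=L^2(0,l)\oplus\mathbb C$ let $A_{\max}(u,\beta)=(-\partial_\tau^2u,\ -\eta^{-1}Du+\gamma\eta^{-2}\beta)$ with domain $\{(u,\beta)\in W^{2,2}(0,l)\oplus\mathbb C:\ u(0)=\omega u(l)\}$, let $\Gamma_0(u,\beta)=Du$, $\Gamma_1(u,\beta)=\beta/\eta-u(0)$, let $A_\varkappa$ ($\varkappa\in\mathbb C$) be the restriction of $A_{\max}$ to $\{f:\Gamma_1f=\varkappa\Gamma_0f\}$, and let $A=A_0$. Let $\mathfrak m$ be the $M$-function, i.e. $\mathfrak m(z)\Gamma_0f=\Gamma_1f$ for $f\in\ker(A_{\max}-z)$, $z\in\mathbb C\setminus\mathbb R$, let $\mathfrak s(z)=1-2{\rm i}/({\rm i}+\mathfrak m(z))$, and let $\mu$ be the measure in the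 Nevanlinna representation $-1/\mathfrak m(z)=a+bz+\int_{\mathbb R}\bigl(\frac1{\sigma-z}-\frac{\sigma}{1+\sigma^2}\bigr)d\mu(\sigma)$, $\Im z>0$ (with $a\in\mathbb R$, $b\ge0$, $\int(1+\sigma^2)^{-1}d\mu<\infty$). **I.** The $M$-function exists, the measure $\mu$ exists and is unique, and for $\Im z>0$, with some constants $C_0,C_1\in\mathbb C$, $$\frac1{1+\mathfrak s(z)}=\frac12\Bigl(1+\frac{\rm i}{\mathfrak m(z)}\Bigr)=\frac12-\frac{{\rm i}\sqrt z\,(c-\cos\sqrt z\,l)(\eta^2z-\gamma)}{(\eta^2z-\gamma)\sin\sqrt z\,l+2\sqrt z\,(c-\cos\sqrt z\,l)}=C_0+C_1z-\frac{\rm i}2\int_{\mathbb R}\Bigl(\frac1{\sigma-z}-\frac\sigma{1+\sigma^2}\Bigr)d\mu(\sigma).$$ The solutions $\lambda>0$ of $$\cos\sqrt\lambda\,l-(\eta^2\lambda-\gamma)\frac{\sin\sqrt\lambda\,l}{2\sqrt\lambda}=c$$ form a strictly increasing sequence $\lambda_j\to\infty$, and $\mu=\sum_j\mu(\{\lambda_j\})\,\delta_{\lambda_j}$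 is purely discrete. If $\sin\sqrt{\lambda_j}\,l\ne0$, then $$\mu(\{\lambda_j\})=\frac{2(\eta^2\lambda_j-\gamma)^2}{\eta^2+\dfrac\gamma{\lambda_j}+2l+\dfrac l{\sqrt{\lambda_j}}(\eta^2\lambda_j-\gamma)\cot\sqrt{\lambda_j}\,l},$$ where the denominator is positive; if $\sin\sqrt{\lambda_j}\,l=0$, then $\mu(\{\lambda_j\})=0$. **II.** Suppose in addition that $c\neq\pm1$ and $\cos\bigl(\sqrt{\gamma/\eta^2}\,l\bigr)\ne c$ (equivalently, the minimal operator, i.e. the restriction of $A_{\max}$ to $\{\Gamma_0f=\Gamma_1f=0\}$, is simple). Then, for every $j$, $\sin\sqrt{\lambda_j}\,l\neq0$ and $\mu(\{\lambda_j\})>0$, so that the atoms of $\mu$ are exactly the $\lambda_j$; $\mathbb C\setminus\mathbb R$ lies in the resolvent set of $A$ and $\{\Im z>0\}$ in that of $A_{-{\rm i}}$; and there is a unitary operator $U:H\to L^2(\mathbb R,\pi\,d\mu)$ such that, for $f\in H$, $(Uf)(t)$ is, for $\mu$-almost every $t$, the limit as $z\to t$, $\Im z>0$, of $g_+(z)=-\pi^{-1/2}\,\Gamma_0(A_{-{\rm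 i}}-z)^{-1}f$, and, for all $z\in\mathbb C\setminus\mathbb R$, $$\bigl(U(A-z)^{-1}f\bigr)(t)=\frac{(Uf)(t)}{t-z}\quad\text{for $\mu$-a.e. }t.$$ For the generalised resolvent $\mathcal R(z)=P(A-z)^{-1}|_{L^2(0,l)}$, where $P$ is the orthogonal projection of $H$ onto $L^2(0,l)$ (identified with $L^2(0,l)\oplus\{0\}$), $$\langle\mathcal R(z)f,g\rangle_{L^2(0,l)}=\pi\int_{\mathbb R}\frac{U(f,0)(t)\,\overline{U(g,0)(t)}}{t-z}\,d\mu(t),\qquad f,g\in L^2(0,l),\ z\in\mathbb C\setminus\mathbb R.$$ **III.** Let $l_1,l_2,l_3,a_1,a_3,\varepsilon>0$, $l_1+l_2+l_3=1$, $\tau\in[-\pi,\pi)\setminus\{0\}$, and assume that $\xi_\tau=-\frac{a_1}{l_1}{\rm e}^{{\rm i}\tau(l_1+l_3)}-\frac{a_3}{l_3}{\rm e}^{-{\rm i}\tau l_2}\ne0$. Let $\mathcal A^\tau_{\rm hom}$ be the operator in $L^2(0,l_2)\oplus\mathbb C$ with domain $\bigl\{(u,\beta):u\in W^{2,2}(0,l_2),\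 u(0)=-\frac{\overline\xi_\tau}{|\xi_\tau|}u(l_2)=\frac{\beta}{\sqrt{l_1+l_3}}\bigr\}$ and action $$\mathcal A^\tau_{\rm hom}\binom u\beta=\binom{-\partial_\tau^2u}{-\frac1{\sqrt{l_1+l_3}}\bigl(\partial_\tau u(0)+\frac{\overline\xi_\tau}{|\xi_\tau|}\partial_\tau u(l_2)\bigr)+(l_1+l_3)^{-1}\bigl(\frac{l_1}{a_1}+\frac{l_3}{a_3}\bigr)^{-1}\bigl(\frac\tau\varepsilon\bigr)^2\beta}.$$ Then $\mathcal A^\tau_{\rm hom}$ equals $A$ with $l=l_2$, $\eta=\sqrt{l_1+l_3}$, $\gamma=(l_1/a_1+l_3/a_3)^{-1}(\tau/\varepsilon)^2$, $\omega=-\overline\xi_\tau/|\xi_\tau|$, so that I applies to it; the equation for the $\lambda_j$ becomes $$\cos\sqrt{\lambda}\,l_2-\Bigl\{(l_1+l_3)\lambda-\Bigl(\frac{l_1}{a_1}+\frac{l_3}{a_3}\Bigr)^{-1}\Bigl(\frac\tau\varepsilon\Bigr)^2\Bigr\}\frac{\sin\sqrt{\lambda}\,l_2}{2\sqrt{\lambda}}=\frac{\frac{a_1}{l_1}\cos\tau+\frac{a_3}{l_3}}{\sqrt{\bigl(\frac{a_1}{l_1}\cos\tau+\frac{a_3}{l_3}\bigr)^2+\frac{a_1^2}{l_1^2}\sin^2\tau}},$$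 and if $a_1=a_3=a$ and $l_1=l_3$ it becomes $$\cos\sqrt{\lambda}\,l_2-\Bigl\{(1-l_2)\lambda-\frac a{1-l_2}\Bigl(\frac\tau\varepsilon\Bigr)^2\Bigr\}\frac{\sin\sqrt{\lambda}\,l_2}{2\sqrt{\lambda}}=|\cos(\tau/2)|.$$ Under the conditions of II for these parameters, the spectral representation of II holds for $(\mathcal A^\tau_{\rm hom}-z)^{-1}$ and for its generalised resolvent $\mathcal R^\tau_{\rm hom}(z)=P(\mathcal A^\tau_{\rm hom}-z)^{-1}|_{L^2(0,l_2)}$. -/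

import Mathlib

open MeasureTheory Filter Topology Set

namespace StrausModel

noncomputable section

/-! ### The spaces -/

/-- `L²(0, l)`. -/
abbrev L2 (l : ℝ) := Lp ℂ 2 (volume.restrict (Ioo (0 : ℝ) l))

/-- The Hilbert space `H = L²(0, l) ⊕ ℂ`. -/
abbrev PairSpace (l : ℝ) := WithLp 2 (L2 l × ℂ)

/-- `u` has the absolutely continuous representative `U` on `[0, l]`, with derivative
`v ∈ L²(0, l)`. -/
structure HasDerivL2 (l : ℝ) (u : L2 l) (U : ℝ → ℂ) (v : L2 l) : Prop where
  ae_eq : ∀ᵐ x ∂(volume.restrict (Ioo (0 : ℝ) l)), u x = U x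
  eq_integral : ∀ x ∈ Icc (0 : ℝ) l, U x = U 0 + ∫ t in (0 : ℝ)..x, v t

theorem intervalIntegrable_L2 {l : ℝ} (v : L2 l) {x : ℝ} (hx : x ∈ Icc (0 : ℝ) l) :
    IntervalIntegrable v volume 0 x := by
  have h1 : IntegrableOn v (Ioo (0 : ℝ) l) volume :=
    (Lp.memLp v).integrable (by norm_num)
  rw [intervalIntegrable_iff_integrableOn_Ioo_of_le hx.1]
  exact h1.mono_set (Ioo_subset_Ioo_right hx.2)

theorem integral_congr_L2 {l : ℝ} {f g : ℝ → ℂ}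
    (h : ∀ᵐ x ∂(volume.restrict (Ioo (0 : ℝ) l)), f x = g x) {x : ℝ}
    (hx : x ∈ Icc (0 : ℝ) l) : ∫ t in (0 : ℝ)..x, f t = ∫ t in (0 : ℝ)..x, g t := by
  rw [intervalIntegral.integral_of_le hx.1, intervalIntegral.integral_of_le hx.1,
    integral_Ioc_eq_integral_Ioo, integral_Ioc_eq_integral_Ioo]
  exact integral_congr_ae (ae_restrict_of_ae_restrict_of_subset (Ioo_subset_Ioo_right hx.2) h)

theorem HasDerivL2.add {l : ℝ} {u₁ u₂ v₁ v₂ : L2 l} {U₁ U₂ : ℝ → ℂ}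
    (h₁ : HasDerivL2 l u₁ U₁ v₁) (h₂ : HasDerivL2 l u₂ U₂ v₂) :
    HasDerivL2 l (u₁ + u₂) (fun x => U₁ x + U₂ x) (v₁ + v₂) where
  ae_eq := by
    filter_upwards [h₁.ae_eq, h₂.ae_eq, Lp.coeFn_add u₁ u₂] with x e₁ e₂ e₃
    rw [e₃, Pi.add_apply, e₁, e₂]
  eq_integral x hx := by
    have e : ∫ t in (0 : ℝ)..x, (v₁ + v₂ : L2 l) t = ∫ t in (0 : ℝ)..x, (v₁ t + v₂ t) :=
      integral_congr_L2 (Lp.coeFn_add v₁ v₂) hx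
    rw [e, intervalIntegral.integral_add (intervalIntegrable_L2 v₁ hx)
      (intervalIntegrable_L2 v₂ hx), h₁.eq_integral x hx, h₂.eq_integral x hx]
    ring

theorem HasDerivL2.smul {l : ℝ} (c : ℂ) {u v : L2 l} {U : ℝ → ℂ} (h : HasDerivL2 l u U v) :
    HasDerivL2 l (c • u) (fun x => c * U x) (c • v) where
  ae_eq := by
    filter_upwards [h.ae_eq, Lp.coeFn_smul c u] with x e₁ e₂
    rw [e₂, Pi.smul_apply, e₁, smul_eq_mul]
  eq_integral x hx := by
    have e : ∫ t in (0 : ℝ)..x, (c • v : L2 l) t = ∫ t in (0 : ℝ)..x, c * v t :=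
      integral_congr_L2 (Lp.coeFn_smul c v) hx
    rw [e, intervalIntegral.integral_const_mul, h.eq_integral x hx]
    ring

theorem HasDerivL2.zero (l : ℝ) : HasDerivL2 l 0 (fun _ => 0) 0 := by
  have hz := Lp.coeFn_zero ℂ 2 (volume.restrict (Ioo (0 : ℝ) l))
  refine ⟨hz, fun x hx => ?_⟩
  have e : ∫ t in (0 : ℝ)..x, (0 : L2 l) t = ∫ t in (0 : ℝ)..x, (0 : ℂ) :=
    integral_congr_L2 hz hx
  rw [e]; simp

/-- Uniqueness of the representative and of the derivative. -/
theorem HasDerivL2.eq_zero {l : ℝ} (hl : 0 < l) {v : L2 l} {U : ℝ → ℂ}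
    (h : HasDerivL2 l 0 U v) : (∀ x ∈ Icc (0 : ℝ) l, U x = 0) ∧ v = 0 := by
  have hint : IntervalIntegrable v volume 0 l := intervalIntegrable_L2 v ⟨hl.le, le_rfl⟩
  have hcont : ContinuousOn U (Icc (0 : ℝ) l) := by
    have h1 : ContinuousOn (fun x => U 0 + ∫ t in (0 : ℝ)..x, v t) (Icc (0 : ℝ) l) := by
      have := intervalIntegral.continuousOn_primitive_interval
        (μ := volume) (f := v) (a := 0) (b := l)
        (by rw [uIcc_of_le hl.le, integrableOn_Icc_iff_integrableOn_Ioo]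
            exact (intervalIntegrable_iff_integrableOn_Ioo_of_le hl.le).1 hint)
      rw [uIcc_of_le hl.le] at this
      exact continuousOn_const.add this
    exact h1.congr h.eq_integral
  have hU0 : ∀ᵐ x ∂(volume.restrict (Ioo (0 : ℝ) l)), U x = 0 := by
    filter_upwards [h.ae_eq, Lp.coeFn_zero ℂ 2 (volume.restrict (Ioo (0 : ℝ) l))] with x e₁ e₂
    rw [← e₁, e₂]; rfl
  have hU : ∀ x ∈ Icc (0 : ℝ) l, U x = 0 := by
    refine Measure.eqOn_Icc_of_ae_eq volume hl.ne (g := fun _ => 0) ?_ hcont continuousOn_const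
    rw [restrict_Ioo_eq_restrict_Icc] at hU0
    exact hU0
  refine ⟨hU, ?_⟩
  have hprim : ∀ x ∈ Icc (0 : ℝ) l, ∫ t in (0 : ℝ)..x, v t = 0 := by
    intro x hx
    have := h.eq_integral x hx
    rw [hU x hx, hU 0 ⟨le_rfl, hl.le⟩, zero_add] at this
    exact this.symm
  rw [Lp.eq_zero_iff_ae_eq_zero]
  have hae := hint.ae_hasDerivAt_integral
  filter_upwards [ae_restrict_of_ae hae, ae_restrict_mem measurableSet_Ioo] with x hx hxm
  rw [uIcc_of_le hl.le] at hx
  have hd := hx (Ioo_subset_Icc_self hxm) 0 ⟨le_rfl, hl.le⟩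
  have h0 : HasDerivAt (fun y => ∫ t in (0 : ℝ)..y, v t) 0 x := by
    refine (hasDerivAt_const x (0 : ℂ)).congr_of_eventuallyEq ?_
    filter_upwards [Ioo_mem_nhds hxm.1 hxm.2] with y hy
    exact hprim y (Ioo_subset_Icc_self hy)
  simpa using hd.unique h0

/-- The Sobolev space `W^{1,2}(0, l)`. -/
def W12 (l : ℝ) : Submodule ℂ (L2 l) where
  carrier := {u | ∃ U v, HasDerivL2 l u U v}
  zero_mem' := ⟨_, _, HasDerivL2.zero l⟩
  add_mem' := by
    rintro _ _ ⟨_, _, h₁⟩ ⟨_, _, h₂⟩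
    exact ⟨_, _, h₁.add h₂⟩
  smul_mem' := by
    rintro c _ ⟨_, _, h⟩
    exact ⟨_, _, h.smul c⟩

open Classical in
/-- The continuous representative on `[0, l]` of `u ∈ W^{1,2}(0, l)`; so `rep u 0` and `rep u l`
are the boundary values of `u` (and `rep u = 0` by convention if `u ∉ W^{1,2}`). -/
def rep {l : ℝ} (u : L2 l) : ℝ → ℂ :=
  if h : ∃ U v, HasDerivL2 l u U v then h.choose else 0

open Classical in
/-- The derivative of `u ∈ W^{1,2}(0, l)`
(and `0` by convention if `u ∉ W^{1,2}`). -/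
def wderiv {l : ℝ} (u : L2 l) : L2 l :=
  if h : ∃ U v, HasDerivL2 l u U v then h.choose_spec.choose else 0

theorem hasDerivL2_rep {l : ℝ} {u : L2 l} (hu : u ∈ W12 l) :
    HasDerivL2 l u (rep u) (wderiv u) := by
  have h : ∃ U v, HasDerivL2 l u U v := hu
  simp only [rep, wderiv, dif_pos h]
  exact h.choose_spec.choose_spec

theorem HasDerivL2.unique {l : ℝ} (hl : 0 < l) {u v : L2 l} {U : ℝ → ℂ}
    (h : HasDerivL2 l u U v) : (∀ x ∈ Icc (0 : ℝ) l, rep u x = U x) ∧ wderiv u = v := by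
  have h₁ := (hasDerivL2_rep ⟨U, v, h⟩).add (h.smul (-1))
  have e : u + (-1 : ℂ) • u = 0 := by simp
  rw [e] at h₁
  obtain ⟨a, b⟩ := h₁.eq_zero hl
  refine ⟨fun x hx => ?_, ?_⟩
  · linear_combination a x hx
  · rw [neg_one_smul, add_neg_eq_zero] at b
    exact b

theorem rep_add {l : ℝ} (hl : 0 < l) {u v : L2 l} (hu : u ∈ W12 l) (hv : v ∈ W12 l)
    {x : ℝ} (hx : x ∈ Icc (0 : ℝ) l) : rep (u + v) x = rep u x + rep v x :=
  (((hasDerivL2_rep hu).add (hasDerivL2_rep hv)).unique hl).1 x hx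

theorem rep_smul {l : ℝ} (hl : 0 < l) (c : ℂ) {u : L2 l} (hu : u ∈ W12 l)
    {x : ℝ} (hx : x ∈ Icc (0 : ℝ) l) : rep (c • u) x = c * rep u x :=
  (((hasDerivL2_rep hu).smul c).unique hl).1 x hx

theorem rep_zero {l : ℝ} (hl : 0 < l) {x : ℝ} (hx : x ∈ Icc (0 : ℝ) l) :
    rep (0 : L2 l) x = 0 :=
  ((HasDerivL2.zero l).unique hl).1 x hx

theorem wderiv_add {l : ℝ} (hl : 0 < l) {u v : L2 l} (hu : u ∈ W12 l) (hv : v ∈ W12 l) :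
    wderiv (u + v) = wderiv u + wderiv v :=
  (((hasDerivL2_rep hu).add (hasDerivL2_rep hv)).unique hl).2

theorem wderiv_smul {l : ℝ} (hl : 0 < l) (c : ℂ) {u : L2 l} (hu : u ∈ W12 l) :
    wderiv (c • u) = c • wderiv u :=
  (((hasDerivL2_rep hu).smul c).unique hl).2

theorem wderiv_zero {l : ℝ} (hl : 0 < l) : wderiv (0 : L2 l) = 0 :=
  ((HasDerivL2.zero l).unique hl).2

/-- Membership in the Sobolev space `W^{2,2}(0, l)`. -/
def MemW22 {l : ℝ} (u : L2 l) : Prop := u ∈ W12 l ∧ wderiv u ∈ W12 l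

/-- `∂_τ u = u' + i τ u`. -/
def dTau {l : ℝ} (τ : ℝ) (u : L2 l) : L2 l := wderiv u + (Complex.I * τ) • u

theorem MemW22.dTau_mem {l : ℝ} (τ : ℝ) {u : L2 l} (h : MemW22 u) : dTau τ u ∈ W12 l :=
  (W12 l).add_mem h.2 ((W12 l).smul_mem _ h.1)

theorem MemW22.add {l : ℝ} (hl : 0 < l) {u v : L2 l} (hu : MemW22 u) (hv : MemW22 v) :
    MemW22 (u + v) :=
  ⟨(W12 l).add_mem hu.1 hv.1, by
    rw [wderiv_add hl hu.1 hv.1]; exact (W12 l).add_mem hu.2 hv.2⟩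

theorem MemW22.smul {l : ℝ} (hl : 0 < l) (c : ℂ) {u : L2 l} (hu : MemW22 u) :
    MemW22 (c • u) :=
  ⟨(W12 l).smul_mem c hu.1, by
    rw [wderiv_smul hl c hu.1]; exact (W12 l).smul_mem c hu.2⟩

theorem MemW22.zero {l : ℝ} (hl : 0 < l) : MemW22 (0 : L2 l) :=
  ⟨(W12 l).zero_mem, by rw [wderiv_zero hl]; exact (W12 l).zero_mem⟩

theorem dTau_add {l : ℝ} (hl : 0 < l) (τ : ℝ) {u v : L2 l} (hu : u ∈ W12 l) (hv : v ∈ W12 l) :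
    dTau τ (u + v) = dTau τ u + dTau τ v := by
  simp only [dTau, wderiv_add hl hu hv, smul_add]; abel

theorem dTau_smul {l : ℝ} (hl : 0 < l) (τ : ℝ) (c : ℂ) {u : L2 l} (hu : u ∈ W12 l) :
    dTau τ (c • u) = c • dTau τ u := by
  simp only [dTau, wderiv_smul hl c hu, smul_add, smul_comm c]

/-! ### The operators -/

/-- The parameters of the model operator, with the standing assumptions on them. -/
structure ModelParams where
  l : ℝ
  τ : ℝ
  η : ℝ
  γ : ℝ
  ω : ℂ
  l_pos : 0 < l
  η_ne : η ≠ 0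
  γ_pos : 0 < γ
  norm_ω : ‖ω‖ = 1

namespace ModelParams

variable (p : ModelParams)

/-- `D u = ∂_τ u(0) - ω ∂_τ u(l)`. -/
def bdryD (u : L2 p.l) : ℂ := rep (dTau p.τ u) 0 - p.ω * rep (dTau p.τ u) p.l

theorem bdryD_add {u v : L2 p.l} (hu : MemW22 u) (hv : MemW22 v) :
    p.bdryD (u + v) = p.bdryD u + p.bdryD v := by
  have hl := p.l_pos
  simp only [bdryD]
  rw [dTau_add hl _ hu.1 hv.1,
    rep_add hl (hu.dTau_mem _) (hv.dTau_mem _) ⟨le_rfl, hl.le⟩,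
    rep_add hl (hu.dTau_mem _) (hv.dTau_mem _) ⟨hl.le, le_rfl⟩]
  ring

theorem bdryD_smul (c : ℂ) {u : L2 p.l} (hu : MemW22 u) :
    p.bdryD (c • u) = c * p.bdryD u := by
  have hl := p.l_pos
  simp only [bdryD]
  rw [dTau_smul hl _ _ hu.1,
    rep_smul hl _ (hu.dTau_mem _) ⟨le_rfl, hl.le⟩,
    rep_smul hl _ (hu.dTau_mem _) ⟨hl.le, le_rfl⟩]
  ring

/-- The maximal operator: `(u, β) ↦ (-∂_τ² u, -η⁻¹ D u + γ η⁻² β)` on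
`{(u, β) : u ∈ W^{2,2}(0, l), u(0) = ω u(l)}`. -/
def maxOp : PairSpace p.l →ₗ.[ℂ] PairSpace p.l where
  domain :=
    { carrier := {f | MemW22 f.fst ∧ rep f.fst 0 = p.ω * rep f.fst p.l}
      zero_mem' := by
        have hl := p.l_pos
        refine ⟨MemW22.zero hl, ?_⟩
        rw [WithLp.zero_fst, rep_zero hl ⟨le_rfl, hl.le⟩, rep_zero hl ⟨hl.le, le_rfl⟩, mul_zero]
      add_mem' := by
        rintro f g ⟨hf, ef⟩ ⟨hg, eg⟩
        have hl := p.l_pos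
        refine ⟨hf.add hl hg, ?_⟩
        rw [WithLp.add_fst, rep_add hl hf.1 hg.1 ⟨le_rfl, hl.le⟩,
          rep_add hl hf.1 hg.1 ⟨hl.le, le_rfl⟩, ef, eg, mul_add]
      smul_mem' := by
        rintro c f ⟨hf, ef⟩
        have hl := p.l_pos
        refine ⟨hf.smul hl c, ?_⟩
        rw [WithLp.smul_fst, rep_smul hl c hf.1 ⟨le_rfl, hl.le⟩,
          rep_smul hl c hf.1 ⟨hl.le, le_rfl⟩, ef]
        ring }
  toFun :=
    { toFun := fun f => WithLp.toLp 2
        (-(dTau p.τ (dTau p.τ f.1.fst)),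
          -((p.η : ℂ)⁻¹ * p.bdryD f.1.fst) + p.γ * ((p.η : ℂ) ^ 2)⁻¹ * f.1.snd)
      map_add' := by
        rintro ⟨f, hf, _⟩ ⟨g, hg, _⟩
        have hl := p.l_pos
        refine (WithLp.ofLp_injective 2) (Prod.ext ?_ ?_)
        · change -(dTau p.τ (dTau p.τ (f + g).fst)) =
            -(dTau p.τ (dTau p.τ f.fst)) + -(dTau p.τ (dTau p.τ g.fst))
          rw [WithLp.add_fst, dTau_add hl _ hf.1 hg.1,
            dTau_add hl _ (hf.dTau_mem _) (hg.dTau_mem _), neg_add]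
        · change -((p.η : ℂ)⁻¹ * p.bdryD (f + g).fst) + p.γ * ((p.η : ℂ) ^ 2)⁻¹ * (f + g).snd =
            (-((p.η : ℂ)⁻¹ * p.bdryD f.fst) + p.γ * ((p.η : ℂ) ^ 2)⁻¹ * f.snd) +
            (-((p.η : ℂ)⁻¹ * p.bdryD g.fst) + p.γ * ((p.η : ℂ) ^ 2)⁻¹ * g.snd)
          rw [WithLp.add_fst, WithLp.add_snd, p.bdryD_add hf hg]
          ring
      map_smul' := by
        rintro c ⟨f, hf, _⟩
        have hl := p.l_pos
        refine (WithLp.ofLp_injective 2) (Prod.ext ?_ ?_)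
        · change -(dTau p.τ (dTau p.τ (c • f).fst)) = c • -(dTau p.τ (dTau p.τ f.fst))
          rw [WithLp.smul_fst, dTau_smul hl _ _ hf.1, dTau_smul hl _ _ (hf.dTau_mem _), smul_neg]
        · change -((p.η : ℂ)⁻¹ * p.bdryD (c • f).fst) + p.γ * ((p.η : ℂ) ^ 2)⁻¹ * (c • f).snd =
            c • (-((p.η : ℂ)⁻¹ * p.bdryD f.fst) + p.γ * ((p.η : ℂ) ^ 2)⁻¹ * f.snd)
          rw [WithLp.smul_fst, WithLp.smul_snd, p.bdryD_smul c hf, smul_eq_mul, smul_eq_mul]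
          ring }

/-- The boundary map `Γ₀ (u, β) = D u`. -/
def Gamma0 (f : PairSpace p.l) : ℂ := p.bdryD f.fst

/-- The boundary map `Γ₁ (u, β) = β / η - u(0)`. -/
def Gamma1 (f : PairSpace p.l) : ℂ := f.snd / p.η - rep f.fst 0

/-- The extension `A_ϰ`, the restriction of the maximal operator to `Γ₁ f = ϰ Γ₀ f`. -/
def extOp (ϰ : ℂ) : PairSpace p.l →ₗ.[ℂ] PairSpace p.l where
  domain :=
    { carrier := {f | f ∈ p.maxOp.domain ∧ p.Gamma1 f = ϰ * p.Gamma0 f}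
      zero_mem' := by
        have hl := p.l_pos
        refine ⟨p.maxOp.domain.zero_mem, ?_⟩
        have h := p.bdryD_smul 0 (MemW22.zero hl)
        rw [zero_smul, zero_mul] at h
        simp only [Gamma1, Gamma0, WithLp.zero_fst, WithLp.zero_snd]
        rw [h, rep_zero hl ⟨le_rfl, hl.le⟩]
        simp
      add_mem' := by
        rintro f g ⟨hf, ef⟩ ⟨hg, eg⟩
        have hl := p.l_pos
        refine ⟨p.maxOp.domain.add_mem hf hg, ?_⟩
        simp only [Gamma1, Gamma0] at ef eg ⊢
        rw [WithLp.add_fst, WithLp.add_snd, p.bdryD_add hf.1 hg.1,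
          rep_add hl hf.1.1 hg.1.1 ⟨le_rfl, hl.le⟩]
        linear_combination ef + eg
      smul_mem' := by
        rintro c f ⟨hf, ef⟩
        have hl := p.l_pos
        refine ⟨p.maxOp.domain.smul_mem c hf, ?_⟩
        simp only [Gamma1, Gamma0] at ef ⊢
        rw [WithLp.smul_fst, WithLp.smul_snd, p.bdryD_smul c hf.1,
          rep_smul hl c hf.1.1 ⟨le_rfl, hl.le⟩, smul_eq_mul]
        linear_combination c * ef }
  toFun := p.maxOp.toFun.comp (Submodule.inclusion fun _ h => h.1)

/-- The operator `A = A_0`; its domain is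
`{(u, β) : u ∈ W^{2,2}(0, l), u(0) = ω u(l), η u(0) = β}`. -/
def modelOp : PairSpace p.l →ₗ.[ℂ] PairSpace p.l := p.extOp 0

/-- `Re (e^{iτl} \bar ω)`. -/
def cosAngle : ℝ := (Complex.exp (Complex.I * p.τ * p.l) * (starRingEnd ℂ) p.ω).re

end ModelParams

/-! ### Resolvents -/

/-- `R = (T - z)⁻¹` as an everywhere defined bounded operator. -/
def IsResolvent {H : Type*} [NormedAddCommGroup H] [NormedSpace ℂ H] (T : H →ₗ.[ℂ] H) (z : ℂ)
    (R : H →L[ℂ] H) : Prop :=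
  ∀ f h : H, R h = f ↔ ∃ hf : f ∈ T.domain, T ⟨f, hf⟩ - z • f = h

/-- `z` belongs to the resolvent set of `T`. -/
def InResolventSet {H : Type*} [NormedAddCommGroup H] [NormedSpace ℂ H] (T : H →ₗ.[ℂ] H)
    (z : ℂ) : Prop := ∃ R : H →L[ℂ] H, IsResolvent T z R

open Classical in
/-- The resolvent `(T - z)⁻¹` (and `0` by convention outside the resolvent set). -/
def resolventOp {H : Type*} [NormedAddCommGroup H] [NormedSpace ℂ H] (T : H →ₗ.[ℂ] H)
    (z : ℂ) : H →L[ℂ] H := if h : InResolventSet T z then h.choose else 0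

/-- The generalised resolvent `P (T - z)⁻¹ |_{L²(0, l)}` of an operator `T` in `L²(0, l) ⊕ ℂ`. -/
def genResolvent {l : ℝ} (T : PairSpace l →ₗ.[ℂ] PairSpace l) (z : ℂ) (f : L2 l) : L2 l :=
  (resolventOp T z (WithLp.toLp 2 (f, 0))).fst

/-! ### The `M`-function, the characteristic function and the spectral measure -/

/-- `m` is the `M`-function of the maximal operator for the triple `(ℂ, Γ₀, Γ₁)`:
`m(z) Γ₀ f = Γ₁ f` on `ker (A_max - z)` for all non-real `z`
(where `Γ₀` does not vanish identically, so that `m(z)` is determined). -/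
def IsMFunction (p : ModelParams) (m : ℂ → ℂ) : Prop :=
  ∀ z : ℂ, z.im ≠ 0 →
    (∃ f : p.maxOp.domain, p.maxOp f = z • (f : PairSpace p.l) ∧ p.Gamma0 f ≠ 0) ∧
    ∀ f : p.maxOp.domain, p.maxOp f = z • (f : PairSpace p.l) →
      m z * p.Gamma0 f = p.Gamma1 f

/-- The characteristic function `s(z) = 1 - 2i / (i + m(z))`. -/
def charFun (m : ℂ → ℂ) (z : ℂ) : ℂ := 1 - 2 * Complex.I / (Complex.I + m z)

/-- The kernel `1 / (σ - z) - σ / (1 + σ²)` of the Nevanlinna representation. -/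
def nevKernel (z : ℂ) (σ : ℝ) : ℂ := 1 / (σ - z) - σ / (1 + (σ : ℂ) ^ 2)

/-- `μ` is the measure of the Nevanlinna representation
`F(z) = a + b z + ∫ (1 / (σ - z) - σ / (1 + σ²)) dμ(σ)`, `Im z > 0`, of `F`. -/
def IsNevanlinnaMeasure (F : ℂ → ℂ) (μ : Measure ℝ) : Prop :=
  ∫⁻ σ, ENNReal.ofReal (1 / (1 + σ ^ 2)) ∂μ < ⊤ ∧
    ∃ a b : ℝ, 0 ≤ b ∧ ∀ z : ℂ, 0 < z.im → F z = a + b * z + ∫ σ, nevKernel z σ ∂μ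

namespace ModelParams

variable (p : ModelParams)

/-- The dispersion relation
`cos (√x l) - (η² x - γ) sin (√x l) / (2 √x) = Re (e^{iτl} \bar ω)`. -/
def Dispersion (x : ℝ) : Prop :=
  Real.cos (√x * p.l) - (p.η ^ 2 * x - p.γ) * (Real.sin (√x * p.l) / (2 * √x)) = p.cosAngle

/-- The denominator of the mass formula. -/
def massDenom (x : ℝ) : ℝ :=
  p.η ^ 2 + p.γ / x + 2 * p.l + p.l / √x * (p.η ^ 2 * x - p.γ) * Real.cot (√x * p.l)

/-- The non-degeneracy conditions `Re (e^{iτl} \bar ω) ≠ ±1` and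
`cos (√(γ/η²) l) ≠ Re (e^{iτl} \bar ω)`: they exclude exactly the parameters for which the minimal
operator (the restriction of the maximal one to `Γ₀ f = Γ₁ f = 0`) has an eigenvector, that is,
fails to be simple. -/
def Nondegenerate : Prop :=
  p.cosAngle ^ 2 ≠ 1 ∧ Real.cos (√(p.γ / p.η ^ 2) * p.l) ≠ p.cosAngle

/-- `g_+(z) = -π^{-1/2} Γ₀ (A_{-i} - z)⁻¹ f`, `Im z > 0`, the image of `f ∈ H` in the model
space `H²₊ ⊖ s H²₊`. -/
def gPlus (f : PairSpace p.l) (z : ℂ) : ℂ :=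
  -(1 / (√Real.pi : ℂ)) * p.Gamma0 (resolventOp (p.extOp (-Complex.I)) z f)

end ModelParams

/-- The unitary `U : H → L²(ℝ, π dμ)` is given by the boundary values of `g_+`, it turns the
resolvent of `T` into the multiplication by `(t - z)⁻¹`, and represents the generalised
resolvent of `T` accordingly. -/
structure IsFunctionalModel (p : ModelParams) (T : PairSpace p.l →ₗ.[ℂ] PairSpace p.l)
    (μ : Measure ℝ)
    (U : PairSpace p.l ≃ₗᵢ[ℂ] Lp ℂ 2 (ENNReal.ofReal Real.pi • μ)) : Prop where
  mem_resolventSet_ext : ∀ z : ℂ, 0 < z.im → InResolventSet (p.extOp (-Complex.I)) z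
  boundary_values : ∀ f : PairSpace p.l, ∀ᵐ (t : ℝ) ∂μ,
    Tendsto (p.gPlus f) (𝓝[{z : ℂ | 0 < z.im}] (t : ℂ)) (𝓝 (U f t))
  mem_resolventSet : ∀ z : ℂ, z.im ≠ 0 → InResolventSet T z
  resolvent : ∀ z : ℂ, z.im ≠ 0 → ∀ f : PairSpace p.l, ∀ᵐ (t : ℝ) ∂μ,
    U (resolventOp T z f) t = ((t : ℂ) - z)⁻¹ * U f t
  generalised_resolvent : ∀ z : ℂ, z.im ≠ 0 → ∀ f g : L2 p.l,
    inner ℂ g (genResolvent T z f) =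
      (Real.pi : ℂ) * ∫ t : ℝ, ((t : ℂ) - z)⁻¹ * U (WithLp.toLp 2 (f, 0)) t *
        (starRingEnd ℂ) (U (WithLp.toLp 2 (g, 0)) t) ∂μ

/-! ### The homogenised operator -/

/-- The data of the homogenised operator of the high-contrast graph, with `τ ≠ 0` (that is,
`γ > 0`) and `ξ_τ ≠ 0`. -/
structure HomParams where
  l₁ : ℝ
  l₂ : ℝ
  l₃ : ℝ
  a₁ : ℝ
  a₃ : ℝ
  ε : ℝ
  τ : ℝ
  l₁_pos : 0 < l₁
  l₂_pos : 0 < l₂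
  l₃_pos : 0 < l₃
  sum_l : l₁ + l₂ + l₃ = 1
  a₁_pos : 0 < a₁
  a₃_pos : 0 < a₃
  ε_pos : 0 < ε
  τ_mem : τ ∈ Ico (-Real.pi) Real.pi
  τ_ne : τ ≠ 0
  ξ_ne : -((a₁ / l₁ : ℝ) : ℂ) * Complex.exp (Complex.I * τ * (l₁ + l₃)) -
    ((a₃ / l₃ : ℝ) : ℂ) * Complex.exp (-(Complex.I * τ * l₂)) ≠ 0

namespace HomParams

variable (q : HomParams)

/-- `ξ_τ = -(a₁/l₁) e^{iτ(l₁+l₃)} - (a₃/l₃) e^{-iτl₂}`. -/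
def ξ : ℂ := -((q.a₁ / q.l₁ : ℝ) : ℂ) * Complex.exp (Complex.I * q.τ * (q.l₁ + q.l₃)) -
    ((q.a₃ / q.l₃ : ℝ) : ℂ) * Complex.exp (-(Complex.I * q.τ * q.l₂))

/-- The coefficient `(l₁/a₁ + l₃/a₃)⁻¹ (τ/ε)²`. -/
def γ : ℝ := (q.l₁ / q.a₁ + q.l₃ / q.a₃)⁻¹ * (q.τ / q.ε) ^ 2

/-- `\bar ξ_τ / |ξ_τ|`. -/
def phase : ℂ := (starRingEnd ℂ) q.ξ / (‖q.ξ‖ : ℂ)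

/-- The parameters `l = l₂`, `η = √(l₁ + l₃)`, `γ = (l₁/a₁ + l₃/a₃)⁻¹ (τ/ε)²`,
`ω = -\bar ξ_τ / |ξ_τ|` of the corresponding model operator. -/
def toModel : ModelParams where
  l := q.l₂
  τ := q.τ
  η := √(q.l₁ + q.l₃)
  γ := q.γ
  ω := -q.phase
  l_pos := q.l₂_pos
  η_ne := (Real.sqrt_pos.2 (add_pos q.l₁_pos q.l₃_pos)).ne'
  γ_pos := by
    have h₁ := div_pos q.l₁_pos q.a₁_pos
    have h₂ := div_pos q.l₃_pos q.a₃_pos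
    have h₃ : q.τ / q.ε ≠ 0 := div_ne_zero q.τ_ne q.ε_pos.ne'
    unfold γ
    positivity
  norm_ω := by
    have h : ‖q.ξ‖ ≠ 0 := norm_ne_zero_iff.2 q.ξ_ne
    simp [phase, h]

/-- The homogenised operator: on
`{(u, β) : u ∈ W^{2,2}(0, l₂), u(0) = -(\bar ξ_τ/|ξ_τ|) u(l₂) = β / √(l₁ + l₃)}` it acts as
`(u, β) ↦ (-∂_τ² u, -(l₁+l₃)^{-1/2} (∂_τ u(0) + (\bar ξ_τ/|ξ_τ|) ∂_τ u(l₂))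
  + (l₁+l₃)⁻¹ (l₁/a₁ + l₃/a₃)⁻¹ (τ/ε)² β)`. -/
def homOp : PairSpace q.l₂ →ₗ.[ℂ] PairSpace q.l₂ where
  domain :=
    { carrier := {f | MemW22 f.fst ∧ rep f.fst 0 = -q.phase * rep f.fst q.l₂ ∧
        -q.phase * rep f.fst q.l₂ = f.snd / (√(q.l₁ + q.l₃) : ℂ)}
      zero_mem' := by
        have hl := q.l₂_pos
        refine ⟨MemW22.zero hl, ?_⟩
        rw [WithLp.zero_fst, WithLp.zero_snd, rep_zero hl ⟨le_rfl, hl.le⟩,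
          rep_zero hl ⟨hl.le, le_rfl⟩]
        simp
      add_mem' := by
        rintro f g ⟨hf, ef, ef'⟩ ⟨hg, eg, eg'⟩
        have hl := q.l₂_pos
        refine ⟨hf.add hl hg, ?_⟩
        rw [WithLp.add_fst, WithLp.add_snd, rep_add hl hf.1 hg.1 ⟨le_rfl, hl.le⟩,
          rep_add hl hf.1 hg.1 ⟨hl.le, le_rfl⟩]
        exact ⟨by linear_combination ef + eg, by linear_combination ef' + eg'⟩
      smul_mem' := by
        rintro c f ⟨hf, ef, ef'⟩
        have hl := q.l₂_pos
        refine ⟨hf.smul hl c, ?_⟩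
        rw [WithLp.smul_fst, WithLp.smul_snd, rep_smul hl c hf.1 ⟨le_rfl, hl.le⟩,
          rep_smul hl c hf.1 ⟨hl.le, le_rfl⟩, smul_eq_mul]
        exact ⟨by linear_combination c * ef, by linear_combination c * ef'⟩ }
  toFun :=
    { toFun := fun f => WithLp.toLp 2
        (-(dTau q.τ (dTau q.τ f.1.fst)),
          -(1 / (√(q.l₁ + q.l₃) : ℂ)) *
              (rep (dTau q.τ f.1.fst) 0 + q.phase * rep (dTau q.τ f.1.fst) q.l₂) +
            ((q.l₁ + q.l₃)⁻¹ * (q.l₁ / q.a₁ + q.l₃ / q.a₃)⁻¹ * (q.τ / q.ε) ^ 2 : ℝ) * f.1.snd)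
      map_add' := by
        rintro ⟨f, hf, _⟩ ⟨g, hg, _⟩
        have hl := q.l₂_pos
        refine (WithLp.ofLp_injective 2) (Prod.ext ?_ ?_)
        · change -(dTau q.τ (dTau q.τ (f + g).fst)) =
            -(dTau q.τ (dTau q.τ f.fst)) + -(dTau q.τ (dTau q.τ g.fst))
          rw [WithLp.add_fst, dTau_add hl _ hf.1 hg.1,
            dTau_add hl _ (hf.dTau_mem _) (hg.dTau_mem _), neg_add]
        · change -(1 / (√(q.l₁ + q.l₃) : ℂ)) *
              (rep (dTau q.τ (f + g).fst) 0 + q.phase * rep (dTau q.τ (f + g).fst) q.l₂) +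
            ((q.l₁ + q.l₃)⁻¹ * (q.l₁ / q.a₁ + q.l₃ / q.a₃)⁻¹ * (q.τ / q.ε) ^ 2 : ℝ) * (f + g).snd =
            (-(1 / (√(q.l₁ + q.l₃) : ℂ)) *
              (rep (dTau q.τ f.fst) 0 + q.phase * rep (dTau q.τ f.fst) q.l₂) +
            ((q.l₁ + q.l₃)⁻¹ * (q.l₁ / q.a₁ + q.l₃ / q.a₃)⁻¹ * (q.τ / q.ε) ^ 2 : ℝ) * f.snd) +
            (-(1 / (√(q.l₁ + q.l₃) : ℂ)) *
              (rep (dTau q.τ g.fst) 0 + q.phase * rep (dTau q.τ g.fst) q.l₂) +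
            ((q.l₁ + q.l₃)⁻¹ * (q.l₁ / q.a₁ + q.l₃ / q.a₃)⁻¹ * (q.τ / q.ε) ^ 2 : ℝ) * g.snd)
          rw [WithLp.add_fst, WithLp.add_snd, dTau_add hl _ hf.1 hg.1,
            rep_add hl (hf.dTau_mem _) (hg.dTau_mem _) ⟨le_rfl, hl.le⟩,
            rep_add hl (hf.dTau_mem _) (hg.dTau_mem _) ⟨hl.le, le_rfl⟩]
          ring
      map_smul' := by
        rintro c ⟨f, hf, _⟩
        have hl := q.l₂_pos
        refine (WithLp.ofLp_injective 2) (Prod.ext ?_ ?_)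
        · change -(dTau q.τ (dTau q.τ (c • f).fst)) =
            c • -(dTau q.τ (dTau q.τ f.fst))
          rw [WithLp.smul_fst, dTau_smul hl _ _ hf.1, dTau_smul hl _ _ (hf.dTau_mem _), smul_neg]
        · change -(1 / (√(q.l₁ + q.l₃) : ℂ)) *
              (rep (dTau q.τ (c • f).fst) 0 + q.phase * rep (dTau q.τ (c • f).fst) q.l₂) +
            ((q.l₁ + q.l₃)⁻¹ * (q.l₁ / q.a₁ + q.l₃ / q.a₃)⁻¹ * (q.τ / q.ε) ^ 2 : ℝ) * (c • f).snd =
            c • (-(1 / (√(q.l₁ + q.l₃) : ℂ)) *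
              (rep (dTau q.τ f.fst) 0 + q.phase * rep (dTau q.τ f.fst) q.l₂) +
            ((q.l₁ + q.l₃)⁻¹ * (q.l₁ / q.a₁ + q.l₃ / q.a₃)⁻¹ * (q.τ / q.ε) ^ 2 : ℝ) * f.snd)
          rw [WithLp.smul_fst, WithLp.smul_snd, dTau_smul hl _ _ hf.1,
            rep_smul hl _ (hf.dTau_mem _) ⟨le_rfl, hl.le⟩,
            rep_smul hl _ (hf.dTau_mem _) ⟨hl.le, le_rfl⟩, smul_eq_mul, smul_eq_mul]
          ring }

end HomParams

end

end StrausModel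

open StrausModel

/-!
The maps `Γ₀`, `Γ₁` form a boundary triple for `A_max`: integration by parts gives
Green's identity
`⟨g, A_max f⟩ - ⟨A_max g, f⟩ = Γ₁ f * conj (Γ₀ g) - Γ₀ f * conj (Γ₁ g)` (`ModelParams.green`), and
everything else follows from it together with the explicit elements `γ(z)` of `ker (A_max - z)`
with `Γ₀ γ(z) = 1` and `Γ₁ γ(z) = m(z)`, which are built from `e^{-iτx} (a cos kx + b sin kx)` with
`k = √z` (`ModelParams.kerVec`, `ModelParams.mFun`).

*The spectrum of `A`.* The operator `A` is symmetric and strictly positive, and it has an explicit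
inverse, a sum of operators of rank one and the square of the Volterra operator that inverts `∂_τ`
(`ModelParams.invOp`). The latter is a norm limit of operators of finite rank, so `A⁻¹` is compact
and self-adjoint: non-real `z` are in the resolvent set of `A`, and `A` has a Hilbert basis of
eigenvectors `b_i`, with eigenvalues `v_i > 0` that solve the dispersion relation
(`ModelParams.exists_hilbertBasis_modelOp`). The resolvent of `A_{-i}` is a rank-one perturbation of
that of `A` (`ModelParams.kreinOp`), which gives
`g_+(z) = π^{-1/2} ⟨γ(conj z), f⟩ / (m(z) + i)`.

*The measure.* Green's identity computes the Fourier coefficients of `γ(z)`: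
`(z - v_i) ⟨b_i, γ(z)⟩ = m(z) * conj (Γ₀ b_i)`. Parseval's identity for `⟨γ(i), γ(z)⟩` then becomes
a spectral expansion of `-1/m` with the point masses `|Γ₀ b_i|²` at `v_i`
(`ModelParams.hasSum_neg_inv_mFunction`), so `μ` exists and is discrete; where `sin kl = 0`, the
vectors `b_i` are annihilated by `Γ₀`. For the uniqueness, the bound `Im F(x + iy) = O(y)` off the
closed discrete carrier of one representing measure shows that any other one has the same carrier
(`IsNevanlinnaMeasure.unique`), and the masses are recovered from `-iy F(t + iy)` as `y → 0`
(`IsNevanlinnaMeasure.tendsto_singleton`). With the closed form of `-1/m` in the variable `k` this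
limit is the mass formula: the derivative of the characteristic determinant `ModelParams.disp` at
`√λ_j` is `√λ_j sin(√λ_j l)` times the denominator (`ModelParams.Dispersion.measure_singleton`).

*The functional model.* In the non-degenerate case the closed form of `γ(z)` extends continuously to
`z = λ_j`, with `m(λ_j) = 0`; so `φ_j = γ(λ_j)` is an eigenvector, it is unique up to a factor, and
`μ({λ_j}) = ‖φ_j‖⁻²`. The unitary `U` maps the Hilbert basis `φ_j / ‖φ_j‖` to the basis of
normalised indicator functions of the atoms, with the phase for which
`(U f)(λ_j) = -i π^{-1/2} ⟨φ_j, f⟩`, the limit of `g_+` at `λ_j`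
(`ModelParams.Nondegenerate.exists_functionalModel`).

The homogenised operator is the model operator for the stated parameters, and `c` is computed from
`-ξ_τ e^{iτl₂} = (a₁/l₁) e^{iτ} + a₃/l₃` (`HomParams.neg_ξ_mul_exp`).
-/

namespace StrausModel

noncomputable section

/-! ### Absolutely continuous functions and integration by parts -/

/-- Primitives of complex-valued integrable functions are absolutely continuous; the real and
imaginary parts are treated separately. -/
theorem absolutelyContinuousOnInterval_primitive {f : ℝ → ℂ} {a b : ℝ}
    (hf : IntervalIntegrable f volume a b) :
    AbsolutelyContinuousOnInterval (fun x => ∫ t in a..x, f t) a b := by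
  have hre : IntervalIntegrable (fun t => (f t).re) volume a b := ⟨hf.1.re, hf.2.re⟩
  have him : IntervalIntegrable (fun t => (f t).im) volume a b := ⟨hf.1.im, hf.2.im⟩
  have h1 := hre.absolutelyContinuousOnInterval_intervalIntegral left_mem_uIcc
  have h2 := him.absolutelyContinuousOnInterval_intervalIntegral left_mem_uIcc
  have key : ∀ z : ℂ, AbsolutelyContinuousOnInterval (fun _ => z) a b := fun z =>
    (LipschitzWith.const z).lipschitzOnWith.absolutelyContinuousOnInterval
  have h3 : AbsolutelyContinuousOnInterval (fun x => (∫ t in a..x, (f t).re) • (1 : ℂ) +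
      (∫ t in a..x, (f t).im) • Complex.I) a b :=
    (h1.smul (key 1)).add (h2.smul (key Complex.I))
  rw [absolutelyContinuousOnInterval_iff] at h3 ⊢
  intro ε hε
  obtain ⟨δ, hδ, h⟩ := h3 ε hε
  refine ⟨δ, hδ, fun E hE hE' => ?_⟩
  refine lt_of_eq_of_lt (Finset.sum_congr rfl fun i hi => ?_) (h E hE hE')
  have hmem := hE.1 i hi
  have aux : ∀ x ∈ uIcc a b, ∫ t in a..x, f t =
      (∫ t in a..x, (f t).re) • (1 : ℂ) + (∫ t in a..x, (f t).im) • Complex.I := by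
    intro x hx
    have hx' : IntervalIntegrable f volume a x :=
      hf.mono_set (uIcc_subset_uIcc left_mem_uIcc hx)
    apply Complex.ext
    · simpa using (Complex.reCLM.intervalIntegral_comp_comm hx').symm
    · simpa using (Complex.imCLM.intervalIntegral_comp_comm hx').symm
  rw [aux _ hmem.1, aux _ hmem.2]

/-- The product rule for absolutely continuous functions, in integrated form. -/
theorem mul_eq_integral_of_primitive {l : ℝ} (hl : 0 ≤ l) {f g F G : ℝ → ℂ}
    (hf : IntervalIntegrable f volume 0 l) (hg : IntervalIntegrable g volume 0 l)
    (hF : ∀ x ∈ Icc (0 : ℝ) l, F x = F 0 + ∫ t in (0 : ℝ)..x, f t)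
    (hG : ∀ x ∈ Icc (0 : ℝ) l, G x = G 0 + ∫ t in (0 : ℝ)..x, g t)
    {x : ℝ} (hx : x ∈ Icc (0 : ℝ) l) :
    F x * G x = F 0 * G 0 + ∫ t in (0 : ℝ)..x, (f t * G t + F t * g t) := by
  set F₁ : ℝ → ℂ := fun x => F 0 + ∫ t in (0 : ℝ)..x, f t with hF₁
  set G₁ : ℝ → ℂ := fun x => G 0 + ∫ t in (0 : ℝ)..x, g t with hG₁
  have key : ∀ z : ℂ, AbsolutelyContinuousOnInterval (fun _ => z) 0 l := fun z =>
    (LipschitzWith.const z).lipschitzOnWith.absolutelyContinuousOnInterval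
  have aF : AbsolutelyContinuousOnInterval F₁ 0 l :=
    (key (F 0)).add (absolutelyContinuousOnInterval_primitive hf)
  have aG : AbsolutelyContinuousOnInterval G₁ 0 l :=
    (key (G 0)).add (absolutelyContinuousOnInterval_primitive hg)
  have hi : IntervalIntegrable (fun t => f t * G₁ t + F₁ t * g t) volume 0 l :=
    (hf.mul_continuousOn aG.continuousOn).add (hg.continuousOn_mul aF.continuousOn)
  have aH := (aF.smul aG).sub (absolutelyContinuousOnInterval_primitive hi)
  have hd : ∀ᵐ x, x ∈ uIcc 0 l → HasDerivAt
      (F₁ • G₁ - fun x => ∫ t in (0 : ℝ)..x, (f t * G₁ t + F₁ t * g t)) 0 x := by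
    filter_upwards [hf.ae_hasDerivAt_integral, hg.ae_hasDerivAt_integral,
      hi.ae_hasDerivAt_integral] with x h1 h2 h3 hx
    have h1 := (h1 hx 0 left_mem_uIcc).const_add (F 0)
    have h2 := (h2 hx 0 left_mem_uIcc).const_add (G 0)
    have h3 := h3 hx 0 left_mem_uIcc
    have := (h1.mul h2).sub h3
    rw [sub_self] at this
    exact this
  obtain ⟨C, hC⟩ := aH.const_of_ae_hasDerivAt_zero hd
  rw [uIcc_of_le hl] at hC
  have e1 := hC x hx
  have e2 := hC 0 ⟨le_rfl, hl⟩
  simp only [Pi.sub_apply, Pi.mul_apply, smul_eq_mul, intervalIntegral.integral_same,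
    hF₁, hG₁, add_zero, sub_zero] at e1 e2
  have e3 : ∫ t in (0 : ℝ)..x, (f t * G t + F t * g t) =
      ∫ t in (0 : ℝ)..x, (f t * G₁ t + F₁ t * g t) := by
    refine intervalIntegral.integral_congr fun t ht => ?_
    rw [uIcc_of_le hx.1] at ht
    have ht' : t ∈ Icc (0 : ℝ) l := ⟨ht.1, ht.2.trans hx.2⟩
    change f t * G t + F t * g t = _
    rw [hF t ht', hG t ht']
  rw [e3, hF x hx, hG x hx]
  linear_combination e1 - e2

theorem intervalIntegrable_coe {l : ℝ} (hl : 0 < l) (v : L2 l) :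
    IntervalIntegrable v volume 0 l := intervalIntegrable_L2 v ⟨hl.le, le_rfl⟩

theorem setIntegral_Ioo_eq_intervalIntegral {l : ℝ} (hl : 0 < l) (f : ℝ → ℂ) :
    ∫ x in Ioo (0 : ℝ) l, f x = ∫ x in (0 : ℝ)..l, f x := by
  rw [intervalIntegral.integral_of_le hl.le, integral_Ioc_eq_integral_Ioo]

theorem inner_L2_eq {l : ℝ} (u v : L2 l) :
    inner ℂ u v = ∫ x in Ioo (0 : ℝ) l, (starRingEnd ℂ) (u x) * v x := by
  rw [L2.inner_def]
  refine integral_congr_ae (Eventually.of_forall fun x => ?_)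
  simp [RCLike.inner_apply, mul_comm]

theorem dTau_coe {l : ℝ} (τ : ℝ) (u : L2 l) :
    ∀ᵐ x ∂(volume.restrict (Ioo (0 : ℝ) l)),
      dTau τ u x = wderiv u x + Complex.I * τ * u x := by
  filter_upwards [Lp.coeFn_add (wderiv u) ((Complex.I * τ) • u),
    Lp.coeFn_smul (Complex.I * τ : ℂ) u] with x h1 h2
  rw [dTau, h1, Pi.add_apply, h2, Pi.smul_apply, smul_eq_mul]

/-- Integration by parts: `∂_τ` is formally skew-adjoint. -/
theorem inner_dTau_add {l : ℝ} (hl : 0 < l) (τ : ℝ) {u w : L2 l} (hu : u ∈ W12 l)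
    (hw : w ∈ W12 l) :
    inner ℂ w (dTau τ u) + inner ℂ (dTau τ w) u =
      (starRingEnd ℂ) (rep w l) * rep u l - (starRingEnd ℂ) (rep w 0) * rep u 0 := by
  have hU := hasDerivL2_rep hu
  have hW := hasDerivL2_rep hw
  have iu := intervalIntegrable_coe hl (wderiv u)
  have iw : IntervalIntegrable (fun t => (starRingEnd ℂ) (wderiv w t)) volume 0 l := by
    have := intervalIntegrable_coe hl (wderiv w)
    exact ⟨(Complex.conjLIE.toContinuousLinearEquiv.toContinuousLinearMap).integrable_comp this.1,
      (Complex.conjLIE.toContinuousLinearEquiv.toContinuousLinearMap).integrable_comp this.2⟩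
  have hWc : ∀ x ∈ Icc (0 : ℝ) l, (starRingEnd ℂ) (rep w x) = (starRingEnd ℂ) (rep w 0) +
      ∫ t in (0 : ℝ)..x, (starRingEnd ℂ) (wderiv w t) := by
    intro x hx
    rw [hW.eq_integral x hx, map_add, intervalIntegral.integral_of_le hx.1,
      intervalIntegral.integral_of_le hx.1, integral_conj]
  have key := mul_eq_integral_of_primitive hl.le iw iu hWc hU.eq_integral
    (x := l) ⟨hl.le, le_rfl⟩
  rw [key, ← setIntegral_Ioo_eq_intervalIntegral hl, inner_L2_eq, inner_L2_eq,
    ← integral_add, add_sub_cancel_left]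
  · refine integral_congr_ae ?_
    filter_upwards [hU.ae_eq, hW.ae_eq, dTau_coe τ u, dTau_coe τ w] with x h1 h2 h3 h4
    rw [h3, h4, ← h1, ← h2]
    simp only [map_add, map_mul, Complex.conj_I, Complex.conj_ofReal]
    ring
  · refine (L2.integrable_inner (𝕜 := ℂ) w (dTau τ u)).congr (Eventually.of_forall fun x => ?_)
    simp [RCLike.inner_apply, mul_comm]
  · refine (L2.integrable_inner (𝕜 := ℂ) (dTau τ w) u).congr (Eventually.of_forall fun x => ?_)
    simp [RCLike.inner_apply, mul_comm]

/-! ### Elements of `L²(0, l)` given by continuous functions -/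

theorem memLp_of_continuous (l : ℝ) {g : ℝ → ℂ} (hg : Continuous g) :
    MemLp g 2 (volume.restrict (Ioo (0 : ℝ) l)) := by
  obtain ⟨C, hC⟩ := (isCompact_Icc (a := (0 : ℝ)) (b := l)).exists_bound_of_continuousOn
    hg.continuousOn
  refine MemLp.of_bound hg.aestronglyMeasurable C ?_
  filter_upwards [ae_restrict_mem measurableSet_Ioo] with x hx
  exact hC x (Ioo_subset_Icc_self hx)

/-- The class in `L²(0, l)` of a continuous function on the line. -/
def ofCont (l : ℝ) (g : C(ℝ, ℂ)) : L2 l := (memLp_of_continuous l g.continuous).toLp g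

theorem ofCont_coe (l : ℝ) (g : C(ℝ, ℂ)) :
    ∀ᵐ x ∂(volume.restrict (Ioo (0 : ℝ) l)), ofCont l g x = g x :=
  MemLp.coeFn_toLp _

theorem hasDerivL2_ofCont (l : ℝ) {g g' : C(ℝ, ℂ)} (h : ∀ x, HasDerivAt g (g' x) x) :
    HasDerivL2 l (ofCont l g) g (ofCont l g') where
  ae_eq := ofCont_coe l g
  eq_integral x hx := by
    rw [integral_congr_L2 (ofCont_coe l g') hx,
      intervalIntegral.integral_eq_sub_of_hasDerivAt (fun t _ => h t)
        (g'.continuous.intervalIntegrable _ _)]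
    ring

theorem norm_L2_le {l : ℝ} (hl : 0 < l) {u : L2 l} {C : ℝ} (hC : 0 ≤ C)
    (h : ∀ᵐ x ∂(volume.restrict (Ioo (0 : ℝ) l)), ‖u x‖ ≤ C) : ‖u‖ ≤ √l * C := by
  have := Lp.norm_le_of_ae_bound (p := 2) hC h
  refine this.trans (le_of_eq ?_)
  congr 1
  have e : ((measureUnivNNReal (volume.restrict (Ioo (0 : ℝ) l)) : NNReal) : ℝ) = l := by
    simp only [measureUnivNNReal, Measure.restrict_apply_univ, Real.volume_Ioo, sub_zero]
    exact ENNReal.toReal_ofReal hl.le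
  rw [e, Real.sqrt_eq_rpow]
  simp

/-! ### Trigonometric solutions of `-∂_τ² u = k² u` -/

/-- If `∂_τ g = h` classically, then `∂_τ` maps the class of `g` to the class of `h`. -/
theorem dTau_ofCont {l : ℝ} (hl : 0 < l) (τ : ℝ) {g h : C(ℝ, ℂ)}
    (hg : ∀ x, HasDerivAt g (h x - Complex.I * τ * g x) x) :
    ofCont l g ∈ W12 l ∧ dTau τ (ofCont l g) = ofCont l h ∧
      ∀ x ∈ Icc (0 : ℝ) l, rep (ofCont l g) x = g x := by
  let d : C(ℝ, ℂ) := h - (Complex.I * τ) • g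
  have H : HasDerivL2 l (ofCont l g) g (ofCont l d) :=
    hasDerivL2_ofCont l fun x => by simpa [d] using hg x
  obtain ⟨h1, h2⟩ := H.unique hl
  refine ⟨⟨_, _, H⟩, ?_, h1⟩
  rw [dTau, h2]
  refine Lp.ext ?_
  filter_upwards [Lp.coeFn_add (ofCont l d) ((Complex.I * τ : ℂ) • ofCont l g),
    Lp.coeFn_smul (Complex.I * τ : ℂ) (ofCont l g), ofCont_coe l d, ofCont_coe l g,
    ofCont_coe l h] with x e1 e2 e3 e4 e5
  rw [e1, Pi.add_apply, e2, Pi.smul_apply, e3, e4, e5]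
  simp [d]

/-- The function `e^{-iτx} (a cos kx + b sin kx)`; these are the solutions of `-∂_τ² u = k² u`. -/
def trig (τ : ℝ) (k a b : ℂ) : C(ℝ, ℂ) where
  toFun x := Complex.exp (-(Complex.I * τ * x)) *
    (a * Complex.cos (k * x) + b * Complex.sin (k * x))

theorem trig_apply (τ : ℝ) (k a b : ℂ) (x : ℝ) :
    trig τ k a b x = Complex.exp (-(Complex.I * τ * x)) *
      (a * Complex.cos (k * x) + b * Complex.sin (k * x)) := rfl

theorem hasDerivAt_mul_ofReal (c : ℂ) (x : ℝ) :
    HasDerivAt (fun y : ℝ => c * (y : ℂ)) c x := by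
  simpa using (Complex.ofRealCLM.hasDerivAt (x := x)).const_mul c

theorem hasDerivAt_trig (τ : ℝ) (k a b : ℂ) (x : ℝ) :
    HasDerivAt (trig τ k a b) (trig τ k (k * b) (-(k * a)) x - Complex.I * τ * trig τ k a b x)
      x := by
  have h1 := (hasDerivAt_mul_ofReal (-(Complex.I * τ)) x).cexp
  have h2 := ((Complex.hasDerivAt_cos (k * x)).comp x (hasDerivAt_mul_ofReal k x)).const_mul a
  have h3 := ((Complex.hasDerivAt_sin (k * x)).comp x (hasDerivAt_mul_ofReal k x)).const_mul b
  have := h1.mul (h2.add h3)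
  simp only [neg_mul] at this
  refine HasDerivAt.congr_deriv this ?_
  simp only [trig_apply]
  simp
  ring

theorem dTau_trig {l : ℝ} (hl : 0 < l) (τ : ℝ) (k a b : ℂ) :
    dTau τ (ofCont l (trig τ k a b)) = ofCont l (trig τ k (k * b) (-(k * a))) :=
  (dTau_ofCont hl τ (hasDerivAt_trig τ k a b)).2.1

theorem rep_trig {l : ℝ} (hl : 0 < l) (τ : ℝ) (k a b : ℂ) {x : ℝ} (hx : x ∈ Icc (0 : ℝ) l) :
    rep (ofCont l (trig τ k a b)) x = trig τ k a b x :=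
  (dTau_ofCont hl τ (hasDerivAt_trig τ k a b)).2.2 x hx

theorem memW22_of_dTau {l : ℝ} (τ : ℝ) {u : L2 l} (hu : u ∈ W12 l) (hd : dTau τ u ∈ W12 l) :
    MemW22 u := by
  refine ⟨hu, ?_⟩
  have e : wderiv u = dTau τ u - (Complex.I * τ) • u := by rw [dTau, add_sub_cancel_right]
  rw [e]
  exact (W12 l).sub_mem hd ((W12 l).smul_mem _ hu)

theorem memW22_trig {l : ℝ} (hl : 0 < l) (τ : ℝ) (k a b : ℂ) :
    MemW22 (ofCont l (trig τ k a b)) := by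
  refine memW22_of_dTau τ (dTau_ofCont hl τ (hasDerivAt_trig τ k a b)).1 ?_
  rw [dTau_trig hl]
  exact (dTau_ofCont hl τ (hasDerivAt_trig τ k _ _)).1

theorem ofCont_congr {l : ℝ} {g h : C(ℝ, ℂ)} {c : ℂ} (e : ∀ x, h x = c * g x) :
    ofCont l h = c • ofCont l g := by
  refine Lp.ext ?_
  filter_upwards [Lp.coeFn_smul c (ofCont l g), ofCont_coe l g, ofCont_coe l h] with x e1 e2 e3
  rw [e1, Pi.smul_apply, e2, e3, e x, smul_eq_mul]

theorem neg_dTau_dTau_trig {l : ℝ} (hl : 0 < l) (τ : ℝ) (k a b : ℂ) :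
    -dTau τ (dTau τ (ofCont l (trig τ k a b))) = k ^ 2 • ofCont l (trig τ k a b) := by
  rw [dTau_trig hl, dTau_trig hl, ← neg_one_smul ℂ]
  rw [ofCont_congr (g := trig τ k a b) (c := -k ^ 2) fun x => ?_, smul_smul]
  · simp
  · simp only [trig_apply]; ring

/-! ### Uniqueness for `-∂_τ² u = k² u` -/

/-- A combination `u G + v H` of `W^{1,2}` functions with smooth coefficients is constant if its
derivative vanishes almost everywhere. -/
theorem rep_mul_add_rep_mul_eq {l : ℝ} (hl : 0 < l) {u v : L2 l} (hu : u ∈ W12 l)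
    (hv : v ∈ W12 l) {G G' H H' : C(ℝ, ℂ)} (hG : ∀ x, HasDerivAt G (G' x) x)
    (hH : ∀ x, HasDerivAt H (H' x) x)
    (h0 : ∀ᵐ x ∂(volume.restrict (Ioo (0 : ℝ) l)),
      wderiv u x * G x + u x * G' x + (wderiv v x * H x + v x * H' x) = 0)
    {x : ℝ} (hx : x ∈ Icc (0 : ℝ) l) :
    rep u x * G x + rep v x * H x = rep u 0 * G 0 + rep v 0 * H 0 := by
  have hU := hasDerivL2_rep hu
  have hV := hasDerivL2_rep hv
  have fG : ∀ x ∈ Icc (0 : ℝ) l, G x = G 0 + ∫ t in (0 : ℝ)..x, G' t := fun x _ => by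
    rw [intervalIntegral.integral_eq_sub_of_hasDerivAt (fun t _ => hG t)
        (G'.continuous.intervalIntegrable _ _)]
    ring
  have fH : ∀ x ∈ Icc (0 : ℝ) l, H x = H 0 + ∫ t in (0 : ℝ)..x, H' t := fun x _ => by
    rw [intervalIntegral.integral_eq_sub_of_hasDerivAt (fun t _ => hH t)
        (H'.continuous.intervalIntegrable _ _)]
    ring
  have i1 := mul_eq_integral_of_primitive hl.le (intervalIntegrable_coe hl (wderiv u))
    (G'.continuous.intervalIntegrable _ _) hU.eq_integral fG hx
  have i2 := mul_eq_integral_of_primitive hl.le (intervalIntegrable_coe hl (wderiv v))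
    (H'.continuous.intervalIntegrable _ _) hV.eq_integral fH hx
  have hcont : ∀ {w : L2 l} (hw : w ∈ W12 l), ContinuousOn (rep w) (uIcc 0 x) := by
    intro w hw
    have c1 := (absolutelyContinuousOnInterval_primitive
      (intervalIntegrable_coe hl (wderiv w))).continuousOn
    have c2 : ContinuousOn (fun x => rep w 0 + ∫ t in (0 : ℝ)..x, wderiv w t) (uIcc 0 l) :=
      continuousOn_const.add c1
    rw [uIcc_of_le hl.le] at c2
    rw [uIcc_of_le hx.1]
    exact (c2.congr (hasDerivL2_rep hw).eq_integral).mono (Icc_subset_Icc_right hx.2)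
  have ii : ∀ {w : L2 l} (hw : w ∈ W12 l) (P P' : C(ℝ, ℂ)), IntervalIntegrable
      (fun t => wderiv w t * P t + rep w t * P' t) volume 0 x := fun {w} hw P P' =>
    ((intervalIntegrable_L2 (wderiv w) hx).mul_continuousOn P.continuous.continuousOn).add
      ((hcont hw).mul P'.continuous.continuousOn).intervalIntegrable
  have i3 : (∫ t in (0 : ℝ)..x, (wderiv u t * G t + rep u t * G' t)) +
      ∫ t in (0 : ℝ)..x, (wderiv v t * H t + rep v t * H' t) = 0 := by
    rw [← intervalIntegral.integral_add (ii hu G G') (ii hv H H')]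
    rw [integral_congr_L2 (g := fun _ => 0) _ hx]
    · simp
    · filter_upwards [h0, hU.ae_eq, hV.ae_eq] with t e1 e2 e3
      rw [← e2, ← e3, e1]
  linear_combination i1 + i2 + i3

/-- Propagation of the Cauchy data of a solution of `-∂_τ² u = k² u` from `0` to `x`. -/
theorem rep_eq_of_dTau_dTau {l : ℝ} (hl : 0 < l) (τ : ℝ) {k : ℂ} {u : L2 l} (hu : MemW22 u)
    (he : dTau τ (dTau τ u) = -(k ^ 2) • u) {x : ℝ} (hx : x ∈ Icc (0 : ℝ) l) :
    k * (Complex.exp (Complex.I * τ * x) * rep u x) =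
        k * rep u 0 * Complex.cos (k * x) + rep (dTau τ u) 0 * Complex.sin (k * x) ∧
      Complex.exp (Complex.I * τ * x) * rep (dTau τ u) x =
        rep (dTau τ u) 0 * Complex.cos (k * x) - k * rep u 0 * Complex.sin (k * x) := by
  have hv := hu.dTau_mem τ
  have a1 := dTau_coe τ u
  have a2 : ∀ᵐ x ∂(volume.restrict (Ioo (0 : ℝ) l)),
      -(k ^ 2) * u x = wderiv (dTau τ u) x + Complex.I * τ * dTau τ u x := by
    filter_upwards [dTau_coe τ (dTau τ u), Lp.coeFn_smul (-(k ^ 2)) u] with x e1 e2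
    rw [← e1, he, e2, Pi.smul_apply, smul_eq_mul]
  have hd : ∀ (a b : ℂ) (x : ℝ), HasDerivAt (trig (-τ) k a b)
      ((trig (-τ) k (k * b) (-(k * a)) + (Complex.I * τ) • trig (-τ) k a b : C(ℝ, ℂ)) x) x := by
    intro a b x
    have := hasDerivAt_trig (-τ) k a b x
    refine this.congr_deriv ?_
    simp
  -- two first integrals, obtained by pairing the Cauchy data with `cos kx` and `sin kx`
  have r1 := rep_mul_add_rep_mul_eq hl hu.1 hv (hd k 0) (hd 0 (-1)) (by
    filter_upwards [a1, a2] with x e1 e2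
    simp only [ContinuousMap.add_apply, ContinuousMap.smul_apply, smul_eq_mul, trig_apply]
    have e1' : wderiv u x = dTau τ u x - Complex.I * τ * u x := by rw [e1]; ring
    have e2' : wderiv (dTau τ u) x = -(k ^ 2) * u x - Complex.I * τ * dTau τ u x := by
      rw [e2]; ring
    rw [e2', e1']
    ring) hx
  have r2 := rep_mul_add_rep_mul_eq hl hu.1 hv (hd 0 k) (hd 1 0) (by
    filter_upwards [a1, a2] with x e1 e2
    simp only [ContinuousMap.add_apply, ContinuousMap.smul_apply, smul_eq_mul, trig_apply]
    have e1' : wderiv u x = dTau τ u x - Complex.I * τ * u x := by rw [e1]; ring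
    have e2' : wderiv (dTau τ u) x = -(k ^ 2) * u x - Complex.I * τ * dTau τ u x := by
      rw [e2]; ring
    rw [e2', e1']
    ring) hx
  simp only [trig_apply] at r1 r2
  simp only [Complex.ofReal_neg, mul_neg, neg_mul, neg_neg, Complex.ofReal_zero, mul_zero,
    Complex.exp_zero, Complex.cos_zero, Complex.sin_zero, zero_mul, add_zero, zero_add, mul_one,
    one_mul, neg_zero] at r1 r2
  have cs := Complex.sin_sq_add_cos_sq (k * x)
  constructor
  · linear_combination Complex.cos (k * x) * r1 + Complex.sin (k * x) * r2 -
      k * Complex.exp (Complex.I * τ * x) * rep u x * cs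
  · linear_combination Complex.cos (k * x) * r2 - Complex.sin (k * x) * r1 -
      Complex.exp (Complex.I * τ * x) * rep (dTau τ u) x * cs

/-- A solution of `-∂_τ² u = k² u` with vanishing Cauchy data is zero. -/
theorem eq_zero_of_dTau_dTau {l : ℝ} (hl : 0 < l) (τ : ℝ) {k : ℂ} (hk : k ≠ 0) {u : L2 l}
    (hu : MemW22 u) (he : dTau τ (dTau τ u) = -(k ^ 2) • u) (h0 : rep u 0 = 0)
    (h1 : rep (dTau τ u) 0 = 0) : u = 0 := by
  rw [Lp.eq_zero_iff_ae_eq_zero]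
  filter_upwards [(hasDerivL2_rep hu.1).ae_eq, ae_restrict_mem measurableSet_Ioo] with x e hx
  have := (rep_eq_of_dTau_dTau hl τ hu he (Ioo_subset_Icc_self hx)).1
  rw [h0, h1] at this
  simpa [hk, Complex.exp_ne_zero, ← e] using this

/-! ### Compactness of the inverse of `∂_τ` with zero initial value -/

theorem intervalIntegrable_exp_mul {l : ℝ} (τ : ℝ) (f : L2 l) {x : ℝ} (hx : x ∈ Icc (0 : ℝ) l) :
    IntervalIntegrable (fun t : ℝ => Complex.exp (Complex.I * τ * t) * f t) volume 0 x :=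
  (intervalIntegrable_L2 f hx).continuousOn_mul (by fun_prop)

theorem norm_exp_I_mul_mul (τ x : ℝ) : ‖Complex.exp (Complex.I * τ * x)‖ = 1 := by
  have : Complex.I * τ * x = ((τ * x : ℝ) : ℂ) * Complex.I := by push_cast; ring
  rw [this, Complex.norm_exp_ofReal_mul_I]

theorem norm_exp_neg_I_mul_mul (τ x : ℝ) : ‖Complex.exp (-(Complex.I * τ * x))‖ = 1 := by
  have : -(Complex.I * τ * x) = ((-(τ * x) : ℝ) : ℂ) * Complex.I := by push_cast; ring
  rw [this, Complex.norm_exp_ofReal_mul_I]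

/-- The Cauchy–Schwarz bound behind the Hölder continuity of primitives of `L²` functions. -/
theorem norm_integral_exp_mul_le {l : ℝ} (τ : ℝ) (f : L2 l) {a b : ℝ} (ha : 0 ≤ a) (hab : a ≤ b)
    (hb : b ≤ l) :
    ‖∫ t in a..b, Complex.exp (Complex.I * τ * t) * f t‖ ≤ √(b - a) * ‖f‖ := by
  have hle : volume.restrict (Ioo a b) ≤ volume.restrict (Ioo (0 : ℝ) l) :=
    Measure.restrict_mono (Ioo_subset_Ioo ha hb) le_rfl
  have h1 : ENNReal.ofReal ‖∫ t in a..b, Complex.exp (Complex.I * τ * t) * f t‖ ≤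
      ENNReal.ofReal (√(b - a) * ‖f‖) := by
    rw [intervalIntegral.integral_of_le hab, integral_Ioc_eq_integral_Ioo, ofReal_norm]
    calc ‖∫ t in Ioo a b, Complex.exp (Complex.I * τ * t) * f t‖ₑ
        ≤ ∫⁻ t in Ioo a b, ‖Complex.exp (Complex.I * τ * t) * f t‖ₑ :=
          enorm_integral_le_lintegral_enorm _
      _ = eLpNorm f 1 (volume.restrict (Ioo a b)) := by
          rw [eLpNorm_one_eq_lintegral_enorm]
          refine lintegral_congr fun t => ?_
          rw [enorm_mul, ← ofReal_norm, norm_exp_I_mul_mul]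
          simp
      _ ≤ eLpNorm f 2 (volume.restrict (Ioo a b)) *
            (volume.restrict (Ioo a b)) univ ^ (1 / (1 : ENNReal).toReal - 1 / (2 : ENNReal).toReal) :=
          eLpNorm_le_eLpNorm_mul_rpow_measure_univ (by norm_num)
            ((Lp.aestronglyMeasurable f).mono_measure hle)
      _ ≤ eLpNorm f 2 (volume.restrict (Ioo (0 : ℝ) l)) * ENNReal.ofReal √(b - a) := by
          gcongr
          rw [Measure.restrict_apply_univ, Real.volume_Ioo, Real.sqrt_eq_rpow,
            ← ENNReal.ofReal_rpow_of_nonneg (sub_nonneg.2 hab) (by norm_num)]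
          norm_num
      _ = ENNReal.ofReal (√(b - a) * ‖f‖) := by
          rw [ENNReal.ofReal_mul (Real.sqrt_nonneg _), mul_comm, Lp.norm_def,
            ENNReal.ofReal_toReal (Lp.eLpNorm_ne_top f)]
  exact (ENNReal.ofReal_le_ofReal_iff (by positivity)).1 h1

/-- The functional `f ↦ ∫₀ᵃ e^{iτt} f(t) dt`. -/
def primFunctional (l τ : ℝ) (a : Icc (0 : ℝ) l) : L2 l →L[ℂ] ℂ :=
  LinearMap.mkContinuous
    { toFun := fun f => ∫ t in (0 : ℝ)..a, Complex.exp (Complex.I * τ * t) * f t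
      map_add' := fun f g => by
        rw [← intervalIntegral.integral_add (intervalIntegrable_exp_mul τ f a.2)
          (intervalIntegrable_exp_mul τ g a.2)]
        refine integral_congr_L2 ?_ a.2
        filter_upwards [Lp.coeFn_add f g] with x e
        rw [e, Pi.add_apply, mul_add]
      map_smul' := fun c f => by
        simp only [RingHom.id_apply, smul_eq_mul]
        rw [← intervalIntegral.integral_const_mul]
        refine integral_congr_L2 ?_ a.2
        filter_upwards [Lp.coeFn_smul c f] with x e
        rw [e, Pi.smul_apply, smul_eq_mul]
        ring }
    (√((a : ℝ) - 0)) fun f => norm_integral_exp_mul_le τ f le_rfl a.2.1 a.2.2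

theorem primFunctional_apply {l τ : ℝ} (a : Icc (0 : ℝ) l) (f : L2 l) :
    primFunctional l τ a f = ∫ t in (0 : ℝ)..a, Complex.exp (Complex.I * τ * t) * f t := rfl

theorem norm_primFunctional_sub_le {l τ : ℝ} {a b : Icc (0 : ℝ) l} (h : a ≤ b) (f : L2 l) :
    ‖primFunctional l τ b f - primFunctional l τ a f‖ ≤ √((b : ℝ) - a) * ‖f‖ := by
  rw [primFunctional_apply, primFunctional_apply, intervalIntegral.integral_interval_sub_left
    (intervalIntegrable_exp_mul τ f b.2) (intervalIntegrable_exp_mul τ f a.2)]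
  exact norm_integral_exp_mul_le τ f a.2.1 h b.2.2

/-- The solution `U(x) = e^{-iτx} ∫₀ˣ e^{iτt} f(t) dt` of `∂_τ U = f`, `U(0) = 0`. -/
def primRep {l : ℝ} (τ : ℝ) (f : L2 l) (x : ℝ) : ℂ :=
  Complex.exp (-(Complex.I * τ * x)) * ∫ t in (0 : ℝ)..x, Complex.exp (Complex.I * τ * t) * f t

theorem continuousOn_primRep {l : ℝ} (hl : 0 < l) (τ : ℝ) (f : L2 l) :
    ContinuousOn (primRep τ f) (Icc 0 l) := by
  have := (absolutelyContinuousOnInterval_primitive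
    (intervalIntegrable_exp_mul τ f ⟨hl.le, le_rfl⟩)).continuousOn
  rw [uIcc_of_le hl.le] at this
  exact ContinuousOn.mul (by fun_prop) this

theorem norm_primRep_le {l : ℝ} (τ : ℝ) (f : L2 l) {x : ℝ} (hx : x ∈ Icc 0 l) :
    ‖primRep τ f x‖ ≤ √l * ‖f‖ := by
  rw [primRep, norm_mul, norm_exp_neg_I_mul_mul, one_mul]
  refine (norm_integral_exp_mul_le τ f le_rfl hx.1 hx.2).trans ?_
  gcongr
  linarith [hx.2]

theorem memLp_primRep {l : ℝ} (hl : 0 < l) (τ : ℝ) (f : L2 l) :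
    MemLp (primRep τ f) 2 (volume.restrict (Ioo (0 : ℝ) l)) := by
  refine MemLp.of_bound (((continuousOn_primRep hl τ f).mono
    Ioo_subset_Icc_self).aestronglyMeasurable measurableSet_Ioo) (√l * ‖f‖) ?_
  filter_upwards [ae_restrict_mem measurableSet_Ioo] with x hx
  exact norm_primRep_le τ f (Ioo_subset_Icc_self hx)

theorem primRep_eq {l τ : ℝ} (f : L2 l) {x : ℝ} (hx : x ∈ Icc 0 l) :
    primRep τ f x = Complex.exp (-(Complex.I * τ * x)) * primFunctional l τ ⟨x, hx⟩ f := rfl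

/-- The operator `f ↦ U` on `L²(0, l)` solving `∂_τ U = f`, `U(0) = 0`. -/
def primOp {l : ℝ} (hl : 0 < l) (τ : ℝ) : L2 l →L[ℂ] L2 l :=
  LinearMap.mkContinuous
    { toFun := fun f => (memLp_primRep hl τ f).toLp
      map_add' := fun f g => by
        refine Lp.ext ?_
        filter_upwards [MemLp.coeFn_toLp (memLp_primRep hl τ f),
          MemLp.coeFn_toLp (memLp_primRep hl τ g), MemLp.coeFn_toLp (memLp_primRep hl τ (f + g)),
          Lp.coeFn_add (memLp_primRep hl τ f).toLp (memLp_primRep hl τ g).toLp,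
          ae_restrict_mem measurableSet_Ioo] with x e1 e2 e3 e4 hx
        have hx' := Ioo_subset_Icc_self hx
        rw [e3, e4, Pi.add_apply, e1, e2, primRep_eq _ hx', primRep_eq _ hx', primRep_eq _ hx',
          map_add, mul_add]
      map_smul' := fun c f => by
        refine Lp.ext ?_
        filter_upwards [MemLp.coeFn_toLp (memLp_primRep hl τ f),
          MemLp.coeFn_toLp (memLp_primRep hl τ (c • f)),
          Lp.coeFn_smul c (memLp_primRep hl τ f).toLp,
          ae_restrict_mem measurableSet_Ioo] with x e1 e2 e3 hx
        have hx' := Ioo_subset_Icc_self hx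
        rw [e2, RingHom.id_apply, e3, Pi.smul_apply, e1, primRep_eq _ hx', primRep_eq _ hx',
          map_smul, smul_eq_mul, smul_eq_mul]
        ring }
    (√l * √l) fun f => by
      rw [mul_assoc]
      refine norm_L2_le hl (by positivity) ?_
      filter_upwards [MemLp.coeFn_toLp (memLp_primRep hl τ f),
        ae_restrict_mem measurableSet_Ioo] with x e hx
      change ‖((memLp_primRep hl τ f).toLp _ : L2 l) x‖ ≤ _
      rw [e]
      exact norm_primRep_le τ f (Ioo_subset_Icc_self hx)

theorem primOp_coe {l : ℝ} (hl : 0 < l) (τ : ℝ) (f : L2 l) :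
    ∀ᵐ x ∂(volume.restrict (Ioo (0 : ℝ) l)), primOp hl τ f x = primRep τ f x :=
  MemLp.coeFn_toLp (memLp_primRep hl τ f)

theorem hasDerivL2_primOp {l : ℝ} (hl : 0 < l) (τ : ℝ) (f : L2 l) :
    HasDerivL2 l (primOp hl τ f) (primRep τ f) (f - (Complex.I * τ) • primOp hl τ f) where
  ae_eq := primOp_coe hl τ f
  eq_integral x hx := by
    have hd : ∀ x : ℝ, HasDerivAt (fun x : ℝ => Complex.exp (-(Complex.I * τ * x)))
        (-(Complex.I * τ) * Complex.exp (-(Complex.I * τ * x))) x := fun x => by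
      have := (hasDerivAt_mul_ofReal (-(Complex.I * τ)) x).cexp
      simp only [neg_mul] at this ⊢
      refine this.congr_deriv (by ring)
    have hi : ∀ a b : ℝ, IntervalIntegrable
        (fun x : ℝ => -(Complex.I * τ) * Complex.exp (-(Complex.I * τ * x))) volume a b :=
      fun a b => Continuous.intervalIntegrable (by fun_prop) a b
    have := mul_eq_integral_of_primitive hl.le
      (F := fun x : ℝ => Complex.exp (-(Complex.I * τ * x)))
      (G := fun x : ℝ => ∫ t in (0 : ℝ)..x, Complex.exp (Complex.I * τ * t) * f t)
      (hi 0 l) (intervalIntegrable_exp_mul τ f ⟨hl.le, le_rfl⟩)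
      (fun x _ => by
        rw [intervalIntegral.integral_eq_sub_of_hasDerivAt (fun t _ => hd t) (hi _ _)]
        ring)
      (fun x _ => by simp) hx
    have e0 : primRep τ f 0 = 0 := by simp [primRep]
    rw [e0, primRep, this]
    simp only [intervalIntegral.integral_same, mul_zero]
    congr 1
    refine integral_congr_L2 ?_ hx
    filter_upwards [primOp_coe hl τ f, Lp.coeFn_sub f ((Complex.I * τ : ℂ) • primOp hl τ f),
      Lp.coeFn_smul (Complex.I * τ : ℂ) (primOp hl τ f)] with t e1 e2 e3
    rw [e2, Pi.sub_apply, e3, Pi.smul_apply, e1, smul_eq_mul, primRep]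
    have : Complex.exp (-(Complex.I * τ * t)) * Complex.exp (Complex.I * τ * t) = 1 := by
      rw [← Complex.exp_add]; simp
    linear_combination f t * this

theorem dTau_primOp {l : ℝ} (hl : 0 < l) (τ : ℝ) (f : L2 l) :
    primOp hl τ f ∈ W12 l ∧ dTau τ (primOp hl τ f) = f ∧
      ∀ x ∈ Icc (0 : ℝ) l, rep (primOp hl τ f) x = primRep τ f x := by
  have H := hasDerivL2_primOp hl τ f
  obtain ⟨h1, h2⟩ := H.unique hl
  refine ⟨⟨_, _, H⟩, ?_, h1⟩
  rw [dTau, h2, sub_add_cancel]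

theorem memLp_indicator_exp (l τ : ℝ) (s : Set ℝ) (hs : MeasurableSet s) :
    MemLp (s.indicator fun x : ℝ => Complex.exp (-(Complex.I * τ * x))) 2
      (volume.restrict (Ioo (0 : ℝ) l)) :=
  (memLp_of_continuous l (by fun_prop)).indicator hs

/-- The `j`-th point of the division of `[0, l]` into `n` equal parts. -/
def gridPoint {l : ℝ} (hl : 0 < l) {n : ℕ} (j : Fin n) : Icc (0 : ℝ) l :=
  ⟨j / n * l, by positivity, by
    have : ((j : ℕ) : ℝ) ≤ n := by exact_mod_cast j.2.le
    have h2 : (j : ℝ) / n ≤ 1 := div_le_one_of_le₀ this (by positivity)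
    nlinarith⟩

/-- The finite-rank operator obtained by freezing the upper limit of integration on each of `n`
equal parts of the interval. -/
def stepOp {l : ℝ} (hl : 0 < l) (τ : ℝ) (n : ℕ) : L2 l →L[ℂ] L2 l :=
  ∑ j : Fin n, (primFunctional l τ (gridPoint hl j)).smulRight
    ((memLp_indicator_exp l τ (Ico (j / n * l) ((j + 1) / n * l)) measurableSet_Ico).toLp)

theorem isCompactOperator_smulRight {E F : Type*} [NormedAddCommGroup E] [NormedSpace ℂ E]
    [NormedAddCommGroup F] [NormedSpace ℂ F] (φ : E →L[ℂ] ℂ) (v : F) :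
    IsCompactOperator (φ.smulRight v) := by
  have h : IsCompactOperator (ContinuousLinearMap.toSpanSingleton ℂ v) :=
    isCompactOperator_of_locallyCompactSpace_rng _
  exact h.comp_clm φ

theorem isCompactOperator_stepOp {l : ℝ} (hl : 0 < l) (τ : ℝ) (n : ℕ) :
    IsCompactOperator (stepOp hl τ n) := by
  have : stepOp hl τ n ∈ compactOperator (RingHom.id ℂ) (L2 l) (L2 l) :=
    Submodule.sum_mem _ fun j _ => isCompactOperator_smulRight _ _
  exact this

/-- By the Hölder continuity of primitives, freezing the upper limit costs `O(√(l / n))`. -/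
theorem norm_primOp_sub_stepOp_le {l : ℝ} (hl : 0 < l) (τ : ℝ) {n : ℕ} (hn : 0 < n) :
    ‖primOp hl τ - stepOp hl τ n‖ ≤ √l * √(l / n) := by
  refine ContinuousLinearMap.opNorm_le_bound _ (by positivity) fun f => ?_
  rw [mul_assoc]
  refine norm_L2_le hl (by positivity) ?_
  let e : Fin n → L2 l := fun j =>
    (memLp_indicator_exp l τ (Ico (j / n * l) ((j + 1) / n * l)) measurableSet_Ico).toLp
  have hstep : stepOp hl τ n f = ∑ j : Fin n, primFunctional l τ (gridPoint hl j) f • e j := by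
    simp [stepOp, e]
  have hsm : ∀ᵐ x ∂(volume.restrict (Ioo (0 : ℝ) l)), ∀ j : Fin n,
      (primFunctional l τ (gridPoint hl j) f • e j : L2 l) x =
        primFunctional l τ (gridPoint hl j) f * (Ico ((j : ℝ) / n * l) ((j + 1) / n * l)).indicator
          (fun x : ℝ => Complex.exp (-(Complex.I * τ * x))) x := by
    rw [ae_all_iff]
    intro j
    filter_upwards [Lp.coeFn_smul (primFunctional l τ (gridPoint hl j) f) (e j),
      MemLp.coeFn_toLp (memLp_indicator_exp l τ (Ico ((j : ℝ) / n * l) ((j + 1) / n * l))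
        measurableSet_Ico)] with x e1 e2
    rw [e1, Pi.smul_apply, e2, smul_eq_mul]
  filter_upwards [Lp.coeFn_sub (primOp hl τ f) (stepOp hl τ n f), primOp_coe hl τ f, hsm,
    Lp.coeFn_fun_finsetSum Finset.univ fun j => primFunctional l τ (gridPoint hl j) f • e j,
    ae_restrict_mem measurableSet_Ioo] with x e1 e2 e3 e4 hx
  have hn' : (0 : ℝ) < n := by exact_mod_cast hn
  -- the index of the part of the interval that contains `x`
  have hq : 0 ≤ x / l * n := by have := hx.1; positivity
  have hxl : x / l < 1 := (div_lt_one hl).2 hx.2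
  have hlt : ⌊x / l * n⌋₊ < n := by
    rw [Nat.floor_lt hq]
    nlinarith
  let i : Fin n := ⟨⌊x / l * n⌋₊, hlt⟩
  have hi1 : (i : ℝ) / n * l ≤ x := by
    have := Nat.floor_le hq
    have h2 : (i : ℝ) ≤ x / l * n := this
    calc (i : ℝ) / n * l ≤ (x / l * n) / n * l := by gcongr
      _ = x := by field_simp
  have hi2 : x < ((i : ℝ) + 1) / n * l := by
    have h2 : x / l * n < (i : ℝ) + 1 := Nat.lt_floor_add_one _
    calc x = (x / l * n) / n * l := by field_simp
      _ < ((i : ℝ) + 1) / n * l := by gcongr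
  have hsum : (stepOp hl τ n f) x =
      primFunctional l τ (gridPoint hl i) f * Complex.exp (-(Complex.I * τ * x)) := by
    rw [hstep, e4, Finset.sum_congr rfl fun j _ => e3 j, Finset.sum_eq_single i]
    · rw [indicator_of_mem
        (show x ∈ Ico ((i : ℝ) / n * l) (((i : ℝ) + 1) / n * l) from ⟨hi1, hi2⟩)]
    · intro j _ hj
      rw [indicator_of_notMem, mul_zero]
      rintro ⟨h1, h2⟩
      have a1 : (j : ℝ) < i + 1 := by
        have := lt_of_le_of_lt h1 hi2
        have := lt_of_mul_lt_mul_right this hl.le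
        exact (div_lt_div_iff_of_pos_right hn').1 this
      have a2 : (i : ℝ) < j + 1 := by
        have := lt_of_le_of_lt hi1 h2
        have := lt_of_mul_lt_mul_right this hl.le
        exact (div_lt_div_iff_of_pos_right hn').1 this
      have b1 : (j : ℕ) < i + 1 := by exact_mod_cast a1
      have b2 : (i : ℕ) < j + 1 := by exact_mod_cast a2
      exact hj (Fin.ext (by omega))
    · intro h; exact absurd (Finset.mem_univ _) h
  have hx' := Ioo_subset_Icc_self hx
  change ‖(primOp hl τ f - stepOp hl τ n f) x‖ ≤ _
  rw [e1, Pi.sub_apply, e2, hsum, primRep_eq f hx',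
    mul_comm (primFunctional l τ (gridPoint hl i) f), ← mul_sub, norm_mul,
    norm_exp_neg_I_mul_mul, one_mul]
  refine (norm_primFunctional_sub_le (a := gridPoint hl i) (b := ⟨x, hx'⟩) hi1 f).trans ?_
  have : x - (gridPoint hl i : ℝ) ≤ l / n := by
    change x - (i : ℝ) / n * l ≤ l / n
    have : ((i : ℝ) + 1) / n * l = (i : ℝ) / n * l + l / n := by ring
    linarith
  gcongr

theorem isCompactOperator_primOp {l : ℝ} (hl : 0 < l) (τ : ℝ) :
    IsCompactOperator (primOp hl τ) := by
  refine isCompactOperator_of_tendsto (F := fun n : ℕ => stepOp hl τ (n + 1)) (l := atTop) ?_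
    (Eventually.of_forall fun n => isCompactOperator_stepOp hl τ (n + 1))
  rw [tendsto_iff_norm_sub_tendsto_zero]
  have h1 : Tendsto (fun n : ℕ => √l * √(l / ((n + 1 : ℕ) : ℝ))) atTop (𝓝 (√l * √0)) := by
    have h2 : Tendsto (fun n : ℕ => l / ((n + 1 : ℕ) : ℝ)) atTop (𝓝 0) :=
      (tendsto_const_div_atTop_nhds_zero_nat l).comp (tendsto_add_atTop_nat 1)
    exact (Real.continuous_sqrt.continuousAt.tendsto.comp h2).const_mul _
  rw [Real.sqrt_zero, mul_zero] at h1
  refine squeeze_zero (fun n => norm_nonneg _) (fun n => ?_) h1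
  rw [norm_sub_rev]
  exact norm_primOp_sub_stepOp_le hl τ (Nat.succ_pos n)

/-! ### Green's identity -/

namespace ModelParams

variable (p : ModelParams)

theorem maxOp_fst (f : p.maxOp.domain) :
    (p.maxOp f).fst = -(dTau p.τ (dTau p.τ (f : PairSpace p.l).fst)) := rfl

theorem maxOp_snd (f : p.maxOp.domain) :
    (p.maxOp f).snd = -((p.η : ℂ)⁻¹ * p.bdryD (f : PairSpace p.l).fst) +
      p.γ * ((p.η : ℂ) ^ 2)⁻¹ * (f : PairSpace p.l).snd := rfl

theorem ω_mul_conj : p.ω * (starRingEnd ℂ) p.ω = 1 := by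
  rw [Complex.mul_conj, Complex.normSq_eq_norm_sq, p.norm_ω]; simp

/-- The first Green identity: the form of the maximal operator and its boundary term. -/
theorem inner_maxOp (f g : p.maxOp.domain) :
    inner ℂ (g : PairSpace p.l) (p.maxOp f) =
      inner ℂ (dTau p.τ (g : PairSpace p.l).fst) (dTau p.τ (f : PairSpace p.l).fst) +
      p.γ * ((p.η : ℂ) ^ 2)⁻¹ *
        ((starRingEnd ℂ) (g : PairSpace p.l).snd * (f : PairSpace p.l).snd) -
      (starRingEnd ℂ) (p.Gamma1 g) * p.Gamma0 f := by
  obtain ⟨f, hf, ef⟩ := f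
  obtain ⟨g, hg, eg⟩ := g
  have hl := p.l_pos
  rw [WithLp.prod_inner_apply]
  change inner ℂ g.fst (p.maxOp ⟨f, _⟩).fst + inner ℂ g.snd (p.maxOp ⟨f, _⟩).snd = _
  rw [maxOp_fst, maxOp_snd]
  simp only [inner_neg_right, RCLike.inner_apply, Gamma0, Gamma1, bdryD]
  have ibp := inner_dTau_add hl p.τ (hf.dTau_mem p.τ) hg.1
  have e1 : (starRingEnd ℂ) (rep g.fst p.l) = p.ω * (starRingEnd ℂ) (rep g.fst 0) := by
    rw [eg, map_mul]
    linear_combination -(starRingEnd ℂ) (rep g.fst p.l) * p.ω_mul_conj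
  rw [e1] at ibp
  simp only [map_sub, map_div₀, Complex.conj_ofReal]
  linear_combination -ibp

/-- Green's identity for the boundary triple `(ℂ, Γ₀, Γ₁)`. -/
theorem green (f g : p.maxOp.domain) :
    inner ℂ (g : PairSpace p.l) (p.maxOp f) - inner ℂ (p.maxOp g) (f : PairSpace p.l) =
      p.Gamma1 f * (starRingEnd ℂ) (p.Gamma0 g) -
        p.Gamma0 f * (starRingEnd ℂ) (p.Gamma1 g) := by
  have h1 := p.inner_maxOp f g
  have h2 := congrArg (starRingEnd ℂ) (p.inner_maxOp g f)
  rw [inner_conj_symm] at h2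
  simp only [map_sub, map_add, map_mul, Complex.conj_conj, inner_conj_symm, Complex.conj_ofReal,
    map_inv₀, map_pow] at h2
  linear_combination h1 - h2

theorem mem_modelOp_iff {f : PairSpace p.l} :
    f ∈ p.modelOp.domain ↔ f ∈ p.maxOp.domain ∧ p.Gamma1 f = 0 := by
  change f ∈ p.maxOp.domain ∧ p.Gamma1 f = 0 * p.Gamma0 f ↔ _
  rw [zero_mul]

theorem extOp_apply {ϰ : ℂ} (f : (p.extOp ϰ).domain) :
    p.extOp ϰ f = p.maxOp ⟨f, f.2.1⟩ := rfl

theorem modelOp_apply (f : p.modelOp.domain) : p.modelOp f = p.maxOp ⟨f, f.2.1⟩ := rfl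

theorem modelOp_symmetric (f g : p.modelOp.domain) :
    inner ℂ (g : PairSpace p.l) (p.modelOp f) = inner ℂ (p.modelOp g) (f : PairSpace p.l) := by
  obtain ⟨hf, ef⟩ := p.mem_modelOp_iff.1 f.2
  obtain ⟨hg, eg⟩ := p.mem_modelOp_iff.1 g.2
  have h := p.green ⟨f, hf⟩ ⟨g, hg⟩
  rw [ef, eg, map_zero, mul_zero, zero_mul, sub_zero, sub_eq_zero] at h
  exact h

/-- The quadratic form of the model operator. -/
theorem inner_modelOp_self (f : p.modelOp.domain) :
    inner ℂ (f : PairSpace p.l) (p.modelOp f) =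
      ((‖dTau p.τ (f : PairSpace p.l).fst‖ ^ 2 +
        p.γ / p.η ^ 2 * ‖(f : PairSpace p.l).snd‖ ^ 2 : ℝ) : ℂ) := by
  obtain ⟨hf, ef⟩ := p.mem_modelOp_iff.1 f.2
  have h := p.inner_maxOp ⟨f, hf⟩ ⟨f, hf⟩
  rw [ef, map_zero, zero_mul, sub_zero] at h
  rw [modelOp_apply, h, inner_self_eq_norm_sq_to_K, Complex.conj_mul']
  push_cast
  change (‖dTau p.τ (f : PairSpace p.l).fst‖ : ℂ) ^ 2 + _ = _
  ring

/-- Strict positivity of the model operator: `γ > 0` makes the second component of `f` vanish, and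
then `Γ₁ f = 0` and `∂_τ u = 0` force `u = 0`. -/
theorem modelOp_eq_zero_of_inner_eq_zero (f : p.modelOp.domain)
    (h : inner ℂ (f : PairSpace p.l) (p.modelOp f) = 0) : (f : PairSpace p.l) = 0 := by
  have hl := p.l_pos
  rw [inner_modelOp_self, Complex.ofReal_eq_zero] at h
  have hpos : 0 < p.γ / p.η ^ 2 := div_pos p.γ_pos (by have := p.η_ne; positivity)
  have hd : ‖dTau p.τ (f : PairSpace p.l).fst‖ ^ 2 = 0 := by
    have h1 : 0 ≤ ‖dTau p.τ (f : PairSpace p.l).fst‖ ^ 2 := by positivity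
    have h2 : 0 ≤ p.γ / p.η ^ 2 * ‖(f : PairSpace p.l).snd‖ ^ 2 := by positivity
    linarith
  have hβ : p.γ / p.η ^ 2 * ‖(f : PairSpace p.l).snd‖ ^ 2 = 0 := by linarith
  have hd' : dTau p.τ (f : PairSpace p.l).fst = 0 := by simpa using hd
  have hs : (f : PairSpace p.l).snd = 0 := by simpa [hpos.ne'] using hβ
  have h1 := (p.mem_modelOp_iff.1 f.2).2
  have hm := f.2.1.1
  rw [Gamma1, hs, zero_div, zero_sub, neg_eq_zero] at h1
  have hfst : (f : PairSpace p.l).fst = 0 := by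
    rw [Lp.eq_zero_iff_ae_eq_zero]
    have hder : ∀ x, HasDerivAt (trig (-p.τ) 0 1 0)
        (((Complex.I * p.τ) • trig (-p.τ) 0 1 0 : C(ℝ, ℂ)) x) x := fun x => by
      refine (hasDerivAt_trig (-p.τ) 0 1 0 x).congr_deriv ?_
      simp [trig_apply]
    have hder0 : ∀ x, HasDerivAt (0 : C(ℝ, ℂ)) ((0 : C(ℝ, ℂ)) x) x := fun x =>
      hasDerivAt_const x (0 : ℂ)
    filter_upwards [(hasDerivL2_rep hm.1).ae_eq, ae_restrict_mem measurableSet_Ioo] with x e hx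
    have := rep_mul_add_rep_mul_eq hl hm.1 hm.1 hder hder0 (by
      have e0 := dTau_coe p.τ (f : PairSpace p.l).fst
      rw [hd'] at e0
      filter_upwards [e0, Lp.coeFn_zero ℂ 2 (volume.restrict (Ioo (0 : ℝ) p.l))] with t e1 e2
      rw [e2] at e1
      simp only [ContinuousMap.smul_apply, ContinuousMap.zero_apply, mul_zero, add_zero,
        smul_eq_mul]
      simp only [Pi.zero_apply] at e1
      linear_combination -trig (-p.τ) 0 1 0 t * e1) (Ioo_subset_Icc_self hx)
    rw [h1] at this
    simpa [trig_apply, Complex.exp_ne_zero, ← e] using this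
  exact WithLp.ofLp_injective 2 (Prod.ext hfst hs)

/-! ### The bounded inverse of the model operator -/

/-- The quasi-momentum factor `θ = e^{-iτl} ω`. -/
def theta : ℂ := Complex.exp (-(Complex.I * p.τ * p.l)) * p.ω

theorem theta_mul_conj : p.theta * (starRingEnd ℂ) p.theta = 1 := by
  rw [Complex.mul_conj, Complex.normSq_eq_norm_sq, theta, norm_mul, p.norm_ω,
    norm_exp_neg_I_mul_mul]
  simp

theorem theta_ne_zero : p.theta ≠ 0 := left_ne_zero_of_mul_eq_one p.theta_mul_conj

theorem conj_theta : (starRingEnd ℂ) p.theta =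
    Complex.exp (Complex.I * p.τ * p.l) * (starRingEnd ℂ) p.ω := by
  rw [theta, map_mul, ← Complex.exp_conj]
  simp

theorem theta_add_conj : p.theta + (starRingEnd ℂ) p.theta = 2 * p.cosAngle := by
  rw [Complex.add_conj, cosAngle, ← conj_theta, Complex.conj_re]
  push_cast; ring

/-- The reciprocals `θ` and `\bar θ` are the roots of `X² - 2 c X + 1`; this is how `c` enters all
the boundary computations. -/
theorem theta_sq : p.theta ^ 2 + 1 = 2 * p.cosAngle * p.theta := by
  rw [← theta_add_conj]
  linear_combination -p.theta_mul_conj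

theorem norm_theta : ‖p.theta‖ = 1 := by
  rw [theta, norm_mul, p.norm_ω, norm_exp_neg_I_mul_mul, one_mul]

theorem cosAngle_eq_re : p.cosAngle = p.theta.re := by
  rw [cosAngle, ← conj_theta, Complex.conj_re]

theorem abs_cosAngle_le : |p.cosAngle| ≤ 1 := by
  rw [cosAngle_eq_re, ← p.norm_theta]
  exact Complex.abs_re_le_norm _

theorem ω_eq : p.ω = Complex.exp (Complex.I * p.τ * p.l) * p.theta := by
  rw [theta, ← mul_assoc, ← Complex.exp_add]; simp

/-- The determinant of the linear system for the Cauchy data of `A⁻¹ f`; it does not vanish because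
`|c| ≤ 1` and `γ > 0`. -/
def detZero : ℂ := p.theta * (2 - 2 * p.cosAngle + p.l * p.γ)

theorem detZero_eq : p.detZero = p.theta * p.l * p.γ - (1 - p.theta) ^ 2 := by
  rw [detZero]; linear_combination p.theta_sq

theorem detZero_ne : p.detZero ≠ 0 := by
  refine mul_ne_zero p.theta_ne_zero ?_
  have h1 : 0 < 2 - 2 * p.cosAngle + p.l * p.γ := by
    have := (abs_le.1 p.abs_cosAngle_le).2
    have := mul_pos p.l_pos p.γ_pos
    linarith
  exact_mod_cast h1.ne'

/-- The inclusion of `L²(0, l)` into the pair space. -/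
def inlCLM : L2 p.l →L[ℂ] PairSpace p.l :=
  (WithLp.prodContinuousLinearEquiv 2 ℂ (L2 p.l) ℂ).symm.toContinuousLinearMap.comp
    (ContinuousLinearMap.inl ℂ (L2 p.l) ℂ)

/-- The functional `f ↦ ∫₀ˡ e^{iτt} f(t) dt`. -/
def primEnd : L2 p.l →L[ℂ] ℂ := primFunctional p.l p.τ ⟨p.l, p.l_pos.le, le_rfl⟩

/-- The solution of `∂_τ e = 0`, `e(0) = 1`. -/
def expL2 : L2 p.l := ofCont p.l (trig p.τ 0 1 0)

/-- The right-hand side of the equation `(1 - θ) u(0) - θ l ∂_τ u(0) = …` for the Cauchy data of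
`A⁻¹ f`, which expresses `u(0) = ω u(l)`. -/
def rhs1 : PairSpace p.l →L[ℂ] ℂ :=
  (-p.theta) • (p.primEnd.comp (primOp p.l_pos p.τ)).comp (WithLp.fstL 2 ℂ (L2 p.l) ℂ)

/-- The right-hand side of the equation `γ u(0) - (1 - θ) ∂_τ u(0) = …` for the Cauchy data of
`A⁻¹ f`, which expresses the second component of `A (A⁻¹ f) = f`. -/
def rhs2 : PairSpace p.l →L[ℂ] ℂ :=
  (p.η : ℂ) • (WithLp.sndL 2 ℂ (L2 p.l) ℂ) + p.theta • p.primEnd.comp (WithLp.fstL 2 ℂ (L2 p.l) ℂ)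

/-- The boundary value `u(0)` of the first component `u` of `A⁻¹ f`. -/
def cauchy0 : PairSpace p.l →L[ℂ] ℂ :=
  (p.detZero)⁻¹ • ((p.theta * p.l) • p.rhs2 - (1 - p.theta) • p.rhs1)

/-- The boundary value `∂_τ u(0)` of the first component `u` of `A⁻¹ f`. -/
def cauchy1 : PairSpace p.l →L[ℂ] ℂ :=
  (p.detZero)⁻¹ • ((1 - p.theta) • p.rhs2 - (p.γ : ℂ) • p.rhs1)

/-- The inverse of the model operator: if `K` solves `∂_τ U = f`, `U(0) = 0`, and `e` solves
`∂_τ e = 0`, `e(0) = 1`, the first component of `A⁻¹ (f, α)` is `u(0) e + ∂_τ u(0) K e - K² f`, and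
the second one is `η u(0)`. -/
def invOp : PairSpace p.l →L[ℂ] PairSpace p.l :=
  p.cauchy0.smulRight (WithLp.toLp 2 (p.expL2, (p.η : ℂ))) +
    p.cauchy1.smulRight (WithLp.toLp 2 (primOp p.l_pos p.τ p.expL2, 0)) -
    ((p.inlCLM.comp (primOp p.l_pos p.τ)).comp (primOp p.l_pos p.τ)).comp (WithLp.fstL 2 ℂ (L2 p.l) ℂ)

theorem isCompactOperator_invOp : IsCompactOperator p.invOp := by
  have h1 : IsCompactOperator
      (((p.inlCLM.comp (primOp p.l_pos p.τ)).comp (primOp p.l_pos p.τ)).comp (WithLp.fstL 2 ℂ (L2 p.l) ℂ)) :=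
    ((isCompactOperator_primOp p.l_pos p.τ).clm_comp
      (p.inlCLM.comp (primOp p.l_pos p.τ))).comp_clm (WithLp.fstL 2 ℂ (L2 p.l) ℂ)
  exact ((isCompactOperator_smulRight _ _).add (isCompactOperator_smulRight _ _)).sub h1

theorem invOp_fst (f : PairSpace p.l) : (p.invOp f).fst =
    p.cauchy0 f • p.expL2 +
      primOp p.l_pos p.τ (p.cauchy1 f • p.expL2 - primOp p.l_pos p.τ f.fst) := by
  rw [map_sub, map_smul, ← add_sub_assoc]; rfl

theorem invOp_snd (f : PairSpace p.l) : (p.invOp f).snd = p.cauchy0 f * p.η := by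
  change p.cauchy0 f * (p.η : ℂ) + p.cauchy1 f * 0 - 0 = _
  ring

theorem dTau_expL2 : dTau p.τ p.expL2 = 0 := by
  rw [expL2, dTau_trig p.l_pos]
  have := ofCont_congr (l := p.l) (g := trig p.τ 0 1 0) (c := 0)
    (h := trig p.τ 0 (0 * 0) (-(0 * 1))) fun x => by simp [trig_apply]
  rw [this, zero_smul]

theorem rep_expL2 {x : ℝ} (hx : x ∈ Icc (0 : ℝ) p.l) :
    rep p.expL2 x = Complex.exp (-(Complex.I * p.τ * x)) := by
  rw [expL2, rep_trig p.l_pos _ _ _ _ hx, trig_apply]; simp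

theorem primEnd_expL2 : p.primEnd p.expL2 = p.l := by
  have hl := p.l_pos
  rw [primEnd, primFunctional_apply, integral_congr_L2 (g := fun _ => 1) _ ⟨hl.le, le_rfl⟩]
  · simp
  · filter_upwards [ofCont_coe p.l (trig p.τ 0 1 0)] with x e
    rw [expL2, e, trig_apply]
    simp only [zero_mul, Complex.cos_zero, mul_one, add_zero]
    rw [← Complex.exp_add]; simp

theorem rep_primOp_end (f : L2 p.l) : rep (primOp p.l_pos p.τ f) p.l =
    Complex.exp (-(Complex.I * p.τ * p.l)) * p.primEnd f :=
  (dTau_primOp p.l_pos p.τ f).2.2 p.l ⟨p.l_pos.le, le_rfl⟩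

theorem rep_primOp_zero (f : L2 p.l) : rep (primOp p.l_pos p.τ f) 0 = 0 := by
  rw [(dTau_primOp p.l_pos p.τ f).2.2 0 ⟨le_rfl, p.l_pos.le⟩]
  simp [primRep]

/-- `A` maps `A⁻¹ f` to `f`. -/
theorem modelOp_invOp (f : PairSpace p.l) :
    ∃ h : p.invOp f ∈ p.modelOp.domain, p.modelOp ⟨p.invOp f, h⟩ = f := by
  have hl := p.l_pos
  have m0 : (0 : ℝ) ∈ Icc (0 : ℝ) p.l := ⟨le_rfl, hl.le⟩
  have ml : p.l ∈ Icc (0 : ℝ) p.l := ⟨hl.le, le_rfl⟩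
  have hη : (p.η : ℂ) ≠ 0 := by exact_mod_cast p.η_ne
  set a := p.cauchy0 f with ha
  set b := p.cauchy1 f with hb
  have hK := fun g => (dTau_primOp p.l_pos p.τ g).1
  have hE : p.expL2 ∈ W12 p.l := (memW22_trig hl p.τ 0 1 0).1
  have hE' := (W12 p.l).smul_mem a hE
  have hE'' := (W12 p.l).smul_mem b hE
  have hd : dTau p.τ (p.invOp f).fst = b • p.expL2 - primOp p.l_pos p.τ f.fst := by
    rw [invOp_fst, dTau_add hl _ hE' (hK _), dTau_smul hl _ _ hE, dTau_expL2, smul_zero, zero_add,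
      (dTau_primOp p.l_pos p.τ _).2.1]
  have hsub : b • p.expL2 - primOp p.l_pos p.τ f.fst =
      b • p.expL2 + primOp p.l_pos p.τ (-f.fst) := by rw [map_neg, sub_eq_add_neg]
  have hdd : dTau p.τ (dTau p.τ (p.invOp f).fst) = -f.fst := by
    rw [hd, hsub, dTau_add hl _ hE'' (hK _), dTau_smul hl _ _ hE, dTau_expL2, smul_zero, zero_add,
      (dTau_primOp p.l_pos p.τ _).2.1]
  have hW : MemW22 (p.invOp f).fst := by
    refine memW22_of_dTau p.τ ?_ ?_
    · rw [invOp_fst]; exact (W12 p.l).add_mem hE' (hK _)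
    · rw [hd]; exact (W12 p.l).sub_mem hE'' (hK _)
  have r0 : rep (p.invOp f).fst 0 = a := by
    rw [invOp_fst, rep_add hl hE' (hK _) m0, rep_smul hl _ hE m0, rep_expL2 _ m0, rep_primOp_zero]
    simp [a]
  have rl : rep (p.invOp f).fst p.l = Complex.exp (-(Complex.I * p.τ * p.l)) *
      (a + b * p.l - p.primEnd (primOp p.l_pos p.τ f.fst)) := by
    rw [invOp_fst, rep_add hl hE' (hK _) ml, rep_smul hl _ hE ml, rep_expL2 _ ml, rep_primOp_end,
      map_sub, map_smul, primEnd_expL2, smul_eq_mul]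
    ring
  have d0 : rep (dTau p.τ (p.invOp f).fst) 0 = b := by
    rw [hd, hsub, rep_add hl hE'' (hK _) m0, rep_smul hl _ hE m0, rep_expL2 _ m0, rep_primOp_zero]
    simp
  have dl : rep (dTau p.τ (p.invOp f).fst) p.l = Complex.exp (-(Complex.I * p.τ * p.l)) *
      (b - p.primEnd f.fst) := by
    rw [hd, hsub, rep_add hl hE'' (hK _) ml, rep_smul hl _ hE ml, rep_expL2 _ ml, rep_primOp_end,
      map_neg]
    ring
  have hr1 : p.rhs1 f = -p.theta * p.primEnd (primOp p.l_pos p.τ f.fst) := rfl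
  have hr2 : p.rhs2 f = p.η * f.snd + p.theta * p.primEnd f.fst := rfl
  have hA : p.detZero * a = p.theta * p.l * p.rhs2 f - (1 - p.theta) * p.rhs1 f := by
    change p.detZero * ((p.detZero)⁻¹ * _) = _
    rw [mul_inv_cancel_left₀ p.detZero_ne]; rfl
  have hB : p.detZero * b = (1 - p.theta) * p.rhs2 f - p.γ * p.rhs1 f := by
    change p.detZero * ((p.detZero)⁻¹ * _) = _
    rw [mul_inv_cancel_left₀ p.detZero_ne]; rfl
  -- the two equations of the linear system for the Cauchy data
  have s1 : (1 - p.theta) * a - p.theta * p.l * b = p.rhs1 f := by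
    refine mul_left_cancel₀ p.detZero_ne ?_
    linear_combination (1 - p.theta) * hA - p.theta * p.l * hB - p.rhs1 f * p.detZero_eq
  have s2 : p.γ * a - (1 - p.theta) * b = p.rhs2 f := by
    refine mul_left_cancel₀ p.detZero_ne ?_
    linear_combination p.γ * hA - (1 - p.theta) * hB - p.rhs2 f * p.detZero_eq
  have hθ : p.ω * Complex.exp (-(Complex.I * p.τ * p.l)) = p.theta := by rw [theta]; ring
  have hmax : p.invOp f ∈ p.maxOp.domain := by
    refine ⟨hW, ?_⟩
    rw [r0, rl, ← mul_assoc, hθ]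
    linear_combination s1 + hr1
  have hG1 : p.Gamma1 (p.invOp f) = 0 := by
    rw [Gamma1, r0, invOp_snd, ← ha]
    field_simp
    ring
  refine ⟨p.mem_modelOp_iff.2 ⟨hmax, hG1⟩, ?_⟩
  refine WithLp.ofLp_injective 2 (Prod.ext ?_ ?_)
  · change -(dTau p.τ (dTau p.τ (p.invOp f).fst)) = f.fst
    rw [hdd, neg_neg]
  · change -((p.η : ℂ)⁻¹ * p.bdryD (p.invOp f).fst) +
      p.γ * ((p.η : ℂ) ^ 2)⁻¹ * (p.invOp f).snd = f.snd
    rw [bdryD, d0, dl, invOp_snd, ← ha, ← mul_assoc p.ω, hθ]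
    field_simp
    linear_combination s2 + hr2

theorem modelOp_sub_apply (f g : p.modelOp.domain) :
    ∃ h : (f : PairSpace p.l) - g ∈ p.modelOp.domain,
      p.modelOp ⟨(f : PairSpace p.l) - g, h⟩ = p.modelOp f - p.modelOp g :=
  ⟨p.modelOp.domain.sub_mem f.2 g.2, by rw [← LinearPMap.map_sub]; rfl⟩

theorem isResolvent_invOp : IsResolvent p.modelOp 0 p.invOp := by
  intro f h
  obtain ⟨hm, he⟩ := p.modelOp_invOp h
  simp only [zero_smul, sub_zero]
  constructor
  · rintro rfl
    exact ⟨hm, he⟩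
  · rintro ⟨hh, e⟩
    obtain ⟨hs, es⟩ := p.modelOp_sub_apply ⟨_, hm⟩ ⟨_, hh⟩
    rw [he, e, sub_self] at es
    exact sub_eq_zero.1 (p.modelOp_eq_zero_of_inner_eq_zero ⟨_, hs⟩ (by rw [es, inner_zero_right]))

theorem isSymmetric_invOp : (p.invOp : PairSpace p.l →ₗ[ℂ] PairSpace p.l).IsSymmetric := by
  intro f g
  obtain ⟨hf, ef⟩ := p.modelOp_invOp f
  obtain ⟨hg, eg⟩ := p.modelOp_invOp g
  have := p.modelOp_symmetric ⟨_, hg⟩ ⟨_, hf⟩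
  rw [ef, eg] at this
  exact this

end ModelParams

/-! ### Resolvents of self-adjoint operators -/

section Resolvent

universe u

variable {H : Type u} [NormedAddCommGroup H] [InnerProductSpace ℂ H] {T : H →ₗ.[ℂ] H}

theorem IsResolvent.unique {z : ℂ} {R R' : H →L[ℂ] H} (h : IsResolvent T z R)
    (h' : IsResolvent T z R') : R = R' := by
  ext f
  exact (h (R' f) f).2 ((h' (R' f) f).1 rfl)

theorem IsResolvent.resolventOp_eq {z : ℂ} {R : H →L[ℂ] H} (h : IsResolvent T z R) :
    resolventOp T z = R := by
  have hz : InResolventSet T z := ⟨R, h⟩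
  rw [resolventOp, dif_pos hz]
  exact hz.choose_spec.unique h

theorem InResolventSet.isResolvent {z : ℂ} (h : InResolventSet T z) :
    IsResolvent T z (resolventOp T z) := by
  obtain ⟨R, hR⟩ := h
  rw [hR.resolventOp_eq]; exact hR

/-- If `T` has a bounded self-adjoint inverse then every non-real `z` is in its resolvent set. -/
theorem inResolventSet_of_isSymmetric_inverse [CompleteSpace H] {S : H →L[ℂ] H}
    (hS : IsResolvent T 0 S) (hsym : (S : H →ₗ[ℂ] H).IsSymmetric) {z : ℂ} (hz : z.im ≠ 0) :
    InResolventSet T z := by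
  have hz0 : z ≠ 0 := by rintro rfl; simp at hz
  have hsa : IsSelfAdjoint S := ContinuousLinearMap.isSelfAdjoint_iff_isSymmetric.2 hsym
  have hnot : z⁻¹ ∉ spectrum ℂ S := by
    intro h
    have h1 := congrArg Complex.im (hsa.mem_spectrum_eq_re h)
    rw [Complex.inv_im, Complex.ofReal_im, div_eq_zero_iff, neg_eq_zero] at h1
    rcases h1 with h1 | h1
    · exact hz h1
    · exact hz0 (Complex.normSq_eq_zero.1 h1)
  rw [spectrum.notMem_iff] at hnot
  obtain ⟨V, hV⟩ := hnot
  have hV1 : ∀ f, (V : H →L[ℂ] H) f = z⁻¹ • f - S f := fun f => by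
    rw [hV]; simp [Algebra.algebraMap_eq_smul_one]
  have hVV : ∀ f, (V : H →L[ℂ] H) ((↑V⁻¹ : H →L[ℂ] H) f) = f := fun f => by
    rw [← mul_apply_eq_comp, Units.mul_inv]; rfl
  have hVV' : ∀ f, (↑V⁻¹ : H →L[ℂ] H) ((V : H →L[ℂ] H) f) = f := fun f => by
    rw [← mul_apply_eq_comp, Units.inv_mul]; rfl
  refine ⟨z⁻¹ • ((↑V⁻¹ : H →L[ℂ] H).comp S), fun g f => ?_⟩
  have hS' := hS
  simp only [IsResolvent, zero_smul, sub_zero] at hS'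
  have key : (∃ hf : g ∈ T.domain, T ⟨g, hf⟩ - z • g = f) ↔ S (f + z • g) = g := by
    rw [hS']
    exact exists_congr fun h => sub_eq_iff_eq_add
  rw [key]
  simp only [_root_.smul_apply, ContinuousLinearMap.comp_apply]
  constructor
  · rintro rfl
    set w := (↑V⁻¹ : H →L[ℂ] H) (S f) with hw
    have e := hVV (S f)
    rw [← hw, hV1] at e
    rw [map_add, map_smul, map_smul, smul_smul, mul_inv_cancel₀ hz0, one_smul, ← e]
    abel
  · intro h
    have e : S f = z • (V : H →L[ℂ] H) g := by
      rw [hV1, smul_sub, smul_smul, mul_inv_cancel₀ hz0, one_smul]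
      rw [map_add, map_smul] at h
      exact eq_sub_of_add_eq h
    rw [e, map_smul, hVV', smul_smul, inv_mul_cancel₀ hz0, one_smul]

/-- A compact self-adjoint operator has a Hilbert basis of eigenvectors. -/
theorem exists_hilbertBasis_eigenvectors [CompleteSpace H] {S : H →L[ℂ] H}
    (hc : IsCompactOperator S) (hsym : (S : H →ₗ[ℂ] H).IsSymmetric) :
    ∃ (ι : Type u) (b : HilbertBasis ι ℂ H), ∀ i, ∃ c : ℂ, S (b i) = c • b i := by
  have hof := hsym.orthogonalFamily_eigenspaces
  have hcl : ∀ c : ℂ, IsClosed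
      (Module.End.eigenspace (S : H →ₗ[ℂ] H) c : Set H) := fun c => by
    have : (Module.End.eigenspace (S : H →ₗ[ℂ] H) c : Set H) = {x | S x = c • x} := by
      ext x; simp
    rw [this]
    exact isClosed_eq S.continuous (continuous_const_smul c)
  have : ∀ c : ℂ, CompleteSpace (Module.End.eigenspace (S : H →ₗ[ℂ] H) c) := fun c =>
    (hcl c).completeSpace_coe
  choose w B hB using fun c : ℂ =>
    exists_hilbertBasis ℂ (Module.End.eigenspace (S : H →ₗ[ℂ] H) c)
  have hon := hof.orthonormal_sigma_orthonormal (v_family := fun c => B c)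
    fun c => (B c).orthonormal
  refine ⟨_, HilbertBasis.mkOfOrthogonalEqBot hon ?_, ?_⟩
  · rw [Submodule.eq_bot_iff]
    intro x hx
    have hx' : x ∈ (⨆ c, Module.End.eigenspace (S : H →ₗ[ℂ] H) c)ᗮ := by
      rw [← Submodule.iInf_orthogonal, Submodule.mem_iInf]
      intro c
      rw [Submodule.mem_orthogonal']
      intro y hy
      have h1 := ((innerSL ℂ x).comp
        (Module.End.eigenspace (S : H →ₗ[ℂ] H) c).subtypeL).hasSum ((B c).hasSum_repr ⟨y, hy⟩)
      have h2 : ∀ i, ((innerSL ℂ x).comp (Module.End.eigenspace (S : H →ₗ[ℂ] H) c).subtypeL)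
          ((B c).repr ⟨y, hy⟩ i • B c i) = 0 := fun i => by
        have := (Submodule.mem_orthogonal' _ _).1 hx _ (Submodule.subset_span ⟨⟨c, i⟩, rfl⟩)
        rw [map_smul]
        change _ • inner ℂ x (B c i : H) = 0
        rw [smul_eq_mul, mul_eq_zero]
        exact Or.inr this
      simp only [h2] at h1
      exact h1.unique hasSum_zero
    rw [ContinuousLinearMap.orthogonalComplement_iSup_eigenspaces_eq_bot hc hsym] at hx'
    exact hx'
  · rintro ⟨c, i⟩
    refine ⟨c, ?_⟩
    rw [HilbertBasis.coe_mkOfOrthogonalEqBot]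
    exact Module.End.mem_eigenspace_iff.1 (B c i).2

end Resolvent

/-! ### The deficiency vectors and the `M`-function -/

theorem norm_ofCont_sub_le {l : ℝ} (hl : 0 < l) {g h : C(ℝ, ℂ)} {C : ℝ} (hC : 0 ≤ C)
    (H : ∀ x ∈ Icc (0 : ℝ) l, ‖g x - h x‖ ≤ C) : ‖ofCont l g - ofCont l h‖ ≤ √l * C := by
  refine norm_L2_le hl hC ?_
  filter_upwards [Lp.coeFn_sub (ofCont l g) (ofCont l h), ofCont_coe l g, ofCont_coe l h,
    ae_restrict_mem measurableSet_Ioo] with x e1 e2 e3 hx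
  rw [e1, Pi.sub_apply, e2, e3]
  exact H x (Ioo_subset_Icc_self hx)

theorem continuous_ofCont {l : ℝ} (hl : 0 < l) : Continuous (ofCont l) := by
  rw [continuous_iff_continuousAt]
  intro g
  rw [Metric.continuousAt_iff']
  intro ε hε
  have h1 := (ContinuousMap.tendsto_iff_forall_isCompact_tendstoUniformlyOn
    (F := id) (p := 𝓝 g) (f := g)).1 tendsto_id _ (isCompact_Icc (a := (0 : ℝ)) (b := l))
  have hpos : 0 < ε / (√l + 1) := by positivity
  filter_upwards [Metric.tendstoUniformlyOn_iff.1 h1 _ hpos] with h hh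
  rw [dist_eq_norm]
  have : ‖ofCont l h - ofCont l g‖ ≤ √l * (ε / (√l + 1)) :=
    norm_ofCont_sub_le hl hpos.le fun x hx => by
      have := hh x hx
      rw [dist_comm, dist_eq_norm] at this
      exact this.le
  refine this.trans_lt ?_
  rw [mul_div_assoc', div_lt_iff₀ (by positivity)]
  nlinarith [Real.sqrt_nonneg l]

theorem continuous_trig (τ : ℝ) :
    Continuous fun q : ℂ × ℂ × ℂ => trig τ q.1 q.2.1 q.2.2 := by
  refine ContinuousMap.continuous_of_continuous_uncurry _ ?_
  simp only [Function.uncurry_def, trig_apply]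
  fun_prop

namespace ModelParams

variable (p : ModelParams)

/-- The characteristic determinant in the variable `k = √z`, an entire function: the square roots of
the eigenvalues of `A` are zeros of it. -/
def disp (k : ℂ) : ℂ :=
  (p.η ^ 2 * k ^ 2 - p.γ) * Complex.sin (k * p.l) + 2 * k * (p.cosAngle - Complex.cos (k * p.l))

/-- The values of `k` for which `ker (A_max - k²)` has an element with `Γ₀ f = 1` given by the
formula in `kerVec`: its denominators must not vanish. -/
structure Admissible (k : ℂ) : Prop where
  ne_zero : k ≠ 0
  cos_ne : (p.cosAngle : ℂ) - Complex.cos (k * p.l) ≠ 0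
  pole_ne : (p.γ : ℂ) - p.η ^ 2 * k ^ 2 ≠ 0

/-- The element `f` of `ker (A_max - k²)` with `Γ₀ f = 1`, for `k` admissible. -/
def kerVec (k : ℂ) : PairSpace p.l :=
  WithLp.toLp 2 (ofCont p.l (trig p.τ k
      (Complex.sin (k * p.l) / (2 * k * (p.cosAngle - Complex.cos (k * p.l))))
      ((1 - p.theta * Complex.cos (k * p.l)) /
        (2 * k * p.theta * (p.cosAngle - Complex.cos (k * p.l))))),
    p.η / (p.γ - p.η ^ 2 * k ^ 2))

/-- The `M`-function in the variable `k = √z`. -/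
def mFun (k : ℂ) : ℂ :=
  1 / (p.γ - p.η ^ 2 * k ^ 2) - Complex.sin (k * p.l) / (2 * k * (p.cosAngle - Complex.cos (k * p.l)))

variable {p}

theorem Admissible.kerVec_mem {k : ℂ} (hk : p.Admissible k) :
    ∃ h : p.kerVec k ∈ p.maxOp.domain, p.maxOp ⟨p.kerVec k, h⟩ = k ^ 2 • p.kerVec k ∧
      p.Gamma0 (p.kerVec k) = 1 ∧ p.Gamma1 (p.kerVec k) = p.mFun k := by
  have hl := p.l_pos
  have m0 : (0 : ℝ) ∈ Icc (0 : ℝ) p.l := ⟨le_rfl, hl.le⟩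
  have ml : p.l ∈ Icc (0 : ℝ) p.l := ⟨hl.le, le_rfl⟩
  have hη : (p.η : ℂ) ≠ 0 := by exact_mod_cast p.η_ne
  obtain ⟨hk0, hc, hp⟩ := hk
  have hθ := p.theta_ne_zero
  have hω : p.ω * Complex.exp (-(Complex.I * p.τ * p.l)) = p.theta := by rw [theta]; ring
  set C := Complex.cos (k * p.l) with hC
  set S := Complex.sin (k * p.l) with hS
  have hCS : S ^ 2 + C ^ 2 = 1 := Complex.sin_sq_add_cos_sq _
  set a := S / (2 * k * (p.cosAngle - C)) with ha
  set b := (1 - p.theta * C) / (2 * k * p.theta * (p.cosAngle - C)) with hb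
  have hv : (p.kerVec k).fst = ofCont p.l (trig p.τ k a b) := rfl
  have hv2 : (p.kerVec k).snd = p.η / (p.γ - p.η ^ 2 * k ^ 2) := rfl
  have r0 : rep (p.kerVec k).fst 0 = a := by
    rw [hv, rep_trig hl _ _ _ _ m0, trig_apply]; simp
  have rl : rep (p.kerVec k).fst p.l =
      Complex.exp (-(Complex.I * p.τ * p.l)) * (a * C + b * S) := by
    rw [hv, rep_trig hl _ _ _ _ ml, trig_apply]
  have d0 : rep (dTau p.τ (p.kerVec k).fst) 0 = k * b := by
    rw [hv, dTau_trig hl, rep_trig hl _ _ _ _ m0, trig_apply]; simp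
  have dl : rep (dTau p.τ (p.kerVec k).fst) p.l =
      Complex.exp (-(Complex.I * p.τ * p.l)) * (k * b * C - k * a * S) := by
    rw [hv, dTau_trig hl, rep_trig hl _ _ _ _ ml, trig_apply]; ring
  have hD : p.bdryD (p.kerVec k).fst = 1 := by
    rw [bdryD, d0, dl, ← mul_assoc, hω, ha, hb]
    field_simp
    linear_combination p.theta ^ 2 * hCS + p.theta_sq
  have hmem : p.kerVec k ∈ p.maxOp.domain := by
    refine ⟨by rw [hv]; exact memW22_trig hl _ _ _ _, ?_⟩
    rw [r0, rl, ← mul_assoc, hω, ha, hb]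
    field_simp
    ring
  refine ⟨hmem, ?_, hD, ?_⟩
  · refine WithLp.ofLp_injective 2 (Prod.ext ?_ ?_)
    · exact neg_dTau_dTau_trig hl p.τ k a b
    · change -((p.η : ℂ)⁻¹ * p.bdryD (p.kerVec k).fst) +
        p.γ * ((p.η : ℂ) ^ 2)⁻¹ * (p.kerVec k).snd = k ^ 2 * (p.kerVec k).snd
      rw [hD, hv2]
      field_simp
      ring
  · have e : (p.η : ℂ) / (p.γ - p.η ^ 2 * k ^ 2) / p.η = 1 / (p.γ - p.η ^ 2 * k ^ 2) := by
      field_simp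
    rw [Gamma1, r0, hv2, e, mFun]

theorem Admissible.kerVec_ne_zero {k : ℂ} (hk : p.Admissible k) : p.kerVec k ≠ 0 := by
  intro h
  obtain ⟨hm, -, h1, -⟩ := hk.kerVec_mem
  have h2 := p.bdryD_smul 0 (MemW22.zero p.l_pos)
  rw [zero_smul, zero_mul] at h2
  rw [h] at h1
  exact one_ne_zero (h1.symm.trans h2)

/-- The closed form of `-1/m`. -/
theorem Admissible.neg_inv_mFun {k : ℂ} (hk : p.Admissible k) :
    -(p.mFun k)⁻¹ = 2 * k * (p.cosAngle - Complex.cos (k * p.l)) * (p.η ^ 2 * k ^ 2 - p.γ) /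
      p.disp k := by
  obtain ⟨hk0, hc, hp⟩ := hk
  have : p.mFun k = p.disp k /
      ((p.γ - p.η ^ 2 * k ^ 2) * (2 * k * (p.cosAngle - Complex.cos (k * p.l)))) := by
    rw [mFun, disp]
    field_simp
    ring
  rw [this, inv_div, ← neg_div]
  congr 1
  ring

theorem Admissible.mFun_eq_zero {k : ℂ} (hk : p.Admissible k) (h : p.disp k = 0) :
    p.mFun k = 0 := by
  have := hk.neg_inv_mFun
  rw [h, div_zero, neg_eq_zero, inv_eq_zero] at this
  exact this

theorem Admissible.continuousAt_kerVec {k : ℂ} (hk : p.Admissible k) :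
    ContinuousAt p.kerVec k := by
  obtain ⟨hk0, hc, hp⟩ := hk
  have hθ := p.theta_ne_zero
  have h1 : ContinuousAt (fun k : ℂ => ofCont p.l (trig p.τ k
      (Complex.sin (k * p.l) / (2 * k * (p.cosAngle - Complex.cos (k * p.l))))
      ((1 - p.theta * Complex.cos (k * p.l)) /
        (2 * k * p.theta * (p.cosAngle - Complex.cos (k * p.l)))))) k := by
    refine ((continuous_ofCont p.l_pos).comp (continuous_trig p.τ)).continuousAt.comp
      (f := fun k : ℂ => (k, Complex.sin (k * p.l) / (2 * k * (p.cosAngle - Complex.cos (k * p.l))),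
      (1 - p.theta * Complex.cos (k * p.l)) /
        (2 * k * p.theta * (p.cosAngle - Complex.cos (k * p.l))))) ?_
    refine continuousAt_id.prodMk (ContinuousAt.prodMk ?_ ?_)
    · exact ContinuousAt.div (by fun_prop) (by fun_prop) (by simp [hk0, hc])
    · exact ContinuousAt.div (by fun_prop) (by fun_prop) (by simp [hk0, hc, hθ])
  have h2 : ContinuousAt (fun k : ℂ => (p.η : ℂ) / (p.γ - p.η ^ 2 * k ^ 2)) k :=
    ContinuousAt.div (by fun_prop) (by fun_prop) hp
  exact (WithLp.prodContinuousLinearEquiv 2 ℂ (L2 p.l) ℂ).symm.continuous.continuousAt.comp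
    (h1.prodMk h2)

theorem Admissible.continuousAt_mFun {k : ℂ} (hk : p.Admissible k) :
    ContinuousAt p.mFun k := by
  obtain ⟨hk0, hc, hp⟩ := hk
  exact ContinuousAt.sub (ContinuousAt.div (by fun_prop) (by fun_prop) hp)
    (ContinuousAt.div (by fun_prop) (by fun_prop) (by simp [hk0, hc]))

theorem complexSqrt_sq (z : ℂ) : Complex.sqrt z ^ 2 = z := by
  exact_mod_cast Complex.cpow_nat_inv_pow z two_ne_zero

/-- Non-real `k²` are admissible, since `cos kl = c ∈ [-1, 1]` forces `k` to be real. -/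
theorem admissible_of_im_ne {k : ℂ} (h : (k ^ 2).im ≠ 0) : p.Admissible k where
  ne_zero := by rintro rfl; simp at h
  cos_ne := by
    intro h0
    obtain ⟨c1, c2⟩ := abs_le.1 p.abs_cosAngle_le
    rw [sub_eq_zero, ← Real.cos_arccos c1 c2, Complex.ofReal_cos, Complex.cos_eq_cos_iff] at h0
    obtain ⟨n, hn⟩ := h0
    have hl : (p.l : ℂ) ≠ 0 := by exact_mod_cast p.l_pos.ne'
    have : ∃ r : ℝ, k = r := by
      rcases hn with hn | hn
      · refine ⟨(2 * n * Real.pi + Real.arccos p.cosAngle) / p.l, ?_⟩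
        push_cast
        rw [eq_div_iff hl, hn]
      · refine ⟨(2 * n * Real.pi - Real.arccos p.cosAngle) / p.l, ?_⟩
        push_cast
        rw [eq_div_iff hl, hn]
    obtain ⟨r, rfl⟩ := this
    rw [← Complex.ofReal_pow, Complex.ofReal_im] at h
    exact h rfl
  pole_ne := by
    intro h0
    have := congrArg Complex.im h0
    have e : (p.η : ℂ) ^ 2 * k ^ 2 = ((p.η ^ 2 : ℝ) : ℂ) * k ^ 2 := by push_cast; ring
    rw [e, Complex.sub_im, Complex.ofReal_im, Complex.im_ofReal_mul, Complex.zero_im, zero_sub,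
      neg_eq_zero, mul_eq_zero] at this
    exact this.elim (by simp [p.η_ne]) h

variable (p)

/-- The element of `ker (A_max - z)` with `Γ₀ f = 1`, for non-real `z`. -/
def gammaField (z : ℂ) : PairSpace p.l := p.kerVec (Complex.sqrt z)

/-- The `M`-function, in closed form. -/
def mFunction (z : ℂ) : ℂ := p.mFun (Complex.sqrt z)

theorem admissible_sqrt {z : ℂ} (hz : z.im ≠ 0) : p.Admissible (Complex.sqrt z) :=
  admissible_of_im_ne (by rwa [complexSqrt_sq])

theorem gammaField_mem {z : ℂ} (hz : z.im ≠ 0) :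
    ∃ h : p.gammaField z ∈ p.maxOp.domain, p.maxOp ⟨p.gammaField z, h⟩ = z • p.gammaField z ∧
      p.Gamma0 (p.gammaField z) = 1 ∧ p.Gamma1 (p.gammaField z) = p.mFunction z := by
  have := (p.admissible_sqrt hz).kerVec_mem
  rwa [complexSqrt_sq] at this

/-- Green's identity on eigenvectors of the maximal operator. -/
theorem green_ker {f g : p.maxOp.domain} {z w : ℂ} (hf : p.maxOp f = z • (f : PairSpace p.l))
    (hg : p.maxOp g = w • (g : PairSpace p.l)) :
    (z - (starRingEnd ℂ) w) * inner ℂ (g : PairSpace p.l) (f : PairSpace p.l) =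
      p.Gamma1 f * (starRingEnd ℂ) (p.Gamma0 g) -
        p.Gamma0 f * (starRingEnd ℂ) (p.Gamma1 g) := by
  rw [← p.green, hf, hg, inner_smul_right, inner_smul_left]
  ring

theorem mFunction_conj {z : ℂ} (hz : z.im ≠ 0) :
    p.mFunction ((starRingEnd ℂ) z) = (starRingEnd ℂ) (p.mFunction z) := by
  obtain ⟨h, he, h0, h1⟩ := p.gammaField_mem hz
  obtain ⟨h', he', h0', h1'⟩ := p.gammaField_mem (z := (starRingEnd ℂ) z) (by simpa using hz)
  have := p.green_ker he' he
  rw [sub_self, zero_mul] at this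
  simp only [h0, h1, h0', h1', map_one, mul_one, one_mul] at this
  exact (sub_eq_zero.1 this.symm)

theorem Gamma1_eq_mFunction_mul {z : ℂ} (hz : z.im ≠ 0) {f : p.maxOp.domain}
    (hf : p.maxOp f = z • (f : PairSpace p.l)) :
    p.mFunction z * p.Gamma0 f = p.Gamma1 f := by
  obtain ⟨h', he', h0', h1'⟩ := p.gammaField_mem (z := (starRingEnd ℂ) z) (by simpa using hz)
  have := p.green_ker hf he'
  rw [Complex.conj_conj, sub_self, zero_mul] at this
  simp only [h0', h1', map_one, mul_one, p.mFunction_conj hz, Complex.conj_conj] at this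
  linear_combination this

theorem isMFunction_mFunction : IsMFunction p p.mFunction := by
  intro z hz
  obtain ⟨h, he, h0, h1⟩ := p.gammaField_mem hz
  exact ⟨⟨⟨_, h⟩, he, by simp [h0]⟩, fun f hf => p.Gamma1_eq_mFunction_mul hz hf⟩

variable {p} in
theorem _root_.StrausModel.IsMFunction.eq_mFunction {m : ℂ → ℂ} (hm : IsMFunction p m) {z : ℂ}
    (hz : z.im ≠ 0) : m z = p.mFunction z := by
  obtain ⟨h, he, h0, h1⟩ := p.gammaField_mem hz
  have := (hm z hz).2 ⟨_, h⟩ he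
  simpa [h0, h1] using this

/-- Green's identity at `z`: the reason why `m` is a Nevanlinna function. -/
theorem mFunction_im {z : ℂ} (hz : z.im ≠ 0) :
    (p.mFunction z).im = z.im * ‖p.gammaField z‖ ^ 2 := by
  obtain ⟨h, he, h0, h1⟩ := p.gammaField_mem hz
  have := p.green_ker he he
  simp only [h0, h1, map_one, mul_one, one_mul, inner_self_eq_norm_sq_to_K] at this
  have := congrArg Complex.im this
  simp only [Complex.sub_conj, Complex.coe_algebraMap, ← Complex.ofReal_pow,
    Complex.im_mul_ofReal] at this
  simp at this
  linarith

theorem mFunction_im_pos {z : ℂ} (hz : 0 < z.im) : 0 < (p.mFunction z).im := by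
  rw [p.mFunction_im hz.ne']
  have := norm_pos_iff.2 (p.admissible_sqrt hz.ne').kerVec_ne_zero
  exact mul_pos hz (pow_pos this 2)

theorem mFunction_ne_zero {z : ℂ} (hz : z.im ≠ 0) : p.mFunction z ≠ 0 := by
  intro h
  have h1 := p.mFunction_im hz
  rw [h, Complex.zero_im] at h1
  have := norm_pos_iff.2 (p.admissible_sqrt hz).kerVec_ne_zero
  exact mul_ne_zero hz (pow_pos this 2).ne' h1.symm

theorem mFunction_add_I_ne_zero {z : ℂ} (hz : 0 < z.im) : p.mFunction z + Complex.I ≠ 0 := by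
  intro h
  have h1 := p.mFunction_im_pos hz
  have := congrArg Complex.im h
  simp at this
  linarith

/-! ### Resolvents of the extensions -/

theorem inResolventSet_modelOp {z : ℂ} (hz : z.im ≠ 0) : InResolventSet p.modelOp z :=
  inResolventSet_of_isSymmetric_inverse p.isResolvent_invOp p.isSymmetric_invOp hz

theorem modelOp_resolventOp {z : ℂ} (hz : z.im ≠ 0) (f : PairSpace p.l) :
    ∃ h : resolventOp p.modelOp z f ∈ p.modelOp.domain,
      p.modelOp ⟨_, h⟩ = f + z • resolventOp p.modelOp z f := by
  obtain ⟨h, e⟩ := ((p.inResolventSet_modelOp hz).isResolvent _ f).1 rfl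
  exact ⟨h, sub_eq_iff_eq_add.1 e⟩

/-- Green's identity for `(A - z)⁻¹ f` and the deficiency vector at `\bar z`. -/
theorem Gamma0_resolventOp {z : ℂ} (hz : z.im ≠ 0) (f : PairSpace p.l) :
    p.Gamma0 (resolventOp p.modelOp z f) * p.mFunction z =
      -inner ℂ (p.gammaField ((starRingEnd ℂ) z)) f := by
  obtain ⟨h, e⟩ := p.modelOp_resolventOp hz f
  obtain ⟨hm, hG⟩ := p.mem_modelOp_iff.1 h
  obtain ⟨h', he', h0', h1'⟩ := p.gammaField_mem (z := (starRingEnd ℂ) z) (by simpa using hz)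
  have := p.green ⟨_, hm⟩ ⟨_, h'⟩
  rw [he'] at this
  have e2 : p.maxOp ⟨_, hm⟩ = f + z • resolventOp p.modelOp z f := e
  rw [e2] at this
  simp only [hG, h0', h1', inner_add_right, inner_smul_right, inner_smul_left, Complex.conj_conj,
    p.mFunction_conj hz] at this
  linear_combination this

theorem eq_zero_of_modelOp_eq_smul {z : ℂ} (hz : z.im ≠ 0) {f : PairSpace p.l}
    (h : f ∈ p.modelOp.domain) (e : p.modelOp ⟨f, h⟩ = z • f) : f = 0 := by
  have := ((p.inResolventSet_modelOp hz).isResolvent f 0).2 ⟨h, by rw [e, sub_self]⟩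
  rw [← this, map_zero]

theorem Gamma0_add {f g : PairSpace p.l} (hf : f ∈ p.maxOp.domain) (hg : g ∈ p.maxOp.domain) :
    p.Gamma0 (f + g) = p.Gamma0 f + p.Gamma0 g := p.bdryD_add hf.1 hg.1

theorem Gamma0_smul (c : ℂ) {f : PairSpace p.l} (hf : f ∈ p.maxOp.domain) :
    p.Gamma0 (c • f) = c * p.Gamma0 f := p.bdryD_smul c hf.1

theorem Gamma1_add {f g : PairSpace p.l} (hf : f ∈ p.maxOp.domain) (hg : g ∈ p.maxOp.domain) :
    p.Gamma1 (f + g) = p.Gamma1 f + p.Gamma1 g := by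
  rw [Gamma1, Gamma1, Gamma1, WithLp.add_fst, WithLp.add_snd,
    rep_add p.l_pos hf.1.1 hg.1.1 ⟨le_rfl, p.l_pos.le⟩]
  ring

theorem Gamma1_smul (c : ℂ) {f : PairSpace p.l} (hf : f ∈ p.maxOp.domain) :
    p.Gamma1 (c • f) = c * p.Gamma1 f := by
  rw [Gamma1, Gamma1, WithLp.smul_fst, WithLp.smul_snd,
    rep_smul p.l_pos c hf.1.1 ⟨le_rfl, p.l_pos.le⟩, smul_eq_mul]
  ring

/-- The resolvent of `A_{-i}`, by Krein's formula. -/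
def kreinOp (z : ℂ) : PairSpace p.l →L[ℂ] PairSpace p.l :=
  resolventOp p.modelOp z + (Complex.I / (p.mFunction z * (p.mFunction z + Complex.I))) •
    (innerSL ℂ (p.gammaField ((starRingEnd ℂ) z))).smulRight (p.gammaField z)

theorem kreinOp_apply (z : ℂ) (f : PairSpace p.l) : p.kreinOp z f = resolventOp p.modelOp z f +
    (Complex.I / (p.mFunction z * (p.mFunction z + Complex.I)) *
      inner ℂ (p.gammaField ((starRingEnd ℂ) z)) f) • p.gammaField z := by
  simp [kreinOp, smul_smul]

theorem kreinOp_spec {z : ℂ} (hz : 0 < z.im) (f : PairSpace p.l) :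
    ∃ h : p.kreinOp z f ∈ p.maxOp.domain, p.maxOp ⟨_, h⟩ = f + z • p.kreinOp z f ∧
      p.Gamma0 (p.kreinOp z f) =
        -inner ℂ (p.gammaField ((starRingEnd ℂ) z)) f / (p.mFunction z + Complex.I) ∧
      p.Gamma1 (p.kreinOp z f) = -Complex.I * p.Gamma0 (p.kreinOp z f) := by
  obtain ⟨hr, er⟩ := p.modelOp_resolventOp hz.ne' f
  obtain ⟨hm, hG⟩ := p.mem_modelOp_iff.1 hr
  have er' : p.maxOp ⟨_, hm⟩ = f + z • resolventOp p.modelOp z f := er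
  obtain ⟨h', he', h0', h1'⟩ := p.gammaField_mem hz.ne'
  have h0 := p.mFunction_ne_zero hz.ne'
  have hI := p.mFunction_add_I_ne_zero hz
  set c := Complex.I / (p.mFunction z * (p.mFunction z + Complex.I)) *
      inner ℂ (p.gammaField ((starRingEnd ℂ) z)) f with hc
  have hgc := p.maxOp.domain.smul_mem c h'
  have hG0 : p.Gamma0 (p.kreinOp z f) =
        -inner ℂ (p.gammaField ((starRingEnd ℂ) z)) f / (p.mFunction z + Complex.I) := by
    rw [kreinOp_apply, ← hc, p.Gamma0_add hm hgc, p.Gamma0_smul c h', h0',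
      eq_div_of_mul_eq h0 (p.Gamma0_resolventOp hz.ne' f), hc]
    field_simp
    ring
  have key : p.maxOp (⟨_, hm⟩ + c • ⟨_, h'⟩) = p.maxOp ⟨_, hm⟩ + c • p.maxOp ⟨_, h'⟩ := by
    rw [LinearPMap.map_add, LinearPMap.map_smul]
  rw [er', he'] at key
  refine ⟨by rw [kreinOp_apply]; exact p.maxOp.domain.add_mem hm hgc, ?_, hG0, ?_⟩
  · simp only [kreinOp_apply, ← hc]
    refine key.trans ?_
    rw [smul_add, smul_comm c z, add_assoc]
  · rw [hG0, kreinOp_apply, ← hc, p.Gamma1_add hm hgc, p.Gamma1_smul c h', h1', hG, hc]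
    field_simp
    ring

theorem isResolvent_kreinOp {z : ℂ} (hz : 0 < z.im) :
    IsResolvent (p.extOp (-Complex.I)) z (p.kreinOp z) := by
  intro f h
  obtain ⟨hm, he, -, hG⟩ := p.kreinOp_spec hz h
  constructor
  · rintro rfl
    refine ⟨⟨hm, hG⟩, ?_⟩
    rw [extOp_apply]
    simp only [he]
    abel
  · rintro ⟨⟨hf, hfG⟩, e⟩
    have e' : p.maxOp ⟨f, hf⟩ = h + z • f := sub_eq_iff_eq_add.1 e
    have hd := p.maxOp.domain.sub_mem hm hf
    have ed : p.maxOp ⟨p.kreinOp z h - f, hd⟩ = z • (p.kreinOp z h - f) := by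
      have : p.maxOp (⟨_, hm⟩ - ⟨_, hf⟩) = p.maxOp ⟨_, hm⟩ - p.maxOp ⟨_, hf⟩ :=
        LinearPMap.map_sub _ _ _
      rw [he, e'] at this
      refine this.trans ?_
      rw [smul_sub]; abel
    have eG : p.Gamma1 (p.kreinOp z h - f) = -Complex.I * p.Gamma0 (p.kreinOp z h - f) :=
      ((p.extOp (-Complex.I)).domain.sub_mem (x := p.kreinOp z h) (y := f) ⟨hm, hG⟩ ⟨hf, hfG⟩).2
    have e1 := p.Gamma1_eq_mFunction_mul hz.ne' ed
    have e2 : p.Gamma0 (p.kreinOp z h - f) = 0 := by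
      refine (mul_eq_zero.1 ?_).resolve_left (p.mFunction_add_I_ne_zero hz)
      simp only at e1
      linear_combination e1 + eG
    rw [e2, mul_zero] at eG
    exact sub_eq_zero.1 (p.eq_zero_of_modelOp_eq_smul hz.ne'
      (p.mem_modelOp_iff.2 ⟨hd, eG⟩) ed)

/-- The model function in terms of the deficiency vectors. Both factors extend continuously to the
eigenvalues of `A`, which gives the boundary values of `g_+`. -/
theorem gPlus_eq {z : ℂ} (hz : 0 < z.im) (f : PairSpace p.l) :
    p.gPlus f z = 1 / (√Real.pi : ℂ) *
      (inner ℂ (p.gammaField ((starRingEnd ℂ) z)) f / (p.mFunction z + Complex.I)) := by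
  rw [gPlus, (p.isResolvent_kreinOp hz).resolventOp_eq, (p.kreinOp_spec hz f).choose_spec.2.1]
  ring

end ModelParams

/-! ### Measures in the Nevanlinna representation -/

theorem measurable_nevKernel (z : ℂ) : Measurable (nevKernel z) := by
  unfold nevKernel
  fun_prop

theorem one_add_sq_ne_zero (σ : ℝ) : (1 : ℂ) + (σ : ℂ) ^ 2 ≠ 0 := by
  have : (0 : ℝ) < 1 + σ ^ 2 := by positivity
  exact_mod_cast this.ne'

theorem sub_ne_zero_of_im_ne {z : ℂ} (hz : z.im ≠ 0) (σ : ℝ) : (σ : ℂ) - z ≠ 0 := by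
  intro h
  have := congrArg Complex.im h
  simp at this
  exact hz this

theorem norm_one_add_sq (σ : ℝ) : ‖(1 : ℂ) + (σ : ℂ) ^ 2‖ = 1 + σ ^ 2 := by
  rw [show (1 : ℂ) + (σ : ℂ) ^ 2 = ((1 + σ ^ 2 : ℝ) : ℂ) by push_cast; ring, Complex.norm_real,
    Real.norm_of_nonneg (by positivity)]

theorem abs_im_le_norm_sub (z : ℂ) (σ : ℝ) : |z.im| ≤ ‖(σ : ℂ) - z‖ := by
  have := Complex.abs_im_le_norm ((σ : ℂ) - z)
  simpa using this

/-- The kernel of the Nevanlinna representation is `O(1 / (1 + σ²))`. -/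
theorem norm_nevKernel_le {z : ℂ} (hz : z.im ≠ 0) (σ : ℝ) :
    |z.im| * ‖nevKernel z σ‖ ≤ (‖1 + z ^ 2‖ + |z.im| * ‖z‖) * (1 / (1 + σ ^ 2)) := by
  have h1 := sub_ne_zero_of_im_ne hz σ
  have h2 := one_add_sq_ne_zero σ
  have e : nevKernel z σ = ((1 + z ^ 2) / (σ - z) + z) / (1 + (σ : ℂ) ^ 2) := by
    rw [nevKernel]; field_simp; ring
  rw [e, norm_div, norm_one_add_sq, mul_div_assoc', mul_one_div]
  gcongr
  have h3 := norm_pos_iff.2 h1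
  calc |z.im| * ‖(1 + z ^ 2) / (σ - z) + z‖
      ≤ |z.im| * (‖1 + z ^ 2‖ / ‖(σ : ℂ) - z‖ + ‖z‖) := by
        gcongr
        exact (norm_add_le _ _).trans (by rw [norm_div])
    _ = ‖1 + z ^ 2‖ * (|z.im| / ‖(σ : ℂ) - z‖) + |z.im| * ‖z‖ := by ring
    _ ≤ ‖1 + z ^ 2‖ * 1 + |z.im| * ‖z‖ := by
        gcongr
        exact div_le_one_of_le₀ (abs_im_le_norm_sub z σ) h3.le
    _ = _ := by ring

section

variable {F : ℂ → ℂ} {μ ν : Measure ℝ}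

theorem IsNevanlinnaMeasure.integrable (h : IsNevanlinnaMeasure F μ) :
    Integrable (fun σ : ℝ => 1 / (1 + σ ^ 2)) μ := by
  refine ⟨(by fun_prop : Measurable fun σ : ℝ => 1 / (1 + σ ^ 2)).aestronglyMeasurable, ?_⟩
  rw [HasFiniteIntegral]
  refine lt_of_eq_of_lt (lintegral_congr fun σ => ?_) h.1
  rw [Real.enorm_of_nonneg (by positivity)]

theorem IsNevanlinnaMeasure.integrable_nevKernel (h : IsNevanlinnaMeasure F μ) {z : ℂ}
    (hz : z.im ≠ 0) : Integrable (nevKernel z) μ := by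
  have hz' := abs_pos.2 hz
  refine Integrable.mono' (h.integrable.const_mul ((‖1 + z ^ 2‖ + |z.im| * ‖z‖) / |z.im|))
    (measurable_nevKernel z).aestronglyMeasurable (Eventually.of_forall fun σ => ?_)
  rw [div_mul_eq_mul_div, le_div_iff₀ hz', mul_comm]
  exact norm_nevKernel_le hz σ

theorem IsNevanlinnaMeasure.measure_singleton_lt_top (h : IsNevanlinnaMeasure F μ) (t : ℝ) :
    μ {t} < ⊤ := by
  have h1 := h.integrable.integrableOn (s := {t})
  have h2 : IntegrableOn (fun _ => 1 / (1 + t ^ 2)) {t} μ :=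
    h1.congr_fun (fun x hx => by rw [mem_singleton_iff.1 hx]) (measurableSet_singleton t)
  rw [integrableOn_const_iff] at h2
  rcases h2 with h2 | h2
  · exact absurd h2 (by have : (1 : ℝ) + t ^ 2 ≠ 0 := by positivity
                        simp [this])
  · exact h2

/-- A point mass of `μ` is recovered from the vertical limit of `F`. -/
theorem IsNevanlinnaMeasure.tendsto_singleton (h : IsNevanlinnaMeasure F μ) (t : ℝ) :
    Tendsto (fun y : ℝ => -(Complex.I * y) * F (t + Complex.I * y)) (𝓝[>] 0)
      (𝓝 ((μ {t}).toReal : ℂ)) := by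
  obtain ⟨-, a, b, -, hF⟩ := id h
  have him : ∀ y : ℝ, (t + Complex.I * y : ℂ).im = y := fun y => by simp
  have hint : Tendsto (fun y : ℝ => ∫ σ, -(Complex.I * y) * nevKernel (t + Complex.I * y) σ ∂μ)
      (𝓝[>] 0) (𝓝 (∫ σ, ({t} : Set ℝ).indicator (fun _ => (1 : ℂ)) σ ∂μ)) := by
    -- the bound for the kernel is uniform in `0 < y < 1`
    have hcont : Continuous fun y : ℝ =>
        ‖1 + (t + Complex.I * y : ℂ) ^ 2‖ + |y| * ‖(t + Complex.I * y : ℂ)‖ := by fun_prop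
    obtain ⟨C, hC⟩ := (isCompact_Icc (a := (0 : ℝ)) (b := 1)).exists_bound_of_continuousOn
      hcont.continuousOn
    refine tendsto_integral_filter_of_dominated_convergence (fun σ => C * (1 / (1 + σ ^ 2)))
      (Eventually.of_forall fun y => ((measurable_nevKernel _).const_mul _).aestronglyMeasurable)
      ?_ (h.integrable.const_mul C) (Eventually.of_forall fun σ => ?_)
    · filter_upwards [Ioo_mem_nhdsGT (zero_lt_one' ℝ)] with y hy
      refine Eventually.of_forall fun σ => ?_
      have h1 := norm_nevKernel_le (z := t + Complex.I * y) (by rw [him]; exact hy.1.ne') σ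
      rw [him] at h1
      rw [norm_mul, norm_neg, norm_mul, Complex.norm_I, one_mul, Complex.norm_real,
        Real.norm_eq_abs]
      refine h1.trans ?_
      gcongr
      exact (le_abs_self _).trans (hC y ⟨hy.1.le, hy.2.le⟩)
    · by_cases hσ : σ = t
      · subst hσ
        rw [indicator_of_mem (mem_singleton σ)]
        have e : ∀ y : ℝ, y ≠ 0 → -(Complex.I * y) * nevKernel (σ + Complex.I * y) σ =
            1 + Complex.I * y * (σ / (1 + (σ : ℂ) ^ 2)) := by
          intro y hy
          have hy' : (y : ℂ) ≠ 0 := by exact_mod_cast hy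
          have h2 := one_add_sq_ne_zero σ
          have hI := Complex.I_ne_zero
          rw [nevKernel, show (σ : ℂ) - (σ + Complex.I * y) = -(Complex.I * y) by ring]
          field_simp
          ring
        have hc : Tendsto (fun y : ℝ => 1 + Complex.I * y * (σ / (1 + (σ : ℂ) ^ 2))) (𝓝[>] 0)
            (𝓝 (1 + Complex.I * (0 : ℝ) * (σ / (1 + (σ : ℂ) ^ 2)))) :=
          (Continuous.tendsto (by fun_prop) 0).mono_left nhdsWithin_le_nhds
        rw [Complex.ofReal_zero, mul_zero, zero_mul, add_zero] at hc
        refine hc.congr' ?_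
        filter_upwards [self_mem_nhdsWithin] with y hy
        exact (e y (ne_of_gt hy)).symm
      · rw [indicator_of_notMem (by simpa using hσ)]
        have hne : (σ : ℂ) - t ≠ 0 := by exact_mod_cast sub_ne_zero.2 hσ
        have hc : ContinuousAt (fun y : ℝ => -(Complex.I * y) * nevKernel (t + Complex.I * y) σ)
            0 := by
          unfold nevKernel
          refine ContinuousAt.mul (by fun_prop) (ContinuousAt.sub (ContinuousAt.div
            (by fun_prop) (by fun_prop) (by simpa using hne)) (by fun_prop))
        have := hc.tendsto.mono_left (nhdsWithin_le_nhds (s := Ioi 0))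
        simpa using this
  rw [integral_indicator_const _ (measurableSet_singleton t)] at hint
  have hlin : Tendsto (fun y : ℝ => -(Complex.I * y) * (a + b * (t + Complex.I * y))) (𝓝[>] 0)
      (𝓝 (-(Complex.I * (0 : ℝ)) * (a + b * (t + Complex.I * (0 : ℝ))))) :=
    (Continuous.tendsto (by fun_prop) 0).mono_left nhdsWithin_le_nhds
  have hsum := hlin.add hint
  rw [Complex.ofReal_zero, mul_zero, neg_zero, zero_mul, zero_add] at hsum
  have e : μ.real {t} • (1 : ℂ) = ((μ {t}).toReal : ℂ) := by
    rw [Measure.real, Complex.real_smul, mul_one]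
  rw [e] at hsum
  refine hsum.congr' ?_
  filter_upwards [self_mem_nhdsWithin] with y hy
  rw [hF _ (by rw [him]; exact hy), integral_const_mul]
  ring

theorem nevKernel_im {z : ℂ} (σ : ℝ) :
    (nevKernel z σ).im = z.im / ((σ - z.re) ^ 2 + z.im ^ 2) := by
  have e : (σ : ℂ) / (1 + (σ : ℂ) ^ 2) = ((σ / (1 + σ ^ 2) : ℝ) : ℂ) := by push_cast; ring
  rw [nevKernel, Complex.sub_im, e, Complex.ofReal_im, one_div, Complex.inv_im,
    Complex.normSq_apply]
  simp
  ring

theorem IsNevanlinnaMeasure.im_eq (h : IsNevanlinnaMeasure F μ) : ∃ b : ℝ, 0 ≤ b ∧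
    ∀ z : ℂ, 0 < z.im → (F z).im = b * z.im + ∫ σ, z.im / ((σ - z.re) ^ 2 + z.im ^ 2) ∂μ := by
  obtain ⟨-, a, b, hb, hF⟩ := id h
  refine ⟨b, hb, fun z hz => ?_⟩
  have hi := h.integrable_nevKernel hz.ne'
  have : (∫ σ, nevKernel z σ ∂μ).im = ∫ σ, (nevKernel z σ).im ∂μ :=
    (Complex.imCLM.integral_comp_comm hi).symm
  rw [hF z hz, Complex.add_im, this, Complex.add_im, Complex.ofReal_im, Complex.im_ofReal_mul,
    zero_add]
  simp only [nevKernel_im]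

theorem IsNevanlinnaMeasure.integrable_poisson (h : IsNevanlinnaMeasure F μ) {z : ℂ}
    (hz : 0 < z.im) : Integrable (fun σ : ℝ => z.im / ((σ - z.re) ^ 2 + z.im ^ 2)) μ := by
  have := (h.integrable_nevKernel hz.ne').im
  refine this.congr (Eventually.of_forall fun σ => ?_)
  exact nevKernel_im σ

/-- If `μ` has no mass near `t`, then `Im F (x + iy) = O(y)` uniformly for `x` near `t`. -/
theorem IsNevanlinnaMeasure.im_le_of_null (h : IsNevanlinnaMeasure F μ) {t δ : ℝ} (hδ : 0 < δ)
    (hn : ∀ᵐ σ ∂μ, 2 * δ ≤ |σ - t|) :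
    ∃ M : ℝ, ∀ z : ℂ, 0 < z.im → |z.re - t| ≤ δ → (F z).im ≤ M * z.im := by
  obtain ⟨b, -, hF⟩ := h.im_eq
  set K : ℝ := 4 * ((1 + 2 * t ^ 2) / (4 * δ ^ 2) + 2) with hK
  have hK0 : 0 < K := by positivity
  refine ⟨b + K * ∫ σ, 1 / (1 + σ ^ 2) ∂μ, fun z hz hzt => ?_⟩
  rw [hF z hz, add_mul, mul_assoc, mul_comm (∫ σ, 1 / (1 + σ ^ 2) ∂μ), ← mul_assoc,
    ← integral_const_mul]
  refine add_le_add le_rfl (integral_mono_ae (h.integrable_poisson hz) (h.integrable.const_mul _) ?_)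
  filter_upwards [hn] with σ hσ
  have h1 : |σ - t| / 2 ≤ |σ - z.re| := by
    have := abs_sub_abs_le_abs_sub (σ - t) (z.re - t)
    rw [show σ - t - (z.re - t) = σ - z.re by ring] at this
    linarith
  have h2 : (σ - t) ^ 2 / 4 ≤ (σ - z.re) ^ 2 := by
    have := pow_le_pow_left₀ (by positivity) h1 2
    rw [div_pow, sq_abs, sq_abs] at this
    linarith
  have h3 : 4 * δ ^ 2 ≤ (σ - t) ^ 2 := by
    have := pow_le_pow_left₀ (by positivity) hσ 2
    rw [sq_abs] at this
    linarith
  have h4 : 1 + σ ^ 2 ≤ K / 4 * (σ - t) ^ 2 := by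
    have h5 : 1 + 2 * t ^ 2 ≤ (1 + 2 * t ^ 2) / (4 * δ ^ 2) * (σ - t) ^ 2 := by
      rw [div_mul_eq_mul_div, le_div_iff₀ (by positivity)]
      gcongr
    have h6 : σ ^ 2 ≤ 2 * (σ - t) ^ 2 + 2 * t ^ 2 := by nlinarith [sq_nonneg (σ - 2 * t)]
    rw [hK]
    linarith
  rw [mul_one_div, div_le_div_iff₀ (by positivity) (by positivity)]
  have h7 : 1 + σ ^ 2 ≤ K * ((σ - z.re) ^ 2 + z.im ^ 2) := by nlinarith [sq_nonneg z.im]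
  calc z.im * (1 + σ ^ 2) ≤ z.im * (K * ((σ - z.re) ^ 2 + z.im ^ 2)) := by gcongr
    _ = _ := by ring

/-- The mass of a short interval is controlled by the Poisson integral. -/
theorem IsNevanlinnaMeasure.measure_Icc_le (h : IsNevanlinnaMeasure F μ) {x y : ℝ} (hy : 0 < y) :
    μ (Icc (x - y) (x + y)) ≤ ENNReal.ofReal (2 * y * (F (x + Complex.I * y)).im) := by
  obtain ⟨b, hb, hF⟩ := h.im_eq
  have hre : (x + Complex.I * y : ℂ).re = x := by simp
  have him : (x + Complex.I * y : ℂ).im = y := by simp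
  have hi := h.integrable_poisson (z := x + Complex.I * y) (by rw [him]; exact hy)
  rw [hF _ (by rw [him]; exact hy)]
  rw [hre, him] at *
  have h0 : ∀ σ : ℝ, 0 ≤ y / ((σ - x) ^ 2 + y ^ 2) := fun σ => by positivity
  have h1 : ENNReal.ofReal (1 / (2 * y)) * μ (Icc (x - y) (x + y)) ≤
      ENNReal.ofReal (∫ σ, y / ((σ - x) ^ 2 + y ^ 2) ∂μ) := by
    rw [ofReal_integral_eq_lintegral_ofReal hi (Eventually.of_forall h0), ← setLIntegral_const]
    refine (setLIntegral_mono' measurableSet_Icc fun σ hσ => ?_).trans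
      (setLIntegral_le_lintegral _ _)
    apply ENNReal.ofReal_le_ofReal
    rw [div_le_div_iff₀ (by positivity) (by positivity)]
    have : (σ - x) ^ 2 ≤ y ^ 2 := sq_le_sq' (by linarith [hσ.1]) (by linarith [hσ.2])
    nlinarith
  calc μ (Icc (x - y) (x + y))
      = ENNReal.ofReal (2 * y) * (ENNReal.ofReal (1 / (2 * y)) * μ (Icc (x - y) (x + y))) := by
        rw [← mul_assoc, ← ENNReal.ofReal_mul (by positivity), mul_one_div_cancel (by positivity),
          ENNReal.ofReal_one, one_mul]
    _ ≤ ENNReal.ofReal (2 * y) * ENNReal.ofReal (∫ σ, y / ((σ - x) ^ 2 + y ^ 2) ∂μ) := by gcongr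
    _ = ENNReal.ofReal (2 * y * ∫ σ, y / ((σ - x) ^ 2 + y ^ 2) ∂μ) :=
        (ENNReal.ofReal_mul (by positivity)).symm
    _ ≤ _ := by
        apply ENNReal.ofReal_le_ofReal
        gcongr
        have : 0 ≤ b * y := by positivity
        linarith

/-- A Nevanlinna measure vanishes on an interval near which `Im F (x + iy) = O(y)`. -/
theorem IsNevanlinnaMeasure.measure_Ico_eq_zero (h : IsNevanlinnaMeasure F μ) {t δ M : ℝ}
    (hδ : 0 < δ)
    (hM : ∀ z : ℂ, 0 < z.im → |z.re - t| ≤ δ → (F z).im ≤ M * z.im) :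
    μ (Ico (t - δ) (t + δ)) = 0 := by
  have key : ∀ n : ℕ, μ (Ico (t - δ) (t + δ)) ≤ ENNReal.ofReal (2 * M * δ ^ 2 / (n + 1 : ℕ)) := by
    intro n
    set y : ℝ := δ / (n + 1 : ℕ) with hy
    have hn : (0 : ℝ) < (n + 1 : ℕ) := by positivity
    have hy0 : 0 < y := by positivity
    have hny : (n + 1 : ℕ) * y = δ := by rw [hy]; field_simp
    -- the centres of the intervals of half-length `y` that cover the given one
    let x : ℕ → ℝ := fun i => t - δ + (2 * i + 1) * y
    have hcov : Ico (t - δ) (t + δ) ⊆ ⋃ i ∈ Finset.range (n + 1), Icc (x i - y) (x i + y) := by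
      intro σ hσ
      have hq : 0 ≤ (σ - (t - δ)) / (2 * y) := div_nonneg (by linarith [hσ.1]) (by positivity)
      have hlt : ⌊(σ - (t - δ)) / (2 * y)⌋₊ < n + 1 := by
        rw [Nat.floor_lt hq, div_lt_iff₀ (by positivity)]
        have := hσ.2
        nlinarith
      have h1 := Nat.floor_le hq
      have h2 := Nat.lt_floor_add_one ((σ - (t - δ)) / (2 * y))
      rw [le_div_iff₀ (by positivity)] at h1
      rw [div_lt_iff₀ (by positivity)] at h2
      refine mem_iUnion₂.2 ⟨_, Finset.mem_range.2 hlt, ?_, ?_⟩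
      · simp only [x]; linarith
      · simp only [x]; linarith
    have hterm : ∀ i ∈ Finset.range (n + 1),
        μ (Icc (x i - y) (x i + y)) ≤ ENNReal.ofReal (2 * M * y ^ 2) := by
      intro i hi
      refine (h.measure_Icc_le hy0).trans (ENNReal.ofReal_le_ofReal ?_)
      have hi' : (i : ℝ) + 1 ≤ (n + 1 : ℕ) := by exact_mod_cast Finset.mem_range.1 hi
      have hb := hM (x i + Complex.I * y) (by simpa using hy0) (by
        have e : ((x i : ℂ) + Complex.I * y).re = x i := by simp
        rw [e, abs_le]
        simp only [x]
        constructor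
        · have : 0 ≤ (2 * (i : ℝ) + 1) * y := by positivity
          linarith
        · have : (2 * (i : ℝ) + 1) * y ≤ 2 * ((n + 1 : ℕ) * y) := by
            rw [← mul_assoc]; gcongr; linarith
          linarith)
      have e : ((x i : ℂ) + Complex.I * y).im = y := by simp
      rw [e] at hb
      nlinarith
    calc μ (Ico (t - δ) (t + δ))
        ≤ μ (⋃ i ∈ Finset.range (n + 1), Icc (x i - y) (x i + y)) := measure_mono hcov
      _ ≤ ∑ i ∈ Finset.range (n + 1), μ (Icc (x i - y) (x i + y)) :=
          measure_biUnion_finset_le _ _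
      _ ≤ ∑ _i ∈ Finset.range (n + 1), ENNReal.ofReal (2 * M * y ^ 2) := Finset.sum_le_sum hterm
      _ = ENNReal.ofReal (2 * M * δ ^ 2 / (n + 1 : ℕ)) := by
          rw [Finset.sum_const, Finset.card_range, nsmul_eq_mul, ← ENNReal.ofReal_natCast,
            ← ENNReal.ofReal_mul (by positivity)]
          congr 1
          rw [hy]
          field_simp
  have hlim : Tendsto (fun n : ℕ => ENNReal.ofReal (2 * M * δ ^ 2 / (n + 1 : ℕ))) atTop (𝓝 0) := by
    rw [← ENNReal.ofReal_zero]
    exact ENNReal.tendsto_ofReal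
      ((tendsto_const_div_atTop_nhds_zero_nat (2 * M * δ ^ 2)).comp (tendsto_add_atTop_nat 1))
  exact le_antisymm (ge_of_tendsto' hlim key) bot_le

theorem IsNevanlinnaMeasure.congr {G : ℂ → ℂ} (h : IsNevanlinnaMeasure F μ)
    (e : ∀ z : ℂ, 0 < z.im → F z = G z) : IsNevanlinnaMeasure G μ := by
  obtain ⟨h1, a, b, hb, hF⟩ := h
  exact ⟨h1, a, b, hb, fun z hz => by rw [← e z hz, hF z hz]⟩

/-- A measure carried by the range of an injective sequence is the sum of its atoms. -/
theorem eq_sum_dirac_of_ae_mem_range {lam : ℕ → ℝ} (hinj : Function.Injective lam)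
    (h : ∀ᵐ x ∂μ, x ∈ range lam) :
    μ = Measure.sum fun j => μ {lam j} • Measure.dirac (lam j) := by
  ext s hs
  rw [Measure.sum_apply _ hs]
  have h1 : μ s = μ (⋃ j, s ∩ {lam j}) := by
    refine measure_congr ?_
    filter_upwards [h] with x hx
    obtain ⟨j, rfl⟩ := hx
    refine propext ⟨fun hm => mem_iUnion.2 ⟨j, hm, rfl⟩, fun hm => ?_⟩
    obtain ⟨i, hi⟩ := mem_iUnion.1 hm
    exact hi.1
  rw [h1, measure_iUnion _ fun j => hs.inter (measurableSet_singleton _)]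
  · refine tsum_congr fun j => ?_
    rw [Measure.smul_apply, Measure.dirac_apply' _ hs, smul_eq_mul]
    by_cases hj : lam j ∈ s
    · rw [indicator_of_mem hj, inter_eq_right.2 (singleton_subset_iff.2 hj)]
      simp
    · rw [indicator_of_notMem hj, inter_singleton_eq_empty.2 hj]
      simp
  · intro i j hij
    refine disjoint_left.2 fun x hx hx' => hij (hinj ?_)
    rw [← mem_singleton_iff.1 hx.2, mem_singleton_iff.1 hx'.2]

/-- Uniqueness of the measure in the Nevanlinna representation, when one representing measure is
carried by a closed discrete set. -/
theorem IsNevanlinnaMeasure.unique {lam : ℕ → ℝ} (hinj : Function.Injective lam)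
    (hcl : IsClosed (range lam)) (hμ : IsNevanlinnaMeasure F μ) (hν : IsNevanlinnaMeasure F ν)
    (h : ∀ᵐ x ∂μ, x ∈ range lam) : ν = μ := by
  have hν0 : ν (range lam)ᶜ = 0 := by
    refine measure_null_of_locally_null _ fun t ht => ?_
    obtain ⟨ε, hε, hball⟩ := Metric.isOpen_iff.1 hcl.isOpen_compl t ht
    have hδ : 0 < ε / 2 := by positivity
    obtain ⟨M, hM⟩ := hμ.im_le_of_null (t := t) hδ (by
      filter_upwards [h] with σ hσ
      by_contra! hc
      exact hball (by rw [Metric.mem_ball, Real.dist_eq]; linarith) hσ)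
    refine ⟨Ico (t - ε / 2) (t + ε / 2), mem_nhdsWithin_of_mem_nhds
      (Ico_mem_nhds (by linarith) (by linarith)), hν.measure_Ico_eq_zero hδ hM⟩
  have hν' : ∀ᵐ x ∂ν, x ∈ range lam := hν0
  rw [eq_sum_dirac_of_ae_mem_range hinj h, eq_sum_dirac_of_ae_mem_range hinj hν']
  congr 1
  funext j
  congr 1
  have := tendsto_nhds_unique (hμ.tendsto_singleton (lam j)) (hν.tendsto_singleton (lam j))
  have := Complex.ofReal_injective this
  exact ((ENNReal.toReal_eq_toReal_iff' (hμ.measure_singleton_lt_top _).ne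
    (hν.measure_singleton_lt_top _).ne).1 this).symm

end

theorem nevKernel_eq_div_sub {z : ℂ} (hz : z.im ≠ 0) (x : ℝ) :
    nevKernel z x = (z + Complex.I) / ((x - z) * (x + Complex.I)) -
      Complex.I * (1 / (1 + (x : ℂ) ^ 2)) := by
  have h1 := sub_ne_zero_of_im_ne hz x
  have h2 := one_add_sq_ne_zero x
  have h3 : (x : ℂ) + Complex.I ≠ 0 := by
    have := sub_ne_zero_of_im_ne (z := -Complex.I) (by simp) x
    simpa using this
  have hI := Complex.I_sq
  rw [nevKernel]
  field_simp
  have e : (1 : ℂ) + (x : ℂ) ^ 2 = (x + Complex.I) * (x - Complex.I) := by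
    linear_combination hI
  rw [e]
  ring_nf

namespace ModelParams

variable (p : ModelParams)

/-! ### Eigenvectors of the model operator -/

/-- Eigenvalues of the model operator are positive. -/
theorem eigenvalue_pos {f : PairSpace p.l} (h : f ∈ p.modelOp.domain) (hf : f ≠ 0) {c : ℂ}
    (e : p.modelOp ⟨f, h⟩ = c • f) : ∃ x : ℝ, 0 < x ∧ c = x := by
  have h1 := p.inner_modelOp_self ⟨f, h⟩
  set q : ℝ := ‖dTau p.τ f.fst‖ ^ 2 + p.γ / p.η ^ 2 * ‖f.snd‖ ^ 2 with hq
  have h2 : inner ℂ f (p.modelOp ⟨f, h⟩) = (q : ℂ) := h1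
  have hγ := p.γ_pos
  have hq0 : q ≠ 0 := by
    intro h0
    rw [h0, Complex.ofReal_zero] at h2
    exact hf (p.modelOp_eq_zero_of_inner_eq_zero ⟨f, h⟩ h2)
  have hq1 : 0 < q := lt_of_le_of_ne (by positivity) hq0.symm
  have hn : 0 < ‖f‖ ^ 2 := pow_pos (norm_pos_iff.2 hf) 2
  refine ⟨q / ‖f‖ ^ 2, div_pos hq1 hn, ?_⟩
  rw [e, inner_smul_right, inner_self_eq_norm_sq_to_K] at h2
  have hn' : ((‖f‖ : ℂ)) ^ 2 ≠ 0 := by exact_mod_cast hn.ne'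
  push_cast
  rw [eq_div_iff hn']
  exact h2

/-- The boundary data of an element of `ker (A_max - k²)` in terms of its Cauchy data at `0`. -/
theorem boundary_of_maxOp_eq {k : ℂ} {f : PairSpace p.l} (h : f ∈ p.maxOp.domain)
    (e : p.maxOp ⟨f, h⟩ = k ^ 2 • f) :
    k * rep f.fst 0 = p.theta * (k * rep f.fst 0 * Complex.cos (k * p.l) +
        rep (dTau p.τ f.fst) 0 * Complex.sin (k * p.l)) ∧
      p.Gamma0 f = rep (dTau p.τ f.fst) 0 - p.theta * (rep (dTau p.τ f.fst) 0 *
        Complex.cos (k * p.l) - k * rep f.fst 0 * Complex.sin (k * p.l)) ∧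
      p.η * p.Gamma0 f = (p.γ - p.η ^ 2 * k ^ 2) * f.snd ∧
      dTau p.τ (dTau p.τ f.fst) = -(k ^ 2) • f.fst := by
  have hl := p.l_pos
  have hη : (p.η : ℂ) ≠ 0 := by exact_mod_cast p.η_ne
  have e1 : -(dTau p.τ (dTau p.τ f.fst)) = k ^ 2 • f.fst := congrArg WithLp.fst e
  have e2 : -((p.η : ℂ)⁻¹ * p.Gamma0 f) + p.γ * ((p.η : ℂ) ^ 2)⁻¹ * f.snd = k ^ 2 * f.snd :=
    congrArg WithLp.snd e
  have e1' : dTau p.τ (dTau p.τ f.fst) = -(k ^ 2) • f.fst := by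
    rw [neg_smul, ← e1, neg_neg]
  obtain ⟨r1, r2⟩ := rep_eq_of_dTau_dTau hl p.τ h.1 e1' (x := p.l) ⟨hl.le, le_rfl⟩
  have hω := p.ω_eq
  refine ⟨?_, ?_, ?_, e1'⟩
  · have := h.2
    rw [← r1]
    rw [hω] at this
    linear_combination k * this
  · rw [← r2, Gamma0, bdryD, hω]
    ring
  · field_simp at e2
    linear_combination -e2

theorem eq_zero_of_cauchy_eq_zero {k : ℂ} (hk : k ≠ 0) {f : PairSpace p.l}
    (h : f ∈ p.modelOp.domain) (e : p.modelOp ⟨f, h⟩ = k ^ 2 • f) (h0 : rep f.fst 0 = 0)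
    (h1 : rep (dTau p.τ f.fst) 0 = 0) : f = 0 := by
  obtain ⟨hm, hG⟩ := p.mem_modelOp_iff.1 h
  obtain ⟨-, -, -, e4⟩ := p.boundary_of_maxOp_eq hm e
  have hη : (p.η : ℂ) ≠ 0 := by exact_mod_cast p.η_ne
  have hs : f.snd = 0 := by
    rw [Gamma1, h0, sub_zero, div_eq_zero_iff] at hG
    exact hG.resolve_right hη
  exact WithLp.ofLp_injective 2 (Prod.ext (eq_zero_of_dTau_dTau p.l_pos p.τ hk hm.1 e4 h0 h1) hs)

/-- The square roots of the eigenvalues are zeros of `disp`. -/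
theorem disp_eq_zero_of_eigen {k : ℂ} (hk : k ≠ 0) {f : PairSpace p.l} (hf : f ≠ 0)
    (h : f ∈ p.modelOp.domain) (e : p.modelOp ⟨f, h⟩ = k ^ 2 • f) : p.disp k = 0 := by
  obtain ⟨hm, hG⟩ := p.mem_modelOp_iff.1 h
  obtain ⟨e1, e2, e3, -⟩ := p.boundary_of_maxOp_eq hm e
  have hη : (p.η : ℂ) ≠ 0 := by exact_mod_cast p.η_ne
  have hs : f.snd = p.η * rep f.fst 0 := by
    rw [Gamma1, sub_eq_zero, div_eq_iff hη] at hG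
    rw [hG]; ring
  rw [hs] at e3
  have e3' : p.Gamma0 f = (p.γ - p.η ^ 2 * k ^ 2) * rep f.fst 0 :=
    mul_left_cancel₀ hη (by linear_combination e3)
  have hθ := p.theta_ne_zero
  have cs := Complex.sin_sq_add_cos_sq (k * p.l)
  by_contra hd
  set a := rep f.fst 0
  set b := rep (dTau p.τ f.fst) 0
  set S := Complex.sin (k * p.l) with hS
  set C := Complex.cos (k * p.l) with hC
  have hdisp : p.disp k = (p.η ^ 2 * k ^ 2 - p.γ) * S + 2 * k * (p.cosAngle - C) := rfl
  have ha : p.theta * p.disp k * a = 0 := by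
    rw [hdisp]
    linear_combination (1 - p.theta * C) * e1 + p.theta * S * (e3' - e2) - k * a * p.theta_sq -
      p.theta ^ 2 * k * a * cs
  have hb : p.theta * p.disp k * b = 0 := by
    rw [hdisp]
    linear_combination k * (1 - p.theta * C) * (e3' - e2) -
      (p.theta * k * S - (p.γ - p.η ^ 2 * k ^ 2)) * e1 - k * b * p.theta_sq -
      p.theta ^ 2 * k * b * cs
  have hne := mul_ne_zero hθ hd
  exact hf (p.eq_zero_of_cauchy_eq_zero hk h e ((mul_eq_zero.1 ha).resolve_left hne)
    ((mul_eq_zero.1 hb).resolve_left hne))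

/-- `disp` is real on the real axis. -/
theorem disp_ofReal (k : ℝ) : p.disp k = (((p.η ^ 2 * k ^ 2 - p.γ) * Real.sin (k * p.l) +
    2 * k * (p.cosAngle - Real.cos (k * p.l)) : ℝ) : ℂ) := by
  rw [disp]; push_cast; ring

theorem dispersion_iff {x : ℝ} (hx : 0 < x) : p.Dispersion x ↔ p.disp (√x : ℝ) = 0 := by
  have hs := Real.sqrt_pos.2 hx
  rw [disp_ofReal, Complex.ofReal_eq_zero, Dispersion, Real.sq_sqrt hx.le]
  constructor
  · intro h
    rw [← h]
    field_simp
    ring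
  · intro h
    field_simp
    linear_combination -h

/-- Eigenvectors at the points where `sin kl = 0` are annihilated by `Γ₀`. -/
theorem Gamma0_eq_zero_of_sin_eq_zero {k : ℂ} (hk : k ≠ 0) {f : PairSpace p.l}
    (h : f ∈ p.maxOp.domain) (e : p.maxOp ⟨f, h⟩ = k ^ 2 • f) (hd : p.disp k = 0)
    (hs : Complex.sin (k * p.l) = 0) : p.Gamma0 f = 0 := by
  obtain ⟨-, e2, -⟩ := p.boundary_of_maxOp_eq h e
  have cs := Complex.sin_sq_add_cos_sq (k * p.l)
  rw [disp, hs, mul_zero, zero_add] at hd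
  -- `sin kl = 0` and the dispersion relation give `c = cos kl = ±1`, hence `θ = c`
  have hc : Complex.cos (k * p.l) = p.cosAngle := by
    have := (mul_eq_zero.1 hd).resolve_left (by simpa using hk)
    exact (sub_eq_zero.1 this).symm
  rw [hs] at cs e2
  rw [hc] at cs e2
  have h1 : (p.theta - p.cosAngle) ^ 2 = 0 := by linear_combination p.theta_sq + cs
  have h2 : p.theta = p.cosAngle := sub_eq_zero.1 (by simpa using h1)
  rw [e2, h2]
  linear_combination -rep (dTau p.τ f.fst) 0 * cs

/-- The model operator has a Hilbert basis of eigenvectors. -/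
theorem exists_hilbertBasis_modelOp : ∃ (ι : Type) (b : HilbertBasis ι ℂ (PairSpace p.l))
    (v : ι → ℝ), ∀ i, 0 < v i ∧ ∃ h : b i ∈ p.modelOp.domain, p.modelOp ⟨b i, h⟩ = (v i : ℂ) • b i := by
  obtain ⟨ι, b, hb⟩ := exists_hilbertBasis_eigenvectors p.isCompactOperator_invOp
    p.isSymmetric_invOp
  have key : ∀ i, ∃ x : ℝ, 0 < x ∧
      ∃ h : b i ∈ p.modelOp.domain, p.modelOp ⟨b i, h⟩ = (x : ℂ) • b i := by
    intro i
    obtain ⟨c, hc⟩ := hb i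
    have hbi : b i ≠ 0 := b.orthonormal.ne_zero i
    obtain ⟨hm, he⟩ := p.modelOp_invOp (b i)
    have hc0 : c ≠ 0 := by
      rintro rfl
      rw [zero_smul] at hc
      have : (⟨p.invOp (b i), hm⟩ : p.modelOp.domain) = 0 := Subtype.ext hc
      rw [this, LinearPMap.map_zero] at he
      exact hbi he.symm
    have e1 : b i = c⁻¹ • p.invOp (b i) := by rw [hc, smul_smul, inv_mul_cancel₀ hc0, one_smul]
    have hmem : b i ∈ p.modelOp.domain := by
      have := p.modelOp.domain.smul_mem c⁻¹ hm
      rwa [← e1] at this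
    have e2 : p.modelOp ⟨b i, hmem⟩ = c⁻¹ • b i := by
      have : (⟨b i, hmem⟩ : p.modelOp.domain) = c⁻¹ • ⟨p.invOp (b i), hm⟩ := Subtype.ext e1
      rw [this, LinearPMap.map_smul, he]
    obtain ⟨x, hx, hcx⟩ := p.eigenvalue_pos hmem hbi e2
    exact ⟨x, hx, hmem, by rw [e2, hcx]⟩
  choose v hv using key
  exact ⟨ι, b, v, hv⟩

/-! ### Existence of the measure -/

/-- The Fourier coefficients of the deficiency vectors with respect to eigenvectors, by Green's
identity. -/
theorem inner_eigenvector_gammaField {z : ℂ} (hz : z.im ≠ 0) {x : ℝ} {e : PairSpace p.l}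
    (h : e ∈ p.modelOp.domain) (he : p.modelOp ⟨e, h⟩ = (x : ℂ) • e) :
    (z - x) * inner ℂ e (p.gammaField z) = p.mFunction z * (starRingEnd ℂ) (p.Gamma0 e) := by
  obtain ⟨hm, hG⟩ := p.mem_modelOp_iff.1 h
  obtain ⟨h', he', h0', h1'⟩ := p.gammaField_mem hz
  have := p.green_ker (f := ⟨_, h'⟩) (g := ⟨_, hm⟩) he' he
  simpa [hG, h0', h1'] using this

/-- The spectral expansion of `-1/m`: Parseval's identity for `⟨γ(i), γ(z)⟩`, where `γ(z)` is the
deficiency vector at `z`. -/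
theorem hasSum_neg_inv_mFunction {ι : Type} (b : HilbertBasis ι ℂ (PairSpace p.l)) (v : ι → ℝ)
    (hb : ∀ i, ∃ h : b i ∈ p.modelOp.domain, p.modelOp ⟨b i, h⟩ = (v i : ℂ) • b i)
    {z : ℂ} (hz : 0 < z.im) :
    HasSum (fun i => ((‖p.Gamma0 (b i)‖ ^ 2 : ℝ) : ℂ) *
        ((z + Complex.I) / ((v i - z) * (v i + Complex.I))))
      (-(p.mFunction z)⁻¹ - (starRingEnd ℂ) (-(p.mFunction Complex.I)⁻¹)) := by
  have hI : (0 : ℝ) < Complex.I.im := by simp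
  have hmz := p.mFunction_ne_zero hz.ne'
  have hmI := p.mFunction_ne_zero hI.ne'
  have hmI' : (starRingEnd ℂ) (p.mFunction Complex.I) ≠ 0 := by simpa using hmI
  have h1 := (b.hasSum_inner_mul_inner (p.gammaField Complex.I) (p.gammaField z)).mul_left
    ((z + Complex.I) / (p.mFunction z * (starRingEnd ℂ) (p.mFunction Complex.I)))
  obtain ⟨h', he', h0', h1'⟩ := p.gammaField_mem hz.ne'
  obtain ⟨h'', he'', h0'', h1''⟩ := p.gammaField_mem hI.ne'
  have g := p.green_ker (f := ⟨_, h'⟩) (g := ⟨_, h''⟩) he' he''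
  simp only [h0', h1', h0'', h1'', map_one, mul_one, one_mul, Complex.conj_I, sub_neg_eq_add] at g
  have e1 : (z + Complex.I) / (p.mFunction z * (starRingEnd ℂ) (p.mFunction Complex.I)) *
      inner ℂ (p.gammaField Complex.I) (p.gammaField z) =
      -(p.mFunction z)⁻¹ - (starRingEnd ℂ) (-(p.mFunction Complex.I)⁻¹) := by
    rw [div_mul_eq_mul_div, g, map_neg, map_inv₀]
    field_simp
    ring
  rw [e1] at h1
  refine h1.congr_fun fun i => ?_
  obtain ⟨h, he⟩ := hb i
  have k1 := p.inner_eigenvector_gammaField hz.ne' h he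
  have k2 := p.inner_eigenvector_gammaField hI.ne' h he
  have hs1 := sub_ne_zero_of_im_ne hz.ne' (v i)
  have hs2 := sub_ne_zero_of_im_ne (z := -Complex.I) (by simp) (v i)
  rw [sub_neg_eq_add] at hs2
  have k2' : -((v i : ℂ) + Complex.I) * inner ℂ (p.gammaField Complex.I) (b i) =
      (starRingEnd ℂ) (p.mFunction Complex.I) * p.Gamma0 (b i) := by
    have := congrArg (starRingEnd ℂ) k2
    rw [map_mul, map_mul, inner_conj_symm, Complex.conj_conj, map_sub, Complex.conj_I,
      Complex.conj_ofReal] at this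
    linear_combination this
  have e3 : ((‖p.Gamma0 (b i)‖ ^ 2 : ℝ) : ℂ) =
      p.Gamma0 (b i) * (starRingEnd ℂ) (p.Gamma0 (b i)) := by
    rw [Complex.mul_conj, Complex.normSq_eq_norm_sq]
  rw [e3]
  field_simp
  linear_combination -(z + Complex.I) * ((starRingEnd ℂ) (p.mFunction Complex.I) *
    p.Gamma0 (b i) * k1 + (z - v i) * inner ℂ (b i) (p.gammaField z) * k2')

end ModelParams

/-- A function with a discrete spectral expansion is a Nevanlinna function, with the discrete
measure. -/
theorem isNevanlinnaMeasure_sum {ι : Type} {F : ℂ → ℂ} {w v : ι → ℝ} (hw : ∀ i, 0 ≤ w i)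
    (h : ∀ z : ℂ, 0 < z.im → HasSum (fun i => (w i : ℂ) *
      ((z + Complex.I) / ((v i - z) * (v i + Complex.I)))) (F z - (starRingEnd ℂ) (F Complex.I))) :
    IsNevanlinnaMeasure F
      (Measure.sum fun i => ENNReal.ofReal (w i) • Measure.dirac (v i)) := by
  have hIm : (0 : ℝ) < Complex.I.im := by simp
  -- the expansion at `i` has positive terms
  have hI : HasSum (fun i => w i * (1 / (1 + v i ^ 2))) (F Complex.I).im := by
    have h1 := (h Complex.I hIm).mul_left (1 / (2 * Complex.I))
    rw [Complex.sub_conj] at h1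
    have e : 1 / (2 * Complex.I) * (((2 * (F Complex.I).im : ℝ) : ℂ) * Complex.I) =
        ((F Complex.I).im : ℂ) := by
      have := Complex.I_ne_zero
      push_cast
      field_simp
    rw [e] at h1
    rw [← Complex.hasSum_ofReal]
    refine h1.congr_fun fun i => ?_
    have e1 := sub_ne_zero_of_im_ne hIm.ne' (v i)
    have e2 := sub_ne_zero_of_im_ne (z := -Complex.I) (by simp) (v i)
    have e3 : (1 : ℂ) + (v i : ℂ) ^ 2 = (v i - Complex.I) * (v i + Complex.I) := by
      linear_combination Complex.I_sq
    rw [sub_neg_eq_add] at e2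
    have := Complex.I_ne_zero
    push_cast
    rw [e3]
    field_simp
    ring
  have hfin : ∫⁻ σ, ENNReal.ofReal (1 / (1 + σ ^ 2))
      ∂(Measure.sum fun i => ENNReal.ofReal (w i) • Measure.dirac (v i)) < ⊤ := by
    rw [lintegral_sum_measure]
    refine lt_of_eq_of_lt (tsum_congr fun i => ?_) hI.summable.tsum_ofReal_lt_top
    rw [lintegral_smul_measure, lintegral_dirac, smul_eq_mul, ← ENNReal.ofReal_mul (hw i)]
  refine ⟨hfin, (F Complex.I).re, 0, le_rfl, fun z hz => ?_⟩
  have hint := IsNevanlinnaMeasure.integrable_nevKernel (F := fun z => ∫ σ, nevKernel z σ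
    ∂(Measure.sum fun i => ENNReal.ofReal (w i) • Measure.dirac (v i)))
    ⟨hfin, 0, 0, le_rfl, fun z _ => by simp⟩ hz.ne'
  have h1 := hasSum_integral_measure hint
  have h2 := (h z hz).sub (((Complex.hasSum_ofReal.2 hI).mul_left Complex.I))
  have h3 := h1.unique (by
    refine h2.congr_fun fun i => ?_
    rw [integral_smul_measure, integral_dirac, nevKernel_eq_div_sub hz.ne',
      ENNReal.toReal_ofReal (hw i), Complex.real_smul]
    push_cast
    ring)
  rw [h3]
  have h4 : (starRingEnd ℂ) (F Complex.I) = (F Complex.I).re - (F Complex.I).im * Complex.I := by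
    apply Complex.ext <;> simp
  rw [h4]
  push_cast
  ring

theorem sum_dirac_eq_zero {ι : Type} {w v : ι → ℝ} {s : Set ℝ} (hs : MeasurableSet s)
    (h : ∀ i, v i ∈ s → w i = 0) :
    (Measure.sum fun i => ENNReal.ofReal (w i) • Measure.dirac (v i)) s = 0 := by
  rw [Measure.sum_apply _ hs, ENNReal.tsum_eq_zero]
  intro i
  by_cases hi : v i ∈ s
  · simp [h i hi]
  · simp [Measure.dirac_apply' _ hs, hi]

namespace ModelParams

variable (p : ModelParams)

/-- The measure of `-1/m` exists; it is carried by the solutions of the dispersion relation, and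
does not charge those with `sin √x l = 0`. -/
theorem exists_isNevanlinnaMeasure : ∃ μ : Measure ℝ,
    IsNevanlinnaMeasure (fun z => -(p.mFunction z)⁻¹) μ ∧
    ∀ s : Set ℝ, MeasurableSet s →
      (∀ x ∈ s, 0 < x → p.Dispersion x → Real.sin (√x * p.l) = 0) → μ s = 0 := by
  obtain ⟨ι, b, v, hb⟩ := p.exists_hilbertBasis_modelOp
  refine ⟨_, isNevanlinnaMeasure_sum (w := fun i => ‖p.Gamma0 (b i)‖ ^ 2) (v := v)
    (fun i => by positivity)
    (fun z hz => p.hasSum_neg_inv_mFunction b v (fun i => (hb i).2) hz), fun s hs h => ?_⟩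
  refine sum_dirac_eq_zero hs fun i hi => ?_
  obtain ⟨hv, hm, he⟩ := hb i
  have hsq : (((√(v i) : ℝ) : ℂ)) ^ 2 = v i := by exact_mod_cast Real.sq_sqrt hv.le
  have hk : ((√(v i) : ℝ) : ℂ) ≠ 0 := by exact_mod_cast (Real.sqrt_pos.2 hv).ne'
  rw [← hsq] at he
  have hd := p.disp_eq_zero_of_eigen hk (b.orthonormal.ne_zero i) hm he
  have hsin := h _ hi hv ((p.dispersion_iff hv).2 hd)
  have := p.Gamma0_eq_zero_of_sin_eq_zero hk (p.mem_modelOp_iff.1 hm).1 he hd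
    (by exact_mod_cast hsin)
  simp [this]

end ModelParams

/-! ### The sequence of solutions of the dispersion relation -/

/-- A subset of `ℝ` that is unbounded above and meets every lower half-line in a finite set is the
range of an increasing sequence. -/
theorem exists_strictMono_range_eq {S : Set ℝ} (hfin : ∀ M, (S ∩ Iic M).Finite)
    (hunb : ∀ M, ∃ x ∈ S, M < x) :
    ∃ lam : ℕ → ℝ, StrictMono lam ∧ Tendsto lam atTop atTop ∧ range lam = S := by
  obtain ⟨x₀, hx₀, -⟩ := hunb 0
  obtain ⟨y₀, ⟨hy₀, hy₁⟩, hmin⟩ := (hfin x₀).exists_minimal ⟨x₀, hx₀, le_refl x₀⟩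
  have hmin' : ∀ x ∈ S, y₀ ≤ x := fun x hx => by
    by_contra! h
    exact absurd (hmin (y := x) ⟨hx, h.le.trans hy₁⟩ h.le) (not_le.2 h)
  let _ : LocallyFiniteOrder S := LocallyFiniteOrder.ofFiniteIcc fun a b => by
    refine Set.Finite.of_finite_image (f := Subtype.val) ((hfin b).subset ?_)
      Subtype.val_injective.injOn
    rintro _ ⟨x, hx, rfl⟩
    exact ⟨x.2, hx.2⟩
  let _ : OrderBot S := { bot := ⟨y₀, hy₀⟩, bot_le := fun x => hmin' x x.2 }
  have : NoMaxOrder S := ⟨fun x => by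
    obtain ⟨y, hy, hxy⟩ := hunb x
    exact ⟨⟨y, hy⟩, hxy⟩⟩
  let _ : SuccOrder S := LinearLocallyFiniteOrder.succOrder S
  let _ : PredOrder S := LinearLocallyFiniteOrder.predOrder S
  let e : S ≃o ℕ := orderIsoNatOfLinearSuccPredArch
  have hmono : StrictMono fun n => (e.symm n : ℝ) := fun a b h => e.symm.strictMono h
  have hrange : range (fun n => (e.symm n : ℝ)) = S := by
    ext x
    constructor
    · rintro ⟨n, rfl⟩
      exact (e.symm n).2
    · intro hx
      exact ⟨e ⟨x, hx⟩, by simp⟩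
  refine ⟨_, hmono, tendsto_atTop_atTop_of_monotone hmono.monotone fun M => ?_, hrange⟩
  obtain ⟨x, hx, hM⟩ := hunb M
  rw [← hrange] at hx
  obtain ⟨n, rfl⟩ := hx
  exact ⟨n, hM.le⟩

theorem isClosed_range_of_tendsto_atTop {lam : ℕ → ℝ} (h : Tendsto lam atTop atTop) :
    IsClosed (range lam) := by
  have : IsProperMap lam := by
    rw [isProperMap_iff_tendsto_cocompact, cocompact_eq_cofinite, Nat.cofinite_eq_atTop]
    exact ⟨continuous_of_discreteTopology, h.mono_right atTop_le_cocompact⟩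
  exact this.isClosedMap.isClosed_range

namespace ModelParams

variable (p : ModelParams)

theorem differentiable_disp : Differentiable ℂ p.disp := by
  unfold disp
  fun_prop

theorem exists_disp_ne_zero : ∃ k, p.disp k ≠ 0 := by
  have hI : Complex.I.im ≠ 0 := by simp
  exact ⟨_, fun h => p.mFunction_ne_zero hI ((p.admissible_sqrt hI).mFun_eq_zero h)⟩

/-- The entire function `disp` does not vanish identically, so its zeros do not accumulate. -/
theorem finite_zeros_disp {K : Set ℂ} (hK : IsCompact K) : (K ∩ {k | p.disp k = 0}).Finite := by
  by_contra hinf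
  obtain ⟨z, -, hz⟩ := Set.Infinite.exists_accPt_of_subset_isCompact hinf hK inter_subset_left
  have h1 : ∃ᶠ k in 𝓝[≠] z, p.disp k = 0 :=
    (accPt_iff_frequently_nhdsNE.1 hz).mono fun k hk => hk.2
  have h2 := (p.differentiable_disp.differentiableOn.analyticOnNhd
    isOpen_univ).eqOn_zero_of_preconnected_of_frequently_eq_zero isPreconnected_univ
    (mem_univ z) h1
  obtain ⟨k, hk⟩ := p.exists_disp_ne_zero
  exact hk (h2 (mem_univ k))

theorem finite_dispersion (M : ℝ) : ({x | 0 < x ∧ p.Dispersion x} ∩ Iic M).Finite := by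
  refine Set.Finite.of_finite_image (f := fun x => ((√x : ℝ) : ℂ))
    ((p.finite_zeros_disp (isCompact_closedBall (0 : ℂ) √M)).subset ?_) ?_
  · rintro _ ⟨x, ⟨⟨hx, hd⟩, hM⟩, rfl⟩
    refine ⟨?_, (p.dispersion_iff hx).1 hd⟩
    rw [mem_closedBall_zero_iff, Complex.norm_real, Real.norm_of_nonneg (Real.sqrt_nonneg x)]
    exact Real.sqrt_le_sqrt hM
  · rintro x ⟨⟨hx, -⟩, -⟩ y ⟨⟨hy, -⟩, -⟩ h
    have h' : √x = √y := Complex.ofReal_injective h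
    exact (Real.sqrt_inj hx.le hy.le).1 h'

/-- There are arbitrarily large solutions: at the zeros of `cos kl` the values of `disp` alternate in
sign for large `k`. -/
theorem exists_dispersion_gt (M : ℝ) : ∃ x ∈ {x | 0 < x ∧ p.Dispersion x}, M < x := by
  have hl := p.l_pos
  have hγ := p.γ_pos
  have hη : 0 < p.η ^ 2 := by have := p.η_ne; positivity
  obtain ⟨c1, c2⟩ := abs_le.1 p.abs_cosAngle_le
  set h : ℝ → ℝ := fun k => (p.η ^ 2 * k ^ 2 - p.γ) * Real.sin (k * p.l) +
    2 * k * (p.cosAngle - Real.cos (k * p.l)) with hh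
  have hcont : Continuous h := by rw [hh]; fun_prop
  -- beyond `K` the first term of `h` dominates where the cosine vanishes
  set K : ℝ := (3 + p.γ) / p.η ^ 2 + |M| + 1 with hK
  have hK1 : 1 ≤ K := by rw [hK]; have : 0 < (3 + p.γ) / p.η ^ 2 := by positivity
                         linarith [abs_nonneg M]
  have hKM : M < K := by rw [hK]; have : 0 < (3 + p.γ) / p.η ^ 2 := by positivity
                         linarith [le_abs_self M]
  have hdom : ∀ k, K ≤ k → 0 < p.η ^ 2 * k ^ 2 - p.γ - 2 * k := by
    intro k hk
    have h1 : (3 + p.γ) / p.η ^ 2 ≤ k := by rw [hK] at hk; linarith [abs_nonneg M]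
    rw [div_le_iff₀ hη] at h1
    have hk1 : 1 ≤ k := hK1.trans hk
    nlinarith
  obtain ⟨n, hn⟩ := exists_nat_ge (K * p.l / (2 * Real.pi))
  have hpi := Real.pi_pos
  rw [div_le_iff₀ (by positivity)] at hn
  set a : ℝ := (Real.pi / 2 + n * (2 * Real.pi)) / p.l with ha
  set b : ℝ := (Real.pi / 2 + Real.pi + n * (2 * Real.pi)) / p.l with hb
  have hal : a * p.l = Real.pi / 2 + n * (2 * Real.pi) := by rw [ha]; field_simp
  have hbl : b * p.l = Real.pi / 2 + Real.pi + n * (2 * Real.pi) := by rw [hb]; field_simp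
  have hab : a ≤ b := by rw [ha, hb]; gcongr; linarith
  have hKa : K ≤ a := by rw [ha, le_div_iff₀ hl]; linarith
  have hpos : 0 < h a := by
    simp only [hh, hal, Real.sin_add_nat_mul_two_pi, Real.cos_add_nat_mul_two_pi,
      Real.sin_pi_div_two, Real.cos_pi_div_two]
    have := hdom a hKa
    nlinarith
  have hneg : h b < 0 := by
    simp only [hh, hbl, Real.sin_add_nat_mul_two_pi, Real.cos_add_nat_mul_two_pi,
      Real.sin_add_pi, Real.cos_add_pi, Real.sin_pi_div_two, Real.cos_pi_div_two]
    have := hdom b (hKa.trans hab)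
    nlinarith
  obtain ⟨k, ⟨hk1, -⟩, hk⟩ := intermediate_value_Icc' hab hcont.continuousOn ⟨hneg.le, hpos.le⟩
  have hk0 : K ≤ k := hKa.trans hk1
  have hkp : 0 < k := by linarith
  refine ⟨k ^ 2, ⟨by positivity, (p.dispersion_iff (by positivity)).2 ?_⟩, by nlinarith⟩
  rw [Real.sqrt_sq hkp.le, disp_ofReal]
  exact_mod_cast hk

theorem exists_dispersion_sequence : ∃ lam : ℕ → ℝ, StrictMono lam ∧ Tendsto lam atTop atTop ∧
    range lam = {x | 0 < x ∧ p.Dispersion x} :=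
  exists_strictMono_range_eq p.finite_dispersion p.exists_dispersion_gt

/-! ### The masses -/

variable {p}

/-- The dispersion relation, cleared of denominators. -/
theorem Dispersion.mul_sin_eq {x : ℝ} (hx : 0 < x) (h : p.Dispersion x) :
    (p.η ^ 2 * x - p.γ) * Real.sin (√x * p.l) =
      2 * √x * (Real.cos (√x * p.l) - p.cosAngle) := by
  have := (p.dispersion_iff hx).1 h
  rw [disp_ofReal, Complex.ofReal_eq_zero, Real.sq_sqrt hx.le] at this
  linear_combination this

theorem Dispersion.massDenom_eq {x : ℝ} (hx : 0 < x) (h : p.Dispersion x)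
    (hs : Real.sin (√x * p.l) ≠ 0) :
    p.massDenom x = p.η ^ 2 + p.γ / x + 2 * p.l + 2 * p.l *
      (Real.cos (√x * p.l) - p.cosAngle) * Real.cos (√x * p.l) / Real.sin (√x * p.l) ^ 2 := by
  have h1 := h.mul_sin_eq hx
  have hk := (Real.sqrt_pos.2 hx).ne'
  rw [massDenom, Real.cot_eq_cos_div_sin]
  congr 1
  rw [div_mul_eq_mul_div, div_mul_div_comm, div_eq_div_iff (by positivity) (by positivity)]
  linear_combination p.l * Real.cos (√x * p.l) * Real.sin (√x * p.l) * h1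

/-- The denominator is positive: by the dispersion relation its last term is at least `-l`, because
`(cos - c)² + 1 - c² ≥ 0`. -/
theorem Dispersion.massDenom_pos {x : ℝ} (hx : 0 < x) (h : p.Dispersion x)
    (hs : Real.sin (√x * p.l) ≠ 0) : 0 < p.massDenom x := by
  rw [h.massDenom_eq hx hs]
  have hl := p.l_pos
  have hγ := p.γ_pos
  have hη : 0 < p.η ^ 2 := by have := p.η_ne; positivity
  obtain ⟨c1, c2⟩ := abs_le.1 p.abs_cosAngle_le
  set C := Real.cos (√x * p.l)
  set S := Real.sin (√x * p.l)
  have cs : S ^ 2 + C ^ 2 = 1 := Real.sin_sq_add_cos_sq _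
  have hS : 0 < S ^ 2 := by positivity
  have h1 : -p.l ≤ 2 * p.l * (C - p.cosAngle) * C / S ^ 2 := by
    rw [le_div_iff₀ hS]
    nlinarith [mul_nonneg hl.le (sq_nonneg (C - p.cosAngle)),
      mul_nonneg hl.le (mul_nonneg (sub_nonneg.2 c2) (by linarith : 0 ≤ 1 + p.cosAngle))]
  have h2 : 0 < p.γ / x := by positivity
  linarith

theorem hasDerivAt_disp (k : ℂ) : HasDerivAt p.disp
    (2 * p.η ^ 2 * k * Complex.sin (k * p.l) + (p.η ^ 2 * k ^ 2 - p.γ) * p.l *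
      Complex.cos (k * p.l) + 2 * (p.cosAngle - Complex.cos (k * p.l)) +
      2 * k * p.l * Complex.sin (k * p.l)) k := by
  have h0 : HasDerivAt (fun k : ℂ => k * p.l) p.l k := by
    simpa using (hasDerivAt_id k).mul_const (p.l : ℂ)
  have h1 := ((((hasDerivAt_id k).pow 2).const_mul ((p.η : ℂ) ^ 2)).sub_const (p.γ : ℂ)).mul h0.csin
  have h2 := ((hasDerivAt_id k).const_mul 2).mul (h0.ccos.const_sub (p.cosAngle : ℂ))
  refine (h1.add h2).congr_deriv ?_
  simp
  ring

/-- At a solution of the dispersion relation the derivative of `disp` is a multiple of the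
denominator of the mass formula. -/
theorem Dispersion.hasDerivAt_disp {x : ℝ} (hx : 0 < x) (h : p.Dispersion x)
    (hs : Real.sin (√x * p.l) ≠ 0) : HasDerivAt p.disp
      ((√x * Real.sin (√x * p.l) * p.massDenom x : ℝ) : ℂ) (√x : ℝ) := by
  refine (ModelParams.hasDerivAt_disp _).congr_deriv ?_
  have h1 := h.mul_sin_eq hx
  have hk := (Real.sqrt_pos.2 hx).ne'
  have hsq := Real.sq_sqrt hx.le
  have e : √x * Real.sin (√x * p.l) * p.massDenom x =
      2 * p.η ^ 2 * √x * Real.sin (√x * p.l) + (p.η ^ 2 * √x ^ 2 - p.γ) * p.l *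
      Real.cos (√x * p.l) + 2 * (p.cosAngle - Real.cos (√x * p.l)) +
      2 * √x * p.l * Real.sin (√x * p.l) := by
    rw [massDenom, Real.cot_eq_cos_div_sin]
    have hx' : x = √x ^ 2 := hsq.symm
    generalize √x = k at *
    subst hx'
    field_simp
    linear_combination -h1
  rw [e]
  push_cast
  ring

theorem sqrt_ofReal_of_pos {x : ℝ} (hx : 0 < x) : Complex.sqrt (x : ℂ) = (√x : ℝ) :=
  Complex.sqrt_of_nonneg (by exact_mod_cast hx.le)

/-- The mass formula: the mass is minus the residue of `-1/m`, computed in the variable `k = √z`,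
where the pole is a simple zero of `disp`. -/
theorem Dispersion.measure_singleton {μ : Measure ℝ}
    (hμ : IsNevanlinnaMeasure (fun z => -(p.mFunction z)⁻¹) μ) {x : ℝ} (hx : 0 < x)
    (h : p.Dispersion x) (hs : Real.sin (√x * p.l) ≠ 0) :
    μ {x} = ENNReal.ofReal (2 * (p.η ^ 2 * x - p.γ) ^ 2 / p.massDenom x) := by
  have hκ := Real.sqrt_pos.2 hx
  have hsq : ((√x : ℝ) : ℂ) ^ 2 = x := by exact_mod_cast Real.sq_sqrt hx.le
  have hmd := h.massDenom_pos hx hs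
  -- `k(y) = √(x + iy)` tends to `√x`
  have hk : Tendsto (fun y : ℝ => Complex.sqrt (x + Complex.I * y)) (𝓝[>] 0) (𝓝 (√x : ℝ)) := by
    have h1 : ContinuousAt Complex.sqrt (x : ℂ) := Complex.continuousAt_sqrt (Or.inl hx.le)
    have h2 : Tendsto (fun y : ℝ => (x + Complex.I * y : ℂ)) (𝓝[>] 0) (𝓝 (x : ℂ)) := by
      have : Continuous fun y : ℝ => (x + Complex.I * y : ℂ) := by fun_prop
      simpa using (this.tendsto 0).mono_left (nhdsWithin_le_nhds (s := Ioi 0))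
    rw [← sqrt_ofReal_of_pos hx]
    exact h1.tendsto.comp h2
  have hk' : Tendsto (fun y : ℝ => Complex.sqrt (x + Complex.I * y)) (𝓝[>] 0)
      (𝓝[≠] ((√x : ℝ) : ℂ)) := by
    refine tendsto_nhdsWithin_of_tendsto_nhds_of_eventually_within _ hk ?_
    filter_upwards [self_mem_nhdsWithin] with y hy
    intro hy'
    have := congrArg (· ^ 2) hy'
    simp only [complexSqrt_sq, hsq, add_eq_left, mul_eq_zero, Complex.I_ne_zero, false_or,
      Complex.ofReal_eq_zero] at this
    exact (ne_of_gt hy) this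
  have hslope := (hasDerivAt_iff_tendsto_slope.1 (h.hasDerivAt_disp hx hs)).comp hk'
  have hnum : Continuous fun k : ℂ => -(k + (√x : ℝ)) *
      (2 * k * (p.cosAngle - Complex.cos (k * p.l)) * (p.η ^ 2 * k ^ 2 - p.γ)) := by fun_prop
  have hne : ((√x * Real.sin (√x * p.l) * p.massDenom x : ℝ) : ℂ) ≠ 0 := by
    exact_mod_cast mul_ne_zero (mul_ne_zero hκ.ne' hs) hmd.ne'
  have hlim := ((hnum.tendsto _).comp hk).div hslope hne
  have hlim' := hμ.tendsto_singleton x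
  have heq := tendsto_nhds_unique_of_eventuallyEq hlim' hlim (by
    filter_upwards [self_mem_nhdsWithin] with y hy
    have him : (x + Complex.I * y : ℂ).im ≠ 0 := by simpa using (ne_of_gt hy)
    have h1 := (p.admissible_sqrt him).neg_inv_mFun
    have h2 := complexSqrt_sq (x + Complex.I * y)
    have h0 : p.disp (√x : ℝ) = 0 := (p.dispersion_iff hx).1 h
    simp only [Function.comp_apply, Pi.div_apply, slope_def_field, h0, sub_zero]
    rw [mFunction, h1]
    generalize Complex.sqrt (x + Complex.I * y) = k at *
    have h3 : Complex.I * y = (k - (√x : ℝ)) * (k + (√x : ℝ)) := by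
      linear_combination hsq - h2
    rw [h3, div_div_eq_mul_div]
    ring)
  have hN : (μ {x}).toReal = 2 * (p.η ^ 2 * x - p.γ) ^ 2 / p.massDenom x := by
    have e1 := h.mul_sin_eq hx
    have e2 : ((μ {x}).toReal : ℂ) = ((2 * (p.η ^ 2 * x - p.γ) ^ 2 / p.massDenom x : ℝ) : ℂ) := by
      rw [heq]
      have : (Complex.cos ((√x : ℝ) * p.l) : ℂ) = (Real.cos (√x * p.l) : ℝ) := by push_cast; rfl
      rw [this, hsq]
      norm_cast
      rw [div_eq_div_iff (by positivity) hmd.ne']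
      linear_combination -2 * √x * p.massDenom x * (p.η ^ 2 * x - p.γ) * e1
    exact_mod_cast e2
  rw [← hN, ENNReal.ofReal_toReal (hμ.measure_singleton_lt_top x).ne]

end ModelParams

/-! ### The Hilbert basis of normalised point masses -/

section

variable {ν : Measure ℝ}

theorem inner_indicatorConstLp_singleton {x : ℝ} (hx : ν {x} ≠ ⊤) (a : ℂ) (f : Lp ℂ 2 ν) :
    inner ℂ (indicatorConstLp 2 (measurableSet_singleton x) hx a) f =
      (starRingEnd ℂ) a * ((ν {x}).toReal * f x) := by
  rw [L2.inner_indicatorConstLp_eq_inner_setIntegral, integral_singleton, RCLike.inner_apply,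
    Measure.real, Complex.real_smul, mul_comm]

theorem indicatorConstLp_singleton_apply {x : ℝ} (hx : ν {x} ≠ ⊤) (a : ℂ)
    (y : ℝ) (hy0 : ν {y} ≠ 0) :
    indicatorConstLp 2 (measurableSet_singleton x) hx a y = if y = x then a else 0 := by
  have h := indicatorConstLp_coeFn (p := 2) (hs := measurableSet_singleton x) (hμs := hx) (c := a)
  have h1 := (ae_iff.1 h)
  by_contra hne
  refine hy0 (measure_mono_null (singleton_subset_iff.2 ?_) h1)
  simpa [indicator_apply] using hne

/-- In `L²` of a measure carried by a sequence of atoms, the normalised indicator functions of the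
atoms form a Hilbert basis. -/
theorem exists_hilbertBasis_atoms {lam : ℕ → ℝ} (hinj : Function.Injective lam)
    (hν : ∀ᵐ x ∂ν, x ∈ range lam) (htop : ∀ j, ν {lam j} ≠ ⊤) {a : ℕ → ℂ}
    (ha : ∀ j, ‖a j‖ ^ 2 * (ν {lam j}).toReal = 1) :
    ∃ b : HilbertBasis ℕ ℂ (Lp ℂ 2 ν), ∀ j (f : Lp ℂ 2 ν),
      b.repr f j = (starRingEnd ℂ) (a j) * ((ν {lam j}).toReal * f (lam j)) := by
  have h0 : ∀ j, ν {lam j} ≠ 0 := fun j h => by simpa [h] using ha j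
  have ha0 : ∀ j, a j ≠ 0 := fun j h => by simpa [h] using ha j
  have hr0 : ∀ j, ((ν {lam j}).toReal : ℂ) ≠ 0 := fun j => by
    exact_mod_cast (ENNReal.toReal_pos (h0 j) (htop j)).ne'
  set v : ℕ → Lp ℂ 2 ν := fun j =>
    indicatorConstLp 2 (measurableSet_singleton (lam j)) (htop j) (a j) with hv
  have horth : Orthonormal ℂ v := by
    rw [orthonormal_iff_ite]
    intro i j
    simp only [hv]
    rw [inner_indicatorConstLp_singleton,
      indicatorConstLp_singleton_apply (htop j) _ _ (h0 i)]
    by_cases hij : i = j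
    · subst hij
      simp only [if_true]
      have := ha i
      rw [← Complex.normSq_eq_norm_sq] at this
      have h2 : ((Complex.normSq (a i) * (ν {lam i}).toReal : ℝ) : ℂ) = 1 := by exact_mod_cast this
      rw [Complex.ofReal_mul, ← Complex.mul_conj] at h2
      linear_combination h2
    · rw [if_neg (fun h => hij (hinj h)), if_neg hij, mul_zero, mul_zero]
  have hsp : (Submodule.span ℂ (range v))ᗮ = ⊥ := by
    rw [eq_bot_iff]
    intro f hf
    rw [Submodule.mem_orthogonal] at hf
    rw [Submodule.mem_bot, Lp.eq_zero_iff_ae_eq_zero]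
    filter_upwards [hν] with x hx
    obtain ⟨j, rfl⟩ := hx
    have := hf (v j) (Submodule.subset_span ⟨j, rfl⟩)
    simp only [hv] at this
    rw [inner_indicatorConstLp_singleton] at this
    have h2 : (starRingEnd ℂ) (a j) ≠ 0 := by simpa using ha0 j
    exact ((mul_eq_zero.1 ((mul_eq_zero.1 this).resolve_left h2)).resolve_left (hr0 j))
  refine ⟨HilbertBasis.mkOfOrthogonalEqBot horth hsp, fun j f => ?_⟩
  rw [HilbertBasis.repr_apply_apply, HilbertBasis.coe_mkOfOrthogonalEqBot]
  exact inner_indicatorConstLp_singleton _ _ _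

end

namespace ModelParams

variable {p : ModelParams}

/-! ### The carrier of the measure -/

/-- The measure in the Nevanlinna representation of `-1/m` is unique. -/
theorem isNevanlinnaMeasure_unique {μ ν : Measure ℝ}
    (hμ : IsNevanlinnaMeasure (fun z => -(p.mFunction z)⁻¹) μ)
    (hν : IsNevanlinnaMeasure (fun z => -(p.mFunction z)⁻¹) ν) : ν = μ := by
  obtain ⟨lam, hm, ht, hr⟩ := p.exists_dispersion_sequence
  obtain ⟨ρ, hρ, hρ0⟩ := p.exists_isNevanlinnaMeasure
  have hcl := isClosed_range_of_tendsto_atTop ht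
  have h : ∀ᵐ x ∂ρ, x ∈ range lam := by
    refine hρ0 _ hcl.measurableSet.compl fun x hx h1 h2 => ?_
    rw [hr] at hx
    exact absurd ⟨h1, h2⟩ hx
  rw [IsNevanlinnaMeasure.unique hm.injective hcl hρ hμ h,
    IsNevanlinnaMeasure.unique hm.injective hcl hρ hν h]

theorem measure_eq_zero_of_sin_eq_zero {μ : Measure ℝ}
    (hμ : IsNevanlinnaMeasure (fun z => -(p.mFunction z)⁻¹) μ) {s : Set ℝ} (hs : MeasurableSet s)
    (h : ∀ x ∈ s, 0 < x → p.Dispersion x → Real.sin (√x * p.l) = 0) : μ s = 0 := by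
  obtain ⟨ρ, hρ, hρ0⟩ := p.exists_isNevanlinnaMeasure
  rw [isNevanlinnaMeasure_unique hρ hμ]
  exact hρ0 s hs h

theorem ae_mem_range {μ : Measure ℝ}
    (hμ : IsNevanlinnaMeasure (fun z => -(p.mFunction z)⁻¹) μ) {lam : ℕ → ℝ}
    (hr : range lam = {x | 0 < x ∧ p.Dispersion x}) : ∀ᵐ x ∂μ, x ∈ range lam := by
  refine measure_eq_zero_of_sin_eq_zero hμ (countable_range lam).measurableSet.compl
    fun x hx h1 h2 => ?_
  rw [hr] at hx
  exact absurd ⟨h1, h2⟩ hx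

/-! ### The non-degenerate case -/

theorem Nondegenerate.sin_ne_zero (hn : p.Nondegenerate) {x : ℝ} (hx : 0 < x)
    (h : p.Dispersion x) : Real.sin (√x * p.l) ≠ 0 := by
  intro hs
  have h1 := h.mul_sin_eq hx
  have hk := (Real.sqrt_pos.2 hx).ne'
  rw [hs, mul_zero, eq_comm, mul_eq_zero] at h1
  have h2 := sub_eq_zero.1 (h1.resolve_left (by simpa using hk))
  have cs := Real.sin_sq_add_cos_sq (√x * p.l)
  rw [hs, h2] at cs
  exact hn.1 (by linear_combination cs)

theorem Nondegenerate.pole_ne (hn : p.Nondegenerate) {x : ℝ} (h : p.Dispersion x) : p.η ^ 2 * x - p.γ ≠ 0 := by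
  intro h0
  have hη : p.η ^ 2 ≠ 0 := pow_ne_zero 2 p.η_ne
  have hx' : p.γ / p.η ^ 2 = x := by rw [div_eq_iff hη]; linear_combination -h0
  refine hn.2 ?_
  rw [hx']
  have := h
  rw [Dispersion, h0, zero_mul, sub_zero] at this
  exact this

/-- In the non-degenerate case the closed form of the deficiency vectors persists at the
eigenvalues. -/
theorem Nondegenerate.admissible (hn : p.Nondegenerate) {x : ℝ} (hx : 0 < x)
    (h : p.Dispersion x) : p.Admissible (√x : ℝ) where
  ne_zero := by exact_mod_cast (Real.sqrt_pos.2 hx).ne'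
  cos_ne := by
    intro h0
    have h1 : p.cosAngle - Real.cos (√x * p.l) = 0 := by exact_mod_cast h0
    have h2 := h.mul_sin_eq hx
    rw [show Real.cos (√x * p.l) - p.cosAngle = 0 by linear_combination -h1, mul_zero] at h2
    exact mul_ne_zero (hn.pole_ne h) (hn.sin_ne_zero hx h) h2
  pole_ne := by
    have h1 := hn.pole_ne h
    rw [← Complex.ofReal_pow (√x), Real.sq_sqrt hx.le]
    exact_mod_cast fun h0 => h1 (by linear_combination -h0)

theorem Nondegenerate.kerVec_mem (hn : p.Nondegenerate) {x : ℝ} (hx : 0 < x)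
    (h : p.Dispersion x) : ∃ h : p.kerVec (√x : ℝ) ∈ p.modelOp.domain,
      p.modelOp ⟨_, h⟩ = (x : ℂ) • p.kerVec (√x : ℝ) ∧ p.Gamma0 (p.kerVec (√x : ℝ)) = 1 := by
  have ha := hn.admissible hx h
  obtain ⟨h1, h2, h3, h4⟩ := ha.kerVec_mem
  rw [← Complex.ofReal_pow, Real.sq_sqrt hx.le] at h2
  rw [ha.mFun_eq_zero ((p.dispersion_iff hx).1 h)] at h4
  exact ⟨p.mem_modelOp_iff.2 ⟨h1, h4⟩, h2, h3⟩

/-- The eigenvalues are simple. -/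
theorem Nondegenerate.eq_smul_kerVec (hn : p.Nondegenerate) {x : ℝ} (hx : 0 < x)
    (h : p.Dispersion x) {e : PairSpace p.l} (he : e ∈ p.modelOp.domain)
    (ee : p.modelOp ⟨e, he⟩ = (x : ℂ) • e) : e = p.Gamma0 e • p.kerVec (√x : ℝ) := by
  have ha := hn.admissible hx h
  obtain ⟨hm, em, h0⟩ := hn.kerVec_mem hx h
  set φ := p.kerVec (√x : ℝ) with hφ
  set c := p.Gamma0 e with hc
  have hcm := p.modelOp.domain.smul_mem c hm
  have hd : e - c • φ ∈ p.modelOp.domain := p.modelOp.domain.sub_mem he hcm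
  have hsq : (((√x : ℝ) : ℂ)) ^ 2 = x := by exact_mod_cast Real.sq_sqrt hx.le
  have ed : p.modelOp ⟨e - c • φ, hd⟩ = ((√x : ℝ) : ℂ) ^ 2 • (e - c • φ) := by
    have : p.modelOp (⟨e, he⟩ - c • ⟨φ, hm⟩) = p.modelOp ⟨e, he⟩ - c • p.modelOp ⟨φ, hm⟩ := by
      rw [LinearPMap.map_sub, LinearPMap.map_smul]
    rw [ee, em] at this
    refine this.trans ?_
    rw [hsq, smul_sub, smul_comm]
  obtain ⟨hem, -⟩ := p.mem_modelOp_iff.1 he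
  obtain ⟨hφm, -⟩ := p.mem_modelOp_iff.1 hm
  obtain ⟨hdm, hG⟩ := p.mem_modelOp_iff.1 hd
  have hd0 : p.Gamma0 (e - c • φ) = 0 := by
    have hn1 : e - c • φ = e + (-c) • φ := by rw [neg_smul, sub_eq_add_neg]
    rw [hn1, p.Gamma0_add hem (p.maxOp.domain.smul_mem _ hφm), p.Gamma0_smul _ hφm, h0, ← hc]
    ring
  -- the difference `d` has `Γ₀ d = Γ₁ d = 0`, so that all its Cauchy data vanish
  obtain ⟨e1, e2, e3, -⟩ := p.boundary_of_maxOp_eq hdm ed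
  have hη : (p.η : ℂ) ≠ 0 := by exact_mod_cast p.η_ne
  rw [hd0, mul_zero, eq_comm, mul_eq_zero] at e3
  have hs := e3.resolve_left ha.pole_ne
  rw [Gamma1, hs, zero_div, zero_sub, neg_eq_zero] at hG
  rw [hG] at e1
  have hsin : Complex.sin ((√x : ℝ) * p.l) ≠ 0 := by exact_mod_cast hn.sin_ne_zero hx h
  have e1' : p.theta * Complex.sin ((√x : ℝ) * p.l) * rep (dTau p.τ (e - c • φ).fst) 0 = 0 := by
    linear_combination -e1
  have h1 := (mul_eq_zero.1 e1').resolve_left (mul_ne_zero p.theta_ne_zero hsin)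
  exact sub_eq_zero.1 (p.eq_zero_of_cauchy_eq_zero ha.ne_zero hd ed hG h1)

theorem tendsto_sqrt {x : ℝ} (hx : 0 < x) : Tendsto Complex.sqrt (𝓝 (x : ℂ)) (𝓝 (√x : ℝ)) := by
  rw [← sqrt_ofReal_of_pos hx]
  exact (Complex.continuousAt_sqrt (Or.inl hx.le)).tendsto

theorem Nondegenerate.tendsto_gammaField (hn : p.Nondegenerate) {x : ℝ} (hx : 0 < x)
    (h : p.Dispersion x) : Tendsto p.gammaField (𝓝 (x : ℂ)) (𝓝 (p.kerVec (√x : ℝ))) :=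
  (hn.admissible hx h).continuousAt_kerVec.tendsto.comp (tendsto_sqrt hx)

theorem Nondegenerate.tendsto_mFunction (hn : p.Nondegenerate) {x : ℝ} (hx : 0 < x)
    (h : p.Dispersion x) : Tendsto p.mFunction (𝓝 (x : ℂ)) (𝓝 0) := by
  have ha := hn.admissible hx h
  rw [← ha.mFun_eq_zero ((p.dispersion_iff hx).1 h)]
  exact ha.continuousAt_mFun.tendsto.comp (tendsto_sqrt hx)

/-- The masses in terms of the norms of the eigenvectors normalised by `Γ₀ = 1`. -/
theorem Nondegenerate.measure_singleton (hn : p.Nondegenerate) {μ : Measure ℝ}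
    (hμ : IsNevanlinnaMeasure (fun z => -(p.mFunction z)⁻¹) μ) {x : ℝ} (hx : 0 < x)
    (h : p.Dispersion x) : (μ {x}).toReal = (‖p.kerVec (√x : ℝ)‖ ^ 2)⁻¹ := by
  obtain ⟨hm, em, h0⟩ := hn.kerVec_mem hx h
  set φ := p.kerVec (√x : ℝ) with hφ
  have hφ0 : φ ≠ 0 := (hn.admissible hx h).kerVec_ne_zero
  have hin : (inner ℂ φ φ : ℂ) ≠ 0 := by rwa [ne_eq, inner_self_eq_zero]
  have hz : Tendsto (fun y : ℝ => (x + Complex.I * y : ℂ)) (𝓝[>] 0) (𝓝 (x : ℂ)) := by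
    have : Continuous fun y : ℝ => (x + Complex.I * y : ℂ) := by fun_prop
    simpa using (this.tendsto 0).mono_left (nhdsWithin_le_nhds (s := Ioi 0))
  have hlim : Tendsto (fun y : ℝ => (inner ℂ φ (p.gammaField (x + Complex.I * y)))⁻¹) (𝓝[>] 0)
      (𝓝 (inner ℂ φ φ)⁻¹) :=
    (tendsto_const_nhds.inner ((hn.tendsto_gammaField hx h).comp hz)).inv₀ hin
  have heq := tendsto_nhds_unique_of_eventuallyEq (hμ.tendsto_singleton x) hlim (by
    filter_upwards [self_mem_nhdsWithin] with y hy
    have hy' : (y : ℂ) ≠ 0 := by exact_mod_cast (ne_of_gt hy)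
    have him : (x + Complex.I * y : ℂ).im ≠ 0 := by simpa using (ne_of_gt hy)
    have h1 := p.inner_eigenvector_gammaField him hm em
    have h2 := p.mFunction_ne_zero him
    have hI := Complex.I_ne_zero
    rw [h0, map_one, mul_one, add_sub_cancel_left] at h1
    rw [← h1] at h2 ⊢
    field_simp)
  rw [inner_self_eq_norm_sq_to_K] at heq
  have heq' : ((μ {x}).toReal : ℂ) = (((‖φ‖ ^ 2)⁻¹ : ℝ) : ℂ) := by
    rw [heq]; push_cast; rfl
  exact Complex.ofReal_injective heq'

/-- The normalised eigenvectors of the model operator form a Hilbert basis. -/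
theorem Nondegenerate.exists_hilbertBasis (hn : p.Nondegenerate) {lam : ℕ → ℝ}
    (hinj : Function.Injective lam) (hr : range lam = {x | 0 < x ∧ p.Dispersion x}) :
    ∃ b : HilbertBasis ℕ ℂ (PairSpace p.l), ∀ j f,
      b.repr f j = (‖p.kerVec (√(lam j) : ℝ)‖ : ℂ)⁻¹ * inner ℂ (p.kerVec (√(lam j) : ℝ)) f := by
  have hl : ∀ j, 0 < lam j ∧ p.Dispersion (lam j) := fun j => by
    have : lam j ∈ range lam := ⟨j, rfl⟩
    rwa [hr] at this
  set φ : ℕ → PairSpace p.l := fun j => p.kerVec (√(lam j) : ℝ) with hφ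
  have hφ0 : ∀ j, φ j ≠ 0 := fun j => (hn.admissible (hl j).1 (hl j).2).kerVec_ne_zero
  have hnorm : ∀ j, (‖φ j‖ : ℂ) ≠ 0 := fun j => by exact_mod_cast norm_ne_zero_iff.2 (hφ0 j)
  set v : ℕ → PairSpace p.l := fun j => (‖φ j‖ : ℂ)⁻¹ • φ j with hv
  have hinner : ∀ j f, inner ℂ (v j) f = (‖φ j‖ : ℂ)⁻¹ * inner ℂ (φ j) f := fun j f => by
    rw [hv, inner_smul_left, map_inv₀, Complex.conj_ofReal]
  have horth : Orthonormal ℂ v := by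
    rw [orthonormal_iff_ite]
    intro i j
    rw [hinner, hv, inner_smul_right]
    by_cases hij : i = j
    · subst hij
      rw [if_pos rfl, inner_self_eq_norm_sq_to_K]
      have := hnorm i
      simp only [Complex.coe_algebraMap]
      field_simp
    · rw [if_neg hij]
      obtain ⟨h1, e1, -⟩ := hn.kerVec_mem (hl i).1 (hl i).2
      obtain ⟨h2, e2, -⟩ := hn.kerVec_mem (hl j).1 (hl j).2
      have hs := p.modelOp_symmetric ⟨_, h2⟩ ⟨_, h1⟩
      simp only [e1, e2, inner_smul_left, inner_smul_right, Complex.conj_ofReal] at hs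
      have hne : (lam i : ℂ) - lam j ≠ 0 := by
        exact_mod_cast sub_ne_zero.2 fun h => hij (hinj h)
      have h0 : inner ℂ (φ i) (φ j) = 0 := by
        refine (mul_eq_zero.1 ?_).resolve_left hne
        simp only [hφ]
        linear_combination -hs
      rw [h0, mul_zero, mul_zero]
  have hsp : (Submodule.span ℂ (range v))ᗮ = ⊥ := by
    rw [eq_bot_iff]
    intro f hf
    rw [Submodule.mem_orthogonal] at hf
    rw [Submodule.mem_bot]
    have hfφ : ∀ j, inner ℂ (φ j) f = 0 := fun j => by
      have := hf (v j) (Submodule.subset_span ⟨j, rfl⟩)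
      rw [hinner] at this
      exact (mul_eq_zero.1 this).resolve_left (inv_ne_zero (hnorm j))
    obtain ⟨ι, b, w, hb⟩ := p.exists_hilbertBasis_modelOp
    refine b.repr.injective ?_
    ext i
    rw [map_zero, b.repr_apply_apply]
    obtain ⟨hw, hm, he⟩ := hb i
    have hsq : (((√(w i) : ℝ) : ℂ)) ^ 2 = w i := by exact_mod_cast Real.sq_sqrt hw.le
    have hd : p.Dispersion (w i) := (p.dispersion_iff hw).2 (p.disp_eq_zero_of_eigen
      (by exact_mod_cast (Real.sqrt_pos.2 hw).ne') (b.orthonormal.ne_zero i) hm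
      (by rw [hsq]; exact he))
    obtain ⟨j, hj⟩ : w i ∈ range lam := by rw [hr]; exact ⟨hw, hd⟩
    rw [hn.eq_smul_kerVec hw hd hm he, inner_smul_left, ← hj]
    exact mul_eq_zero_of_right _ (hfφ j)
  refine ⟨HilbertBasis.mkOfOrthogonalEqBot horth hsp, fun j f => ?_⟩
  rw [HilbertBasis.repr_apply_apply, HilbertBasis.coe_mkOfOrthogonalEqBot, hinner]


/-- The functional model of the model operator: `U` maps the normalised eigenvectors to the
normalised indicator functions of the atoms of `μ`. -/
theorem Nondegenerate.exists_functionalModel (hn : p.Nondegenerate) {μ : Measure ℝ}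
    (hμ : IsNevanlinnaMeasure (fun z => -(p.mFunction z)⁻¹) μ) :
    ∃ U : PairSpace p.l ≃ₗᵢ[ℂ] Lp ℂ 2 (ENNReal.ofReal Real.pi • μ),
      IsFunctionalModel p p.modelOp μ U := by
  obtain ⟨lam, hmono, -, hr⟩ := p.exists_dispersion_sequence
  have hl : ∀ j, 0 < lam j ∧ p.Dispersion (lam j) := fun j => by
    have : lam j ∈ range lam := ⟨j, rfl⟩
    rwa [hr] at this
  have hae := ae_mem_range hμ hr
  have hpi := Real.pi_pos
  have hspi : (√Real.pi : ℂ) ≠ 0 := by exact_mod_cast (Real.sqrt_pos.2 hpi).ne'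
  have hspi2 : (√Real.pi : ℂ) ^ 2 = Real.pi := by exact_mod_cast Real.sq_sqrt hpi.le
  set φ : ℕ → PairSpace p.l := fun j => p.kerVec (√(lam j) : ℝ) with hφ
  have hφ0 : ∀ j, φ j ≠ 0 := fun j => (hn.admissible (hl j).1 (hl j).2).kerVec_ne_zero
  have hnorm : ∀ j, (‖φ j‖ : ℂ) ≠ 0 := fun j => by exact_mod_cast norm_ne_zero_iff.2 (hφ0 j)
  obtain ⟨b₁, hb₁⟩ := hn.exists_hilbertBasis hmono.injective hr
  set ν : Measure ℝ := ENNReal.ofReal Real.pi • μ with hν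
  have hνμ : ∀ {P : ℝ → Prop}, (∀ᵐ x ∂μ, P x) → ∀ᵐ x ∂ν, P x := fun h =>
    Measure.ae_smul_measure h _
  have hνr : ∀ j, (ν {lam j}).toReal = Real.pi * (‖φ j‖ ^ 2)⁻¹ := fun j => by
    rw [hν, Measure.smul_apply, smul_eq_mul, ENNReal.toReal_mul, ENNReal.toReal_ofReal hpi.le,
      hn.measure_singleton hμ (hl j).1 (hl j).2]
  have hνt : ∀ j, ν {lam j} ≠ ⊤ := fun j => by
    rw [hν, Measure.smul_apply, smul_eq_mul]
    exact ENNReal.mul_ne_top ENNReal.ofReal_ne_top (hμ.measure_singleton_lt_top _).ne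
  -- the phase `-i` makes the values of `U f` equal to the boundary values of `g_+`
  obtain ⟨b₂, hb₂⟩ := exists_hilbertBasis_atoms hmono.injective (hνμ hae) hνt
    (a := fun j => -Complex.I * ((√Real.pi : ℂ)⁻¹ * ‖φ j‖)) (fun j => by
      have := norm_ne_zero_iff.2 (hφ0 j)
      rw [hνr, norm_mul, norm_mul, norm_neg, Complex.norm_I, norm_inv, Complex.norm_real,
        Complex.norm_real, norm_norm, Real.norm_of_nonneg (Real.sqrt_nonneg _), one_mul, mul_pow,
        inv_pow, Real.sq_sqrt hpi.le]
      field_simp)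
  set U := b₁.repr.trans b₂.repr.symm with hU
  -- the value of `U f` at an atom
  have hval : ∀ f j, U f (lam j) = -Complex.I / √Real.pi * inner ℂ (φ j) f := fun f j => by
    have h1 := hb₂ j (U f)
    have h2 : b₂.repr (U f) = b₁.repr f := by simp [hU]
    have h3 := hnorm j
    have hI := Complex.I_sq
    rw [h2, hb₁, hνr] at h1
    simp only [map_mul, map_neg, Complex.conj_I, map_inv₀, Complex.conj_ofReal] at h1
    push_cast at h1
    rw [← hspi2] at h1
    change (‖φ j‖ : ℂ)⁻¹ * inner ℂ (φ j) f = _ at h1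
    field_simp at h1 ⊢
    linear_combination Complex.I * h1 + √Real.pi * U f (lam j) * hI
  have hres : ∀ z : ℂ, z.im ≠ 0 → ∀ f j, U (resolventOp p.modelOp z f) (lam j) =
      ((lam j : ℂ) - z)⁻¹ * U f (lam j) := fun z hz f j => by
    obtain ⟨hm, em, -⟩ := hn.kerVec_mem (hl j).1 (hl j).2
    obtain ⟨hm', em'⟩ := p.modelOp_resolventOp hz f
    have hs := p.modelOp_symmetric ⟨_, hm'⟩ ⟨_, hm⟩
    rw [em, em'] at hs
    simp only [inner_add_right, inner_smul_left, inner_smul_right, Complex.conj_ofReal] at hs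
    have h0 := sub_ne_zero_of_im_ne hz (lam j)
    rw [hval, hval, eq_inv_mul_iff_mul_eq₀ h0]
    simp only [hφ]
    linear_combination -(-Complex.I / √Real.pi) * hs
  refine ⟨U, fun z hz => ⟨_, p.isResolvent_kreinOp hz⟩, fun f => ?_,
    fun z hz => p.inResolventSet_modelOp hz, fun z hz f => ?_, fun z hz f g => ?_⟩
  · filter_upwards [hae] with t ht
    obtain ⟨j, rfl⟩ := ht
    obtain ⟨hx, hd⟩ := hl j
    have hconj : Tendsto (fun z : ℂ => (starRingEnd ℂ) z) (𝓝 (lam j : ℂ)) (𝓝 (lam j : ℂ)) := by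
      simpa using Complex.continuous_conj.tendsto (lam j : ℂ)
    have h1 : Tendsto (fun z => inner ℂ (p.gammaField ((starRingEnd ℂ) z)) f) (𝓝 (lam j : ℂ))
        (𝓝 (inner ℂ (φ j) f)) :=
      ((hn.tendsto_gammaField hx hd).comp hconj).inner tendsto_const_nhds
    have h2 : Tendsto (fun z => p.mFunction z + Complex.I) (𝓝 (lam j : ℂ))
        (𝓝 (0 + Complex.I)) := (hn.tendsto_mFunction hx hd).add tendsto_const_nhds
    have h3 := (h1.div h2 (by simp)).const_mul (1 / (√Real.pi : ℂ))
    have h4 : U f (lam j) = 1 / (√Real.pi : ℂ) * (inner ℂ (φ j) f / (0 + Complex.I)) := by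
      rw [hval, zero_add, Complex.div_I]
      ring
    rw [h4]
    refine (h3.mono_left nhdsWithin_le_nhds).congr' ?_
    filter_upwards [self_mem_nhdsWithin] with z hz
    exact (p.gPlus_eq hz f).symm
  · filter_upwards [hae] with t ht
    obtain ⟨j, rfl⟩ := ht
    exact hres z hz f j
  · have h1 : inner ℂ g (genResolvent p.modelOp z f) =
        inner ℂ (WithLp.toLp 2 (g, 0) : PairSpace p.l)
          (resolventOp p.modelOp z (WithLp.toLp 2 (f, 0))) := by
      simp [WithLp.prod_inner_apply, genResolvent]
    rw [h1, ← U.inner_map_map, L2.inner_def]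
    have h2 : ∀ h : ℝ → ℂ, ∫ t, h t ∂ν = Real.pi * ∫ t, h t ∂μ := fun h => by
      rw [hν, integral_smul_measure, ENNReal.toReal_ofReal hpi.le, Complex.real_smul]
    rw [h2]
    congr 1
    refine integral_congr_ae ?_
    filter_upwards [hae] with t ht
    obtain ⟨j, rfl⟩ := ht
    rw [RCLike.inner_apply, hres z hz]

end ModelParams

/-! ### The homogenised operator -/

namespace HomParams

variable (q : HomParams)

theorem sq_η : q.toModel.η ^ 2 = q.l₁ + q.l₃ :=
  Real.sq_sqrt (add_pos q.l₁_pos q.l₃_pos).le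

theorem homOp_eq_modelOp : q.homOp = q.toModel.modelOp := by
  have hη2 : (√(q.l₁ + q.l₃) : ℂ) ^ 2 = q.l₁ + q.l₃ := by exact_mod_cast q.sq_η
  have hdom : ∀ f, f ∈ q.homOp.domain ↔ f ∈ q.toModel.modelOp.domain := by
    intro f
    have hf := q.toModel.mem_modelOp_iff (f := f)
    constructor
    · rintro ⟨h1, h2, h3⟩
      exact hf.2 ⟨⟨h1, h2⟩, sub_eq_zero.2 (h3.symm.trans h2.symm)⟩
    · intro h
      obtain ⟨⟨h1, h2⟩, h3⟩ := hf.1 h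
      exact ⟨h1, h2, h2.symm.trans (sub_eq_zero.1 h3).symm⟩
  refine LinearPMap.ext (Submodule.ext hdom) fun f hf hf' => ?_
  refine WithLp.ofLp_injective 2 (Prod.ext rfl ?_)
  change -(1 / (√(q.l₁ + q.l₃) : ℂ)) *
      (rep (dTau q.τ f.fst) 0 + q.phase * rep (dTau q.τ f.fst) q.l₂) +
    ((q.l₁ + q.l₃)⁻¹ * (q.l₁ / q.a₁ + q.l₃ / q.a₃)⁻¹ * (q.τ / q.ε) ^ 2 : ℝ) * f.snd =
    -((√(q.l₁ + q.l₃) : ℂ)⁻¹ * (rep (dTau q.τ f.fst) 0 - -q.phase * rep (dTau q.τ f.fst) q.l₂)) +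
      (q.γ : ℂ) * ((√(q.l₁ + q.l₃) : ℂ) ^ 2)⁻¹ * f.snd
  rw [hη2, γ]
  push_cast
  ring

/-- The vector `-ξ_τ e^{iτl₂}` has the components `(a₁/l₁) cos τ + a₃/l₃` and `(a₁/l₁) sin τ`. -/
theorem neg_ξ_mul_exp : -q.ξ * Complex.exp (Complex.I * q.τ * q.l₂) =
    ((q.a₁ / q.l₁ * Real.cos q.τ + q.a₃ / q.l₃ : ℝ) : ℂ) +
      ((q.a₁ / q.l₁ * Real.sin q.τ : ℝ) : ℂ) * Complex.I := by
  have h1 : Complex.exp (Complex.I * q.τ * (q.l₁ + q.l₃)) *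
      Complex.exp (Complex.I * q.τ * q.l₂) = Complex.cos q.τ + Complex.sin q.τ * Complex.I := by
    have hs : (q.l₁ : ℂ) + q.l₂ + q.l₃ = 1 := by exact_mod_cast q.sum_l
    rw [← Complex.exp_add, ← Complex.exp_mul_I]
    congr 1
    linear_combination Complex.I * q.τ * hs
  have h2 : Complex.exp (-(Complex.I * q.τ * q.l₂)) *
      Complex.exp (Complex.I * q.τ * q.l₂) = 1 := by
    rw [← Complex.exp_add, neg_add_cancel, Complex.exp_zero]
  rw [ξ]
  push_cast
  linear_combination (q.a₁ / q.l₁ : ℂ) * h1 + (q.a₃ / q.l₃ : ℂ) * h2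

theorem norm_ξ : ‖q.ξ‖ = √((q.a₁ / q.l₁ * Real.cos q.τ + q.a₃ / q.l₃) ^ 2 +
    q.a₁ ^ 2 / q.l₁ ^ 2 * Real.sin q.τ ^ 2) := by
  have h := congrArg norm q.neg_ξ_mul_exp
  have he : Complex.I * q.τ * q.l₂ = ((q.τ * q.l₂ : ℝ) : ℂ) * Complex.I := by push_cast; ring
  rw [norm_mul, norm_neg, he, Complex.norm_exp_ofReal_mul_I, mul_one] at h
  rw [h, Complex.norm_add_mul_I]
  congr 1
  ring

theorem cosAngle_toModel : q.toModel.cosAngle = (q.a₁ / q.l₁ * Real.cos q.τ + q.a₃ / q.l₃) /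
    √((q.a₁ / q.l₁ * Real.cos q.τ + q.a₃ / q.l₃) ^ 2 +
      q.a₁ ^ 2 / q.l₁ ^ 2 * Real.sin q.τ ^ 2) := by
  have e : Complex.exp (Complex.I * q.τ * q.l₂) * (starRingEnd ℂ) (-q.phase) =
      (-q.ξ * Complex.exp (Complex.I * q.τ * q.l₂)) / (‖q.ξ‖ : ℝ) := by
    rw [phase, map_neg, map_div₀, Complex.conj_conj, Complex.conj_ofReal]
    ring
  change (Complex.exp (Complex.I * q.τ * q.l₂) * (starRingEnd ℂ) (-q.phase)).re = _
  rw [e, Complex.div_ofReal_re, neg_ξ_mul_exp, norm_ξ, Complex.add_re, Complex.re_ofReal_mul,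
    Complex.I_re, mul_zero, add_zero, Complex.ofReal_re]

theorem dispersion_iff (x : ℝ) : q.toModel.Dispersion x ↔
    Real.cos (√x * q.l₂) -
        ((q.l₁ + q.l₃) * x - (q.l₁ / q.a₁ + q.l₃ / q.a₃)⁻¹ * (q.τ / q.ε) ^ 2) *
          (Real.sin (√x * q.l₂) / (2 * √x)) =
      (q.a₁ / q.l₁ * Real.cos q.τ + q.a₃ / q.l₃) /
        √((q.a₁ / q.l₁ * Real.cos q.τ + q.a₃ / q.l₃) ^ 2 +
          q.a₁ ^ 2 / q.l₁ ^ 2 * Real.sin q.τ ^ 2) := by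
  rw [ModelParams.Dispersion, sq_η, cosAngle_toModel]
  exact Iff.rfl

theorem dispersion_iff_of_symmetric (ha : q.a₁ = q.a₃) (hl : q.l₁ = q.l₃) (x : ℝ) :
    q.toModel.Dispersion x ↔
      Real.cos (√x * q.l₂) -
          ((1 - q.l₂) * x - q.a₁ / (1 - q.l₂) * (q.τ / q.ε) ^ 2) *
            (Real.sin (√x * q.l₂) / (2 * √x)) = |Real.cos (q.τ / 2)| := by
  have h1 : 1 - q.l₂ = q.l₁ + q.l₃ := by linear_combination -q.sum_l
  have hl1 := q.l₁_pos
  have ha1 := q.a₁_pos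
  have h2 : (q.l₁ / q.a₁ + q.l₃ / q.a₃)⁻¹ = q.a₁ / (1 - q.l₂) := by
    rw [h1, ← ha, ← hl, ← add_div, inv_div]
  have h3 : (q.a₁ / q.l₁ * Real.cos q.τ + q.a₃ / q.l₃) /
        √((q.a₁ / q.l₁ * Real.cos q.τ + q.a₃ / q.l₃) ^ 2 +
          q.a₁ ^ 2 / q.l₁ ^ 2 * Real.sin q.τ ^ 2) = |Real.cos (q.τ / 2)| := by
    have hA : 0 < q.a₁ / q.l₁ := by positivity
    have hc : Real.cos q.τ = 2 * Real.cos (q.τ / 2) ^ 2 - 1 := by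
      rw [← Real.cos_two_mul]; congr 1; ring
    have hs : Real.sin q.τ = 2 * Real.sin (q.τ / 2) * Real.cos (q.τ / 2) := by
      rw [← Real.sin_two_mul]; congr 1; ring
    have cs := Real.sin_sq_add_cos_sq (q.τ / 2)
    rw [← ha, ← hl, hc, hs, ← div_pow]
    generalize q.a₁ / q.l₁ = A at *
    generalize Real.cos (q.τ / 2) = C at *
    generalize Real.sin (q.τ / 2) = S at *
    have e : (A * (2 * C ^ 2 - 1) + A) ^ 2 + A ^ 2 * (2 * S * C) ^ 2 = (2 * A * |C|) ^ 2 := by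
      rw [mul_pow _ |C|, sq_abs]
      linear_combination 4 * A ^ 2 * C ^ 2 * cs
    rw [e, Real.sqrt_sq (by positivity)]
    -- where `cos (τ / 2) = 0` the quotient is `0 / 0`, with the correct value `0`
    rcases eq_or_ne C 0 with h0 | h0
    · simp [h0]
    · rw [div_eq_iff (by positivity)]
      linear_combination -2 * A * sq_abs C
  rw [dispersion_iff, h2, h3, h1]

end HomParams

/-! ### The characteristic function -/

theorem inv_one_add_charFun {m : ℂ → ℂ} {z : ℂ} (h0 : m z ≠ 0) (h1 : m z + Complex.I ≠ 0) :
    1 / (1 + charFun m z) = 1 / 2 * (1 + Complex.I / m z) := by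
  have h2 : 1 + charFun m z = 2 * m z / (m z + Complex.I) := by
    rw [charFun, add_comm Complex.I]
    field_simp
    ring
  rw [h2]
  field_simp

namespace ModelParams

variable (p : ModelParams)

theorem half_one_add_I_div_mFunction {z : ℂ} (hz : z.im ≠ 0) :
    1 / 2 * (1 + Complex.I / p.mFunction z) =
      1 / 2 - Complex.I * Complex.sqrt z *
          (p.cosAngle - Complex.cos (Complex.sqrt z * p.l)) * (p.η ^ 2 * z - p.γ) /
        ((p.η ^ 2 * z - p.γ) * Complex.sin (Complex.sqrt z * p.l) +
          2 * Complex.sqrt z * (p.cosAngle - Complex.cos (Complex.sqrt z * p.l))) := by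
  have h := (p.admissible_sqrt hz).neg_inv_mFun
  rw [disp, complexSqrt_sq] at h
  change -(p.mFunction z)⁻¹ = _ at h
  rw [div_eq_mul_inv Complex.I]
  linear_combination -(Complex.I / 2) * h

end ModelParams

end

end StrausModel

theorem mainTheorem5 :
    -- The model operator.
    (∀ p : ModelParams, ∃ m : ℂ → ℂ, IsMFunction p m ∧
      (∀ z : ℂ, 0 < z.im →
        1 / (1 + charFun m z) = 1 / 2 * (1 + Complex.I / m z) ∧
        1 / 2 * (1 + Complex.I / m z) =
          1 / 2 - Complex.I * Complex.sqrt z *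
              (p.cosAngle - Complex.cos (Complex.sqrt z * p.l)) * (p.η ^ 2 * z - p.γ) /
            ((p.η ^ 2 * z - p.γ) * Complex.sin (Complex.sqrt z * p.l) +
              2 * Complex.sqrt z * (p.cosAngle - Complex.cos (Complex.sqrt z * p.l)))) ∧
      ∃ μ : Measure ℝ,
        IsNevanlinnaMeasure (fun z => -(m z)⁻¹) μ ∧
        (∀ ν : Measure ℝ, IsNevanlinnaMeasure (fun z => -(m z)⁻¹) ν → ν = μ) ∧
        (∃ C₀ C₁ : ℂ, ∀ z : ℂ, 0 < z.im →
          1 / (1 + charFun m z) = C₀ + C₁ * z - Complex.I / 2 * ∫ σ, nevKernel z σ ∂μ) ∧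
        ∃ lam : ℕ → ℝ,
          StrictMono lam ∧ Tendsto lam atTop atTop ∧
          Set.range lam = {x : ℝ | 0 < x ∧ p.Dispersion x} ∧
          μ = Measure.sum (fun j => μ {lam j} • Measure.dirac (lam j)) ∧
          (∀ j, Real.sin (√(lam j) * p.l) ≠ 0 →
            0 < p.massDenom (lam j) ∧
            μ {lam j} =
              ENNReal.ofReal (2 * (p.η ^ 2 * lam j - p.γ) ^ 2 / p.massDenom (lam j))) ∧
          (∀ j, Real.sin (√(lam j) * p.l) = 0 → μ {lam j} = 0) ∧
          (p.Nondegenerate →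
            (∀ j, Real.sin (√(lam j) * p.l) ≠ 0 ∧ 0 < μ {lam j}) ∧
            ∃ U : PairSpace p.l ≃ₗᵢ[ℂ] Lp ℂ 2 (ENNReal.ofReal Real.pi • μ),
              IsFunctionalModel p p.modelOp μ U)) ∧
    -- The homogenised operator.
    (∀ q : HomParams,
      q.homOp = q.toModel.modelOp ∧
      (∀ x : ℝ, 0 < x → (q.toModel.Dispersion x ↔
        Real.cos (√x * q.l₂) -
            ((q.l₁ + q.l₃) * x - (q.l₁ / q.a₁ + q.l₃ / q.a₃)⁻¹ * (q.τ / q.ε) ^ 2) *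
              (Real.sin (√x * q.l₂) / (2 * √x)) =
          (q.a₁ / q.l₁ * Real.cos q.τ + q.a₃ / q.l₃) /
            √((q.a₁ / q.l₁ * Real.cos q.τ + q.a₃ / q.l₃) ^ 2 +
              q.a₁ ^ 2 / q.l₁ ^ 2 * Real.sin q.τ ^ 2))) ∧
      (q.a₁ = q.a₃ → q.l₁ = q.l₃ → ∀ x : ℝ, 0 < x → (q.toModel.Dispersion x ↔
        Real.cos (√x * q.l₂) -
            ((1 - q.l₂) * x - q.a₁ / (1 - q.l₂) * (q.τ / q.ε) ^ 2) *
              (Real.sin (√x * q.l₂) / (2 * √x)) = |Real.cos (q.τ / 2)|)) ∧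
      (∀ (m : ℂ → ℂ) (μ : Measure ℝ), IsMFunction q.toModel m →
        IsNevanlinnaMeasure (fun z => -(m z)⁻¹) μ → q.toModel.Nondegenerate →
        ∃ U : PairSpace q.l₂ ≃ₗᵢ[ℂ] Lp ℂ 2 (ENNReal.ofReal Real.pi • μ),
          IsFunctionalModel q.toModel q.homOp μ U)) := by
  refine ⟨fun p => ⟨p.mFunction, p.isMFunction_mFunction, fun z hz => ?_, ?_⟩, fun q => ?_⟩
  · exact ⟨inv_one_add_charFun (p.mFunction_ne_zero hz.ne') (p.mFunction_add_I_ne_zero hz),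
      p.half_one_add_I_div_mFunction hz.ne'⟩
  · obtain ⟨μ, hμ, -⟩ := p.exists_isNevanlinnaMeasure
    obtain ⟨lam, hmono, htend, hr⟩ := p.exists_dispersion_sequence
    have hlam : ∀ j, 0 < lam j ∧ p.Dispersion (lam j) := fun j => by
      have : lam j ∈ range lam := ⟨j, rfl⟩
      rwa [hr] at this
    refine ⟨μ, hμ, fun ν hν => ModelParams.isNevanlinnaMeasure_unique hμ hν, ?_, lam, hmono,
      htend, hr, eq_sum_dirac_of_ae_mem_range hmono.injective (ModelParams.ae_mem_range hμ hr),
      fun j hs => ?_, fun j hs => ?_, fun hn => ⟨fun j => ?_, hn.exists_functionalModel hμ⟩⟩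
    · obtain ⟨-, a, b, -, hF⟩ := hμ
      refine ⟨1 / 2 - Complex.I / 2 * a, -(Complex.I / 2) * b, fun z hz => ?_⟩
      rw [inv_one_add_charFun (p.mFunction_ne_zero hz.ne') (p.mFunction_add_I_ne_zero hz),
        div_eq_mul_inv Complex.I]
      linear_combination -(Complex.I / 2) * hF z hz
    · obtain ⟨hx, hd⟩ := hlam j
      exact ⟨hd.massDenom_pos hx hs, hd.measure_singleton hμ hx hs⟩
    · refine ModelParams.measure_eq_zero_of_sin_eq_zero hμ (measurableSet_singleton _) ?_
      rintro x rfl - -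
      exact hs
    · obtain ⟨hx, hd⟩ := hlam j
      have hs := hn.sin_ne_zero hx hd
      have hd0 := hd.massDenom_pos hx hs
      refine ⟨hs, ?_⟩
      rw [hd.measure_singleton hμ hx hs, ENNReal.ofReal_pos]
      have := hn.pole_ne hd
      positivity
  · refine ⟨q.homOp_eq_modelOp, fun x _ => q.dispersion_iff x,
      fun ha hl x _ => q.dispersion_iff_of_symmetric ha hl x, fun m μ hm hμ hn => ?_⟩
    rw [q.homOp_eq_modelOp]
    exact hn.exists_functionalModel
      (hμ.congr fun z hz => by rw [hm.eq_mFunction (ne_of_gt hz)])
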